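/- All pictures below are semigroup pictures over the presentation $\mathcal P=\langle x\mid x=x^2\rangle$, considered up to isomorphism: a finite picture consists of a frame, finitely many transistors, each of type $(x,x^2)$ (one top contact, two bottom contacts) or $(x^2,x)$ (two top contacts, one bottom contact), and wires, each leading from a contact on the top of the frame or on the bottom of a transistor to a contact on the bottom of the frame or on the top of a transistor, such that every contact lies on exactly one wire and "lies above" is a strict partial order on the transistors. In an $(x^n,x^m)$-picture the frame has $n$ top and $m$ bottom contacts, in fixed order. A dipole is an $(x,x^2)$-transistor whose two bottom contacts are joined in order to the two top contacts of an $(x^2,x)$-transistor, or an $(x^2,x)$-transistor whose bottom contact is joined to the top contact of an $(x,x^2)$-transistor. Dipoles are removed by deleting both transistors and gluing the wires above to those below, in order. A picture is reduced if it contains no dipole. A picture is annular if it can be drawn without crossings, respecting the orientations of the transistors and of the frame, in an annulus whose inner and outer boundary circles carry the top and the bottom of the frame. Consider either the class of annular pictures or the class of all ("braided") finite pictures. The $(x,x)$-pictures of the class modulo dipoles form a group under concatenation; it is Thompson's group $T=\mathcal D_a(\mathcal P,x)$ in the annular case and $V=\mathcal D_b(\mathcal P,x)$ in the braided case. The diagram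 complex ($\tilde K_a(\mathcal P,x)$, respectively $\tilde K_b(\mathcal P,x)$) is the cubical complex whose vertices are the $(x,x^n)$-pictures of the class, $n\ge 1$, modulo dipoles and modulo concatenation on the right with permutation pictures (pictures without transistors) of the class. Its $k$-cubes are given by reduced $(x,x^n)$-pictures of the class with $k$ of their maximal transistors marked; the $2^k$ corners are obtained by leaving off subsets of the marked transistors. The group acts on the left by concatenation, and the base vertex $*$ is the one without transistors. A hyperplane is a class of edges under the equivalence relation generated by being opposite in a square. The positive half-space $H^+$ of a hyperplane $H$ is the part of the complement of $H$ that is not connected to $*$; write $H_1^+\le H_2^+$ if $H_2^+\subseteq H_1^+$. A profile is a non-empty set $\mathcal H$ of positive half-spaces such that (1) any finitely many members of $\mathcal H$ have non-empty intersection, (2) $(\mathcal H,\le)$ has no maximal element, and (3) if $H_1^+\in\mathcal H$ and $H_2^+\le H_1^+$, then $H_2^+\in\mathcal H$. The group acts on profiles as follows: $g*\mathcal H$ is the set of all positive half-spaces $K^+$ such that $K^+\le g\cdot H^+$ for some $H^+\in\mathcal H$ for which $g\cdot H^+$ is again a positive half-space. The profile $\Delta_\infty$ is the one of the full infinite ordered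 rooted binary tree, regarded as an infinite picture all of whose transistors are of type $(x,x^2)$ and in which no wire reaches the bottom of the frame: it consists of the half-spaces $H_t^+$, $t$ a transistor of the tree, where $H_t$ is the hyperplane of the edge that adds $t$ to the finite picture consisting of the transistors strictly above $t$. **Theorem.** $\Delta_\infty$ is the only profile of $\tilde K_a(\mathcal P,x)$ that is fixed by all of $T$, and $\Delta_\infty$ is the only profile of $\tilde K_b(\mathcal P,x)$ that is fixed by all of $V$; in both cases $\Delta_\infty$ is a profile and is fixed. -/

import Mathlib

/-! Pictures over the semigroup presentation `⟨x ∣ x = x²⟩`, their annular and braided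
diagram groups, the associated cubical complexes, and profiles. -/

namespace DiagramProfile

/-- The contacts from which a wire of a picture can start: a point on the top of the frame (which
carries `n` contacts), the left (`false`) or right (`true`) contact on the bottom of an
`(x, x²)`-transistor `s : S`, or the only contact on the bottom of an `(x², x)`-transistor `t : M`.
All wires carry the label `x`. -/
inductive Source (n : ℕ) (S M : Type) : Type
  | frame (i : Fin n) : Source n S M
  | split (s : S) (b : Bool) : Source n S M
  | merge (t : M) : Source n S M

/-- The contacts at which a wire of a picture can end: a point on the bottom of the frame (which
carries `m` contacts), the only contact on the top of an `(x, x²)`-transistor `s : S`, or the left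
(`false`) or right (`true`) contact on the top of an `(x², x)`-transistor `t : M`. -/
inductive Sink (m : ℕ) (S M : Type) : Type
  | frame (j : Fin m) : Sink m S M
  | split (s : S) : Sink m S M
  | merge (t : M) (b : Bool) : Sink m S M

namespace Source

variable {n : ℕ} {S M S' M' S'' M'' : Type}

/-- Relabel the transistors of a contact. -/
def map (f : S → S') (g : M → M') : Source n S M → Source n S' M'
  | frame i => frame i
  | split s b => split (f s) b
  | merge t => merge (g t)

/-- The transistor that carries a contact (`none` for the frame). -/
def transistor : Source n S M → Option (S ⊕ M)
  | frame _ => none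
  | split s _ => some (Sum.inl s)
  | merge t => some (Sum.inr t)

theorem map_map (f : S → S') (g : M → M') (f' : S' → S'') (g' : M' → M'') (p : Source n S M) :
    (p.map f g).map f' g' = p.map (f' ∘ f) (g' ∘ g) := by
  cases p <;> rfl

theorem map_id' (f : S → S) (g : M → M) (hf : ∀ s, f s = s) (hg : ∀ t, g t = t)
    (p : Source n S M) : p.map f g = p := by
  cases p <;> simp [map, hf, hg]

end Source

namespace Sink

variable {m : ℕ} {S M S' M' S'' M'' : Type}

/-- Relabel the transistors of a contact. -/
def map (f : S → S') (g : M → M') : Sink m S M → Sink m S' M'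
  | frame j => frame j
  | split s => split (f s)
  | merge t b => merge (g t) b

/-- The transistor that carries a contact (`none` for the frame). -/
def transistor : Sink m S M → Option (S ⊕ M)
  | frame _ => none
  | split s => some (Sum.inl s)
  | merge t _ => some (Sum.inr t)

theorem map_map (f : S → S') (g : M → M') (f' : S' → S'') (g' : M' → M'') (p : Sink m S M) :
    (p.map f g).map f' g' = p.map (f' ∘ f) (g' ∘ g) := by
  cases p <;> rfl

theorem map_id' (f : S → S) (g : M → M) (hf : ∀ s, f s = s) (hg : ∀ t, g t = t)
    (p : Sink m S M) : p.map f g = p := by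
  cases p <;> simp [map, hf, hg]

end Sink

/-- The transistor `x` lies directly above the transistor `y`: some wire leads from the bottom of
`x` to the top of `y`. -/
def Above {n m : ℕ} {S M : Type} (w : Source n S M → Sink m S M) (x y : S ⊕ M) : Prop :=
  ∃ p : Source n S M, p.transistor = some x ∧ (w p).transistor = some y

/-- An `(xⁿ, xᵐ)`-picture over `⟨x ∣ x = x²⟩`, with set `S` of `(x, x²)`-transistors and set `M` of
`(x², x)`-transistors. A wire is given by its two ends, and every contact belongs to exactly one
wire, so the wires form a bijection from the contacts where a wire may start to those where
it may end. The transitive closure of "directly above" is a strict partial order. The sets of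
transistors are allowed to be infinite here; a picture in the usual sense is a finite one. -/
structure Picture (n m : ℕ) : Type 1 where
  S : Type
  M : Type
  wire : Source n S M ≃ Sink m S M
  acyclic : ∀ x, ¬ Relation.TransGen (Above wire) x x

theorem acyclic_of_two {X A B : Type} {r : X → X → Prop} {rA : A → A → Prop} {rB : B → B → Prop}
    (f : A → X) (g : B → X) (hfg : ∀ x, (∃ a, f a = x) ∨ ∃ b, g b = x)
    (hgf : ∀ b a, ¬ r (g b) (f a)) (hf : ∀ a a', r (f a) (f a') → rA a a')
    (hg : ∀ b b', r (g b) (g b') → rB b b') (hA : ∀ a, ¬ Relation.TransGen rA a a)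
    (hB : ∀ b, ¬ Relation.TransGen rB b b) (x : X) : ¬ Relation.TransGen r x x := by
  intro h
  rcases hfg x with ⟨a, rfl⟩ | ⟨b, rfl⟩
  · have key : ∀ y, Relation.TransGen r (f a) y → ∀ a', y = f a' → Relation.TransGen rA a a' := by
      intro y hy
      induction hy with
      | single h => rintro a' rfl; exact .single (hf _ _ h)
      | @tail y z _ h ih =>
        rintro a' rfl
        rcases hfg y with ⟨a'', rfl⟩ | ⟨b, rfl⟩
        · exact .tail (ih _ rfl) (hf _ _ h)
        · exact absurd h (hgf _ _)
    exact hA a (key _ h a rfl)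
  · have key : ∀ y, Relation.TransGen r y (g b) → ∀ b', y = g b' → Relation.TransGen rB b' b := by
      intro y hy
      induction hy using Relation.TransGen.head_induction_on with
      | single h => rintro b' rfl; exact .single (hg _ _ h)
      | @head y z h _ ih =>
        rintro b' rfl
        rcases hfg z with ⟨a, rfl⟩ | ⟨b'', rfl⟩
        · exact absurd h (hgf _ _)
        · exact .head (hg _ _ h) (ih _ rfl)
    exact hB b (key _ h b rfl)

namespace Picture

variable {n m k l : ℕ}

/-- The set of transistors of a picture. -/
abbrev Transistor (P : Picture n m) : Type := P.S ⊕ P.M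

/-- The strict partial order on the transistors of a picture: `x` lies above `y`. -/
def Lt (P : Picture n m) : P.Transistor → P.Transistor → Prop :=
  Relation.TransGen (Above P.wire)

/-- A transistor is maximal if no transistor hangs below it. -/
def IsMaximal (P : Picture n m) (x : P.Transistor) : Prop := ∀ y, ¬ P.Lt x y

/-- A picture has finitely many transistors. -/
def IsFinite (P : Picture n m) : Prop := Finite P.S ∧ Finite P.M

/-- A permutation picture is one without transistors. -/
def IsPermutation (P : Picture n m) : Prop := IsEmpty P.S ∧ IsEmpty P.M

/-- An isomorphism of pictures: it is the identity on the frame, and it respects the types of the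
transistors, the left-right order of their contacts, and the wires. -/
structure Iso (P Q : Picture n m) where
  eS : P.S ≃ Q.S
  eM : P.M ≃ Q.M
  wire : ∀ p, Q.wire (p.map eS eM) = (P.wire p).map eS eM

/-- The picture without transistors whose wires join the `i`-th contact on the top of the
frame to the `σ i`-th contact on its bottom. -/
def ofPerm (σ : Equiv.Perm (Fin n)) : Picture n n where
  S := Empty
  M := Empty
  wire :=
    { toFun := fun p => match p with
        | .frame i => .frame (σ i)
      invFun := fun q => match q with
        | .frame i => .frame (σ.symm i)
      left_inv := fun p => by rcases p with i | ⟨⟨⟩, _⟩ | ⟨⟨⟩⟩; simp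
      right_inv := fun p => by rcases p with i | ⟨⟨⟩⟩ | ⟨⟨⟩, _⟩; simp }
  acyclic := fun x => by rcases x with ⟨⟨⟩⟩ | ⟨⟨⟩⟩

/-- The picture with one transistor, an `(x, x²)`-transistor hanging from the first of the
`n + 1` contacts on the top of the frame; the other wires run straight down. -/
def splitFirst (n : ℕ) : Picture (n + 1) (n + 2) where
  S := Unit
  M := Empty
  wire :=
    { toFun := fun p => match p with
        | .frame i => Fin.cases (.split ()) (fun i => .frame i.succ.succ) i
        | .split _ false => .frame 0
        | .split _ true => .frame 1
      invFun := fun q => match q with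
        | .frame j => Fin.cases (.split () false)
            (fun j => Fin.cases (.split () true) (fun j => .frame j.succ) j) j
        | .split _ => .frame 0
      left_inv := fun p => by
        rcases p with i | ⟨_, b⟩ | ⟨⟨⟩⟩
        · cases i using Fin.cases <;> rfl
        · cases b <;> rfl
      right_inv := fun q => by
        rcases q with j | _ | ⟨⟨⟩, _⟩
        · cases j using Fin.cases with
          | zero => rfl
          | succ j => cases j using Fin.cases <;> rfl
        · rfl }
  acyclic := by
    have h : ∀ x y : Unit ⊕ Empty, ¬ Above (fun p : Source (n + 1) Unit Empty => (match p with
        | .frame i => Fin.cases (.split ()) (fun i => .frame i.succ.succ) i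
        | .split _ false => .frame 0
        | .split _ true => .frame 1 : Sink (n + 2) Unit Empty)) x y := by
      rintro x y ⟨p, hp, hq⟩
      rcases p with i | ⟨_, b⟩ | ⟨⟨⟩⟩
      · simp [Source.transistor] at hp
      · cases b <;> simp [Sink.transistor] at hq
    intro x hx
    obtain ⟨y, hy, -⟩ := Relation.TransGen.head'_iff.1 hx
    exact h _ _ hy

/-- The mirror image of a contact. -/
def flip (m : ℕ) (S M : Type) : Source m M S ≃ Sink m S M where
  toFun p := match p with
    | .frame i => .frame i
    | .split t b => .merge t b
    | .merge s => .split s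
  invFun q := match q with
    | .frame i => .frame i
    | .merge t b => .split t b
    | .split s => .merge s
  left_inv p := by cases p <;> rfl
  right_inv q := by cases q <;> rfl

theorem flip_transistor {S M : Type} (p : Source m M S) :
    (flip m S M p).transistor = p.transistor.map Sum.swap := by
  cases p <;> rfl

theorem flip_symm_transistor {S M : Type} (p : Sink m S M) :
    ((flip m S M).symm p).transistor = p.transistor.map Sum.swap := by
  cases p <;> rfl

/-- The mirror image of a picture in a horizontal line. -/
def mirror (P : Picture n m) : Picture m n where
  S := P.M
  M := P.S
  wire := (flip m P.S P.M).trans (P.wire.symm.trans (flip n P.M P.S))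
  acyclic := by
    have h : ∀ x y, Above ((flip m P.S P.M).trans (P.wire.symm.trans (flip n P.M P.S))) x y →
        Above P.wire y.swap x.swap := by
      rintro x y ⟨p, hp, hq⟩
      refine ⟨P.wire.symm (flip m P.S P.M p), ?_, ?_⟩
      · simp only [Equiv.trans_apply, flip_transistor, Option.map_eq_some_iff] at hq
        obtain ⟨a, ha, rfl⟩ := hq
        simpa using ha
      · simp [flip_transistor, hp]
    intro x hx
    have key : ∀ y, Relation.TransGen
        (Above ((flip m P.S P.M).trans (P.wire.symm.trans (flip n P.M P.S)))) x y →
        Relation.TransGen (Above P.wire) y.swap x.swap := by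
      intro y hy
      induction hy with
      | single h' => exact .single (h _ _ h')
      | tail _ h' ih => exact .head (h _ _ h') ih
    exact P.acyclic _ (key x hx)

section Concat

variable (P : Picture n k) (Q : Picture k m)

/-- Continue a wire of `P` to a wire of the concatenation of `P` and `Q`. -/
def concatDown : Sink k P.S P.M → Sink m (P.S ⊕ Q.S) (P.M ⊕ Q.M)
  | .frame j => (Q.wire (.frame j)).map Sum.inr Sum.inr
  | .split s => .split (Sum.inl s)
  | .merge t b => .merge (Sum.inl t) b

/-- Continue a wire of `Q` upwards to a wire of the concatenation of `P` and `Q`. -/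
def concatUp : Source k Q.S Q.M → Source n (P.S ⊕ Q.S) (P.M ⊕ Q.M)
  | .frame j => (P.wire.symm (.frame j)).map Sum.inl Sum.inl
  | .split s b => .split (Sum.inr s) b
  | .merge t => .merge (Sum.inr t)

/-- The lower end of a wire of the concatenation of `P` and `Q`. -/
def concatFun : Source n (P.S ⊕ Q.S) (P.M ⊕ Q.M) → Sink m (P.S ⊕ Q.S) (P.M ⊕ Q.M)
  | .frame i => concatDown P Q (P.wire (.frame i))
  | .split (Sum.inl s) b => concatDown P Q (P.wire (.split s b))
  | .merge (Sum.inl t) => concatDown P Q (P.wire (.merge t))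
  | .split (Sum.inr s) b => (Q.wire (.split s b)).map Sum.inr Sum.inr
  | .merge (Sum.inr t) => (Q.wire (.merge t)).map Sum.inr Sum.inr

/-- The upper end of a wire of the concatenation of `P` and `Q`. -/
def concatInv : Sink m (P.S ⊕ Q.S) (P.M ⊕ Q.M) → Source n (P.S ⊕ Q.S) (P.M ⊕ Q.M)
  | .frame j => concatUp P Q (Q.wire.symm (.frame j))
  | .split (Sum.inr s) => concatUp P Q (Q.wire.symm (.split s))
  | .merge (Sum.inr t) b => concatUp P Q (Q.wire.symm (.merge t b))
  | .split (Sum.inl s) => (P.wire.symm (.split s)).map Sum.inl Sum.inl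
  | .merge (Sum.inl t) b => (P.wire.symm (.merge t b)).map Sum.inl Sum.inl

theorem concatFun_inl (p : Source n P.S P.M) :
    concatFun P Q (p.map Sum.inl Sum.inl) = concatDown P Q (P.wire p) := by
  cases p <;> rfl

theorem concatFun_up (p : Source k Q.S Q.M) :
    concatFun P Q (concatUp P Q p) = (Q.wire p).map Sum.inr Sum.inr := by
  rcases p with j | _ | _
  · simp [concatUp, concatFun_inl, concatDown]
  · rfl
  · rfl

theorem concatInv_inr (q : Sink m Q.S Q.M) :
    concatInv P Q (q.map Sum.inr Sum.inr) = concatUp P Q (Q.wire.symm q) := by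
  cases q <;> rfl

theorem concatInv_down (q : Sink k P.S P.M) :
    concatInv P Q (concatDown P Q q) = (P.wire.symm q).map Sum.inl Sum.inl := by
  rcases q with j | _ | _
  · simp [concatDown, concatInv_inr, concatUp]
  · rfl
  · rfl

theorem concat_inl_or (p : Source n (P.S ⊕ Q.S) (P.M ⊕ Q.M)) :
    (∃ p' : Source n P.S P.M, p = p'.map Sum.inl Sum.inl) ∨ ∃ p', p = concatUp P Q p' := by
  rcases p with i | ⟨s | s, b⟩ | t | t
  · exact .inl ⟨.frame i, rfl⟩
  · exact .inl ⟨.split s b, rfl⟩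
  · exact .inr ⟨.split s b, rfl⟩
  · exact .inl ⟨.merge t, rfl⟩
  · exact .inr ⟨.merge t, rfl⟩

theorem concat_inr_or (q : Sink m (P.S ⊕ Q.S) (P.M ⊕ Q.M)) :
    (∃ q' : Sink m Q.S Q.M, q = q'.map Sum.inr Sum.inr) ∨ ∃ q', q = concatDown P Q q' := by
  rcases q with i | (s | s) | ⟨t | t, b⟩
  · exact .inl ⟨.frame i, rfl⟩
  · exact .inr ⟨.split s, rfl⟩
  · exact .inl ⟨.split s, rfl⟩
  · exact .inr ⟨.merge t b, rfl⟩
  · exact .inl ⟨.merge t b, rfl⟩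

theorem concat_acyclic (x : (P.S ⊕ Q.S) ⊕ (P.M ⊕ Q.M)) :
    ¬ Relation.TransGen (Above (concatFun P Q)) x x := by
  refine acyclic_of_two (rA := Above P.wire) (rB := Above Q.wire)
    (Sum.map Sum.inl Sum.inl) (Sum.map Sum.inr Sum.inr) ?_ ?_ ?_ ?_ P.acyclic Q.acyclic x
  · rintro ((s | s) | (t | t))
    · exact .inl ⟨.inl s, rfl⟩
    · exact .inr ⟨.inl s, rfl⟩
    · exact .inl ⟨.inr t, rfl⟩
    · exact .inr ⟨.inr t, rfl⟩
  · rintro b a ⟨p, hp, hq⟩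
    have hp' : ∃ p', p = concatUp P Q p' := by
      rcases concat_inl_or P Q p with ⟨p', rfl⟩ | h
      · rcases p' <;> rcases b <;> simp [Source.map, Source.transistor] at hp
      · exact h
    obtain ⟨p', rfl⟩ := hp'
    rw [concatFun_up] at hq
    rcases h : Q.wire p' <;> rcases a <;> simp [h, Sink.map, Sink.transistor] at hq
  · rintro a a' ⟨p, hp, hq⟩
    have hp' : ∃ p' : Source n P.S P.M, p = p'.map Sum.inl Sum.inl ∧ p'.transistor = some a := by
      rcases p with i | ⟨s | s, b⟩ | (t | t) <;> rcases a <;>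
        simp [Source.transistor] at hp
      · exact ⟨.split s b, rfl, by simp [Source.transistor, hp]⟩
      · exact ⟨.merge t, rfl, by simp [Source.transistor, hp]⟩
    obtain ⟨p', rfl, hp'⟩ := hp'
    refine ⟨p', hp', ?_⟩
    rw [concatFun_inl] at hq
    rcases h : P.wire p' with j | s | ⟨t, b⟩
    · rw [h] at hq
      rcases h' : Q.wire (.frame j) <;> rcases a' <;>
        simp [h', concatDown, Sink.map, Sink.transistor] at hq
    · rcases a' <;> simp [h, concatDown, Sink.transistor] at hq ⊢; exact hq
    · rcases a' <;> simp [h, concatDown, Sink.transistor] at hq ⊢; exact hq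
  · rintro b b' ⟨p, hp, hq⟩
    have hp' : ∃ p' : Source k Q.S Q.M, p = concatUp P Q p' ∧ p'.transistor = some b := by
      rcases p with i | ⟨s | s, c⟩ | (t | t) <;> rcases b <;>
        simp [Source.transistor] at hp
      · exact ⟨.split s c, rfl, by simp [Source.transistor, hp]⟩
      · exact ⟨.merge t, rfl, by simp [Source.transistor, hp]⟩
    obtain ⟨p', rfl, hp'⟩ := hp'
    refine ⟨p', hp', ?_⟩
    rw [concatFun_up] at hq
    rcases h : Q.wire p' <;> rcases b' <;> simp [h, Sink.map, Sink.transistor] at hq ⊢ <;> exact hq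

/-- The concatenation `P ∘ Q`: the bottom of the frame of `P` is glued to the top of the
frame of `Q`, and the line where they meet is erased. -/
def concat : Picture n m where
  S := P.S ⊕ Q.S
  M := P.M ⊕ Q.M
  wire :=
    { toFun := concatFun P Q
      invFun := concatInv P Q
      left_inv := fun p => by
        rcases concat_inl_or P Q p with ⟨p, rfl⟩ | ⟨p, rfl⟩
        · simp [concatFun_inl, concatInv_down]
        · simp [concatFun_up, concatInv_inr]
      right_inv := fun q => by
        rcases concat_inr_or P Q q with ⟨q, rfl⟩ | ⟨q, rfl⟩
        · simp [concatFun_up, concatInv_inr]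
        · simp [concatFun_inl, concatInv_down] }
  acyclic := concat_acyclic P Q

end Concat

theorem concat_wire (P : Picture n k) (Q : Picture k m) (p) :
    (P.concat Q).wire p = concatFun P Q p := rfl

namespace Iso

/-- The identity isomorphism. -/
def refl (P : Picture n m) : Iso P P :=
  ⟨Equiv.refl _, Equiv.refl _, fun p => by
    have h : ∀ q : Sink m P.S P.M, q = q.map (Equiv.refl _) (Equiv.refl _) := by
      rintro (_ | _ | _) <;> rfl
    rcases p with _ | _ | _ <;> exact h _⟩

/-- The inverse isomorphism. -/
def symm {P Q : Picture n m} (e : Iso P Q) : Iso Q P where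
  eS := e.eS.symm
  eM := e.eM.symm
  wire p := by
    have h1 : ∀ p : Source n Q.S Q.M, (p.map e.eS.symm e.eM.symm).map e.eS e.eM = p := by
      rintro (_ | _ | _) <;> simp [Source.map]
    have h2 : ∀ q : Sink m P.S P.M, (q.map e.eS e.eM).map e.eS.symm e.eM.symm = q := by
      rintro (_ | _ | _) <;> simp [Sink.map]
    have h := e.wire (p.map e.eS.symm e.eM.symm)
    rw [h1] at h
    rw [h, h2]

/-- Concatenations of isomorphic pictures are isomorphic. -/
def concat {P P' : Picture n k} {Q Q' : Picture k m} (e : Iso P P') (f : Iso Q Q') :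
    Iso (P.concat Q) (P'.concat Q') where
  eS := Equiv.sumCongr e.eS f.eS
  eM := Equiv.sumCongr e.eM f.eM
  wire p := by
    have hQ : ∀ q : Sink m Q.S Q.M, (q.map f.eS f.eM).map Sum.inr Sum.inr =
        (q.map Sum.inr Sum.inr : Sink m (P.S ⊕ Q.S) (P.M ⊕ Q.M)).map
          (Equiv.sumCongr e.eS f.eS) (Equiv.sumCongr e.eM f.eM) := by
      rintro (_ | _ | _) <;> rfl
    have hd : ∀ q : Sink k P.S P.M, concatDown P' Q' (q.map e.eS e.eM) =
        (concatDown P Q q).map (Equiv.sumCongr e.eS f.eS) (Equiv.sumCongr e.eM f.eM) := by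
      rintro (j | _ | _)
      · exact (congrArg _ (f.wire (.frame j))).trans (hQ _)
      · rfl
      · rfl
    rcases p with i | ⟨s | s, b⟩ | (t | t)
    · exact (congrArg (concatDown P' Q') (e.wire (.frame i))).trans (hd _)
    · exact (congrArg (concatDown P' Q') (e.wire (.split s b))).trans (hd _)
    · exact (congrArg _ (f.wire (.split s b))).trans (hQ _)
    · exact (congrArg (concatDown P' Q') (e.wire (.merge t))).trans (hd _)
    · exact (congrArg _ (f.wire (.merge t))).trans (hQ _)

/-- Concatenation is associative up to isomorphism. -/
def assoc (P : Picture n k) (Q : Picture k l) (R : Picture l m) :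
    Iso ((P.concat Q).concat R) (P.concat (Q.concat R)) where
  eS := Equiv.sumAssoc _ _ _
  eM := Equiv.sumAssoc _ _ _
  wire p := by
    have hR : ∀ r : Sink m R.S R.M, (r.map Sum.inr Sum.inr :
          Sink m (Q.S ⊕ R.S) (Q.M ⊕ R.M)).map Sum.inr Sum.inr =
        (r.map Sum.inr Sum.inr : Sink m ((P.S ⊕ Q.S) ⊕ R.S) ((P.M ⊕ Q.M) ⊕ R.M)).map
          (Equiv.sumAssoc _ _ _) (Equiv.sumAssoc _ _ _) := by
      rintro (_ | _ | _) <;> rfl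
    have hQ : ∀ q : Sink l Q.S Q.M, (concatDown Q R q).map Sum.inr Sum.inr =
        (concatDown (P.concat Q) R (q.map Sum.inr Sum.inr)).map
          (Equiv.sumAssoc _ _ _) (Equiv.sumAssoc _ _ _) := by
      rintro (j | _ | _)
      · exact hR _
      · rfl
      · rfl
    have hP : ∀ q : Sink k P.S P.M, concatDown P (Q.concat R) q =
        (concatDown (P.concat Q) R (concatDown P Q q)).map
          (Equiv.sumAssoc _ _ _) (Equiv.sumAssoc _ _ _) := by
      rintro (j | _ | _)
      · exact hQ _
      · rfl
      · rfl
    rcases p with i | ⟨(s | s) | s, b⟩ | ((t | t) | t)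
    · exact hP _
    · exact hP _
    · exact hQ _
    · exact hR _
    · exact hP _
    · exact hQ _
    · exact hR _

/-- The identity picture is a left unit up to isomorphism. -/
def oneConcat (P : Picture n m) : Iso ((ofPerm 1).concat P) P where
  eS := Equiv.emptySum Empty _
  eM := Equiv.emptySum Empty _
  wire p := by
    have hP : ∀ q : Sink m P.S P.M, q =
        (q.map Sum.inr Sum.inr : Sink m (Empty ⊕ P.S) (Empty ⊕ P.M)).map
          (Equiv.emptySum Empty _) (Equiv.emptySum Empty _) := by
      rintro (_ | _ | _) <;> rfl
    rcases p with i | ⟨⟨⟨⟩⟩ | s, b⟩ | (⟨⟨⟩⟩ | t)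
    · exact hP _
    · exact hP _
    · exact hP _

/-- The identity picture is a right unit up to isomorphism. -/
def concatOne (P : Picture n m) : Iso (P.concat (ofPerm 1)) P where
  eS := Equiv.sumEmpty _ Empty
  eM := Equiv.sumEmpty _ Empty
  wire p := by
    have hP : ∀ q : Sink m P.S P.M, q = (concatDown P (ofPerm 1) q).map
        (Equiv.sumEmpty _ Empty) (Equiv.sumEmpty _ Empty) := by
      rintro (_ | _ | _) <;> rfl
    rcases p with i | ⟨s | ⟨⟨⟩⟩, b⟩ | (t | ⟨⟨⟩⟩)
    · exact hP _
    · exact hP _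
    · exact hP _

end Iso

/-- `Q` is obtained from `P` by removing a dipole. The dipole consists of the transistors
`eS none` and `eM none`; the two equivalences identify the transistors of `Q` with the other ones
of `P`. In the first kind of dipole the `(x, x²)`-transistor lies above the `(x², x)`-transistor
and their contacts are paired in order by two wires; in the second kind the `(x², x)`-transistor
lies above the `(x, x²)`-transistor and one wire joins them. A wire of `Q` is either a wire
of `P`, or it is glued from a wire of `P` that ends on the top of the dipole and the corresponding
wire of `P` that starts on the bottom of the dipole. -/
def IsDipoleRemoval (P Q : Picture n m) : Prop :=
  ∃ (eS : Option Q.S ≃ P.S) (eM : Option Q.M ≃ P.M),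
    ((∀ b, P.wire (.split (eS none) b) = .merge (eM none) b) ∧
      ∀ p : Source n Q.S Q.M,
        P.wire (p.map (eS ∘ some) (eM ∘ some)) = (Q.wire p).map (eS ∘ some) (eM ∘ some) ∨
        (P.wire (p.map (eS ∘ some) (eM ∘ some)) = .split (eS none) ∧
          P.wire (.merge (eM none)) = (Q.wire p).map (eS ∘ some) (eM ∘ some))) ∨
    (P.wire (.merge (eM none)) = .split (eS none) ∧
      ∀ p : Source n Q.S Q.M,
        P.wire (p.map (eS ∘ some) (eM ∘ some)) = (Q.wire p).map (eS ∘ some) (eM ∘ some) ∨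
        ∃ b, P.wire (p.map (eS ∘ some) (eM ∘ some)) = .merge (eM none) b ∧
          P.wire (.split (eS none) b) = (Q.wire p).map (eS ∘ some) (eM ∘ some))

/-- A picture is reduced if it contains no dipoles. -/
def IsReduced (P : Picture n m) : Prop :=
  ∀ (s : P.S) (t : P.M), ¬ (∀ b, P.wire (.split s b) = .merge t b) ∧
    ¬ P.wire (.merge t) = .split s

/-- Equality modulo dipoles: the equivalence relation generated by isomorphism and the removal of
dipoles. -/
def DipoleEq : Picture n m → Picture n m → Prop :=
  Relation.EqvGen fun P Q => Nonempty (Iso P Q) ∨ IsDipoleRemoval P Q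

theorem DipoleEq.of_iso {P Q : Picture n m} (e : Iso P Q) : DipoleEq P Q :=
  .rel _ _ (.inl ⟨e⟩)

theorem DipoleEq.refl (P : Picture n m) : DipoleEq P P := Relation.EqvGen.refl P

theorem DipoleEq.symm {P Q : Picture n m} (h : DipoleEq P Q) : DipoleEq Q P :=
  Relation.EqvGen.symm _ _ h

theorem DipoleEq.trans {P Q R : Picture n m} (h : DipoleEq P Q) (h' : DipoleEq Q R) :
    DipoleEq P R :=
  Relation.EqvGen.trans _ _ _ h h'

/-- Auxiliary bijection. -/
def optionSumLeft (α β : Type) : Option (α ⊕ β) ≃ Option α ⊕ β where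
  toFun x := match x with
    | none => .inl none
    | some (.inl a) => .inl (some a)
    | some (.inr b) => .inr b
  invFun x := match x with
    | .inl none => none
    | .inl (some a) => some (.inl a)
    | .inr b => some (.inr b)
  left_inv x := by rcases x with _ | _ | _ <;> rfl
  right_inv x := by rcases x with (_ | _) | _ <;> rfl

/-- Auxiliary bijection. -/
def optionSumRight (α β : Type) : Option (α ⊕ β) ≃ α ⊕ Option β where
  toFun x := match x with
    | none => .inr none
    | some (.inl a) => .inl a
    | some (.inr b) => .inr (some b)
  invFun x := match x with
    | .inr none => none
    | .inl a => some (.inl a)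
    | .inr (some b) => some (.inr b)
  left_inv x := by rcases x with _ | _ | _ <;> rfl
  right_inv x := by rcases x with _ | _ | _ <;> rfl

theorem IsDipoleRemoval.concat_left {P P' : Picture n k} (h : IsDipoleRemoval P P')
    (Q : Picture k m) : IsDipoleRemoval (P.concat Q) (P'.concat Q) := by
  obtain ⟨eS, eM, h⟩ := h
  set fS : Option (P'.S ⊕ Q.S) ≃ P.S ⊕ Q.S :=
    (optionSumLeft _ _).trans (Equiv.sumCongr eS (Equiv.refl _)) with hfS
  set fM : Option (P'.M ⊕ Q.M) ≃ P.M ⊕ Q.M :=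
    (optionSumLeft _ _).trans (Equiv.sumCongr eM (Equiv.refl _)) with hfM
  have hQ : ∀ q : Sink m Q.S Q.M, (q.map Sum.inr Sum.inr : Sink m (P.S ⊕ Q.S) (P.M ⊕ Q.M)) =
      (q.map Sum.inr Sum.inr : Sink m (P'.S ⊕ Q.S) (P'.M ⊕ Q.M)).map (fS ∘ some) (fM ∘ some) := by
    rintro (_ | _ | _) <;> rfl
  have hd : ∀ q : Sink k P'.S P'.M, concatDown P Q (q.map (eS ∘ some) (eM ∘ some)) =
      (concatDown P' Q q).map (fS ∘ some) (fM ∘ some) := by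
    rintro (j | _ | _)
    · exact hQ _
    · rfl
    · rfl
  have key : ∀ (C : Source n (P'.S ⊕ Q.S) (P'.M ⊕ Q.M) → Prop),
      (∀ p : Source n P'.S P'.M, C (p.map Sum.inl Sum.inl)) →
      (∀ p, concatFun P Q (p.map (fS ∘ some) (fM ∘ some)) =
        (concatFun P' Q p).map (fS ∘ some) (fM ∘ some) → C p) → ∀ p, C p := by
    intro C h1 h2 p
    rcases p with i | ⟨s | s, b⟩ | (t | t)
    · exact h1 (.frame i)
    · exact h1 (.split s b)
    · exact h2 _ (hQ _)
    · exact h1 (.merge t)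
    · exact h2 _ (hQ _)
  have hs : ∀ p : Source n P'.S P'.M,
      concatFun P Q ((p.map Sum.inl Sum.inl : Source n (P'.S ⊕ Q.S) (P'.M ⊕ Q.M)).map
        (fS ∘ some) (fM ∘ some)) = concatDown P Q (P.wire (p.map (eS ∘ some) (eM ∘ some))) := by
    rintro (_ | _ | _) <;> rfl
  have hi : ∀ p : Source n P'.S P'.M, (concatDown P' Q (P'.wire p)).map (fS ∘ some) (fM ∘ some) =
      (concatFun P' Q (p.map Sum.inl Sum.inl)).map (fS ∘ some) (fM ∘ some) := by
    rintro (_ | _ | _) <;> rfl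
  refine ⟨fS, fM, ?_⟩
  rcases h with ⟨h1, h2⟩ | ⟨h1, h2⟩
  · refine .inl ⟨fun b => congrArg (concatDown P Q) (h1 b), ?_⟩
    refine key _ (fun p => ?_) fun p hp => .inl hp
    rcases h2 p with h | ⟨h, h'⟩
    · exact .inl ((hs p).trans (((congrArg _ h).trans (hd _)).trans (hi p)))
    · exact .inr ⟨(hs p).trans (congrArg (concatDown P Q) h),
        ((congrArg (concatDown P Q) h').trans (hd _)).trans (hi p)⟩
  · refine .inr ⟨congrArg (concatDown P Q) h1, ?_⟩
    refine key _ (fun p => ?_) fun p hp => .inl hp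
    rcases h2 p with h | ⟨b, h, h'⟩
    · exact .inl ((hs p).trans (((congrArg _ h).trans (hd _)).trans (hi p)))
    · exact .inr ⟨b, (hs p).trans (congrArg (concatDown P Q) h),
        ((congrArg (concatDown P Q) h').trans (hd _)).trans (hi p)⟩

theorem IsDipoleRemoval.concat_right (P : Picture n k) {Q Q' : Picture k m}
    (h : IsDipoleRemoval Q Q') : IsDipoleRemoval (P.concat Q) (P.concat Q') := by
  obtain ⟨eS, eM, h⟩ := h
  set fS : Option (P.S ⊕ Q'.S) ≃ P.S ⊕ Q.S :=
    (optionSumRight _ _).trans (Equiv.sumCongr (Equiv.refl _) eS) with hfS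
  set fM : Option (P.M ⊕ Q'.M) ≃ P.M ⊕ Q.M :=
    (optionSumRight _ _).trans (Equiv.sumCongr (Equiv.refl _) eM) with hfM
  have hQ : ∀ q : Sink m Q'.S Q'.M, ((q.map (eS ∘ some) (eM ∘ some)).map Sum.inr Sum.inr :
        Sink m (P.S ⊕ Q.S) (P.M ⊕ Q.M)) =
      (q.map Sum.inr Sum.inr : Sink m (P.S ⊕ Q'.S) (P.M ⊕ Q'.M)).map
        (fS ∘ some) (fM ∘ some) := by
    rintro (_ | _ | _) <;> rfl
  have key : ∀ (C : Sink m (P.S ⊕ Q.S) (P.M ⊕ Q.M) → Sink m (P.S ⊕ Q'.S) (P.M ⊕ Q'.M) → Prop),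
      (∀ p : Source k Q'.S Q'.M, C ((Q.wire (p.map (eS ∘ some) (eM ∘ some))).map Sum.inr Sum.inr)
        ((Q'.wire p).map Sum.inr Sum.inr)) →
      (∀ q, C (q.map (fS ∘ some) (fM ∘ some)) q) →
      ∀ p, C (concatFun P Q (p.map (fS ∘ some) (fM ∘ some))) (concatFun P Q' p) := by
    intro C h1 h2 p
    have hd : ∀ q, C (concatDown P Q q) (concatDown P Q' q) := by
      rintro (j | s | ⟨t, b⟩)
      · exact h1 (.frame j)
      · exact h2 (.split (.inl s))
      · exact h2 (.merge (.inl t) b)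
    rcases p with i | ⟨s | s, b⟩ | (t | t)
    · exact hd _
    · exact hd _
    · exact h1 (.split s b)
    · exact hd _
    · exact h1 (.merge t)
  refine ⟨fS, fM, ?_⟩
  rcases h with ⟨h1, h2⟩ | ⟨h1, h2⟩
  · refine .inl ⟨fun b => congrArg (Sink.map Sum.inr Sum.inr) (h1 b), ?_⟩
    refine key (fun a b => a = b.map (fS ∘ some) (fM ∘ some) ∨ (a = .split (fS none) ∧
      (P.concat Q).wire (.merge (fM none)) = b.map (fS ∘ some) (fM ∘ some))) (fun p => ?_)
      (fun _ => .inl rfl)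
    rcases h2 p with h | ⟨h, h'⟩
    · exact .inl ((congrArg _ h).trans (hQ _))
    · exact .inr ⟨congrArg (Sink.map Sum.inr Sum.inr) h,
        (congrArg (Sink.map Sum.inr Sum.inr) h').trans (hQ _)⟩
  · refine .inr ⟨congrArg (Sink.map Sum.inr Sum.inr) h1, ?_⟩
    refine key (fun a b => a = b.map (fS ∘ some) (fM ∘ some) ∨ ∃ c, a = .merge (fM none) c ∧
      (P.concat Q).wire (.split (fS none) c) = b.map (fS ∘ some) (fM ∘ some)) (fun p => ?_)
      (fun _ => .inl rfl)
    rcases h2 p with h | ⟨b, h, h'⟩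
    · exact .inl ((congrArg _ h).trans (hQ _))
    · exact .inr ⟨b, congrArg (Sink.map Sum.inr Sum.inr) h,
        (congrArg (Sink.map Sum.inr Sum.inr) h').trans (hQ _)⟩

theorem DipoleEq.concat {P P' : Picture n k} {Q Q' : Picture k m} (h : DipoleEq P P')
    (h' : DipoleEq Q Q') : DipoleEq (P.concat Q) (P'.concat Q') := by
  have h1 : DipoleEq (P.concat Q) (P'.concat Q) := by
    induction h with
    | rel P P' h =>
      rcases h with ⟨⟨e⟩⟩ | h
      · exact .of_iso (e.concat (.refl Q))
      · exact .rel _ _ (.inr (h.concat_left Q))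
    | refl P => exact .refl _
    | symm _ _ _ ih => exact ih.symm
    | trans _ _ _ _ _ ih ih' => exact ih.trans ih'
  refine h1.trans ?_
  clear h h1
  induction h' with
  | rel Q Q' h =>
    rcases h with ⟨⟨e⟩⟩ | h
    · exact .of_iso ((Iso.refl P').concat e)
    · exact .rel _ _ (.inr (h.concat_right P'))
  | refl P => exact .refl _
  | symm _ _ _ ih => exact ih.symm
  | trans _ _ _ _ _ ih ih' => exact ih.trans ih'

/-! ### A picture followed by its mirror image is trivial modulo dipoles -/

/-- Auxiliary: a picture whose wires to the bottom of the frame are cut. It is given by the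
function that sends the contact on top of a transistor to the upper end of its wire. -/
structure Cut (n : ℕ) (S M : Type) where
  g : Sink 0 S M → Source n S M
  inj : Function.Injective g
  acyclic : ∀ x, ¬ Relation.TransGen
    (fun x y => ∃ q, (g q).transistor = some x ∧ q.transistor = some y) x x

namespace Cut

variable {S M S' M' : Type}

/-- Auxiliary contact map. -/
def upSink : Sink 0 S M → Sink n (S ⊕ M) (M ⊕ S)
  | .split s => .split (.inl s)
  | .merge t b => .merge (.inl t) b

/-- Auxiliary contact map. -/
def mirSink : Source n S M → Sink n (S ⊕ M) (M ⊕ S)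
  | .frame i => .frame i
  | .split s b => .merge (.inr s) b
  | .merge t => .split (.inr t)

/-- Auxiliary contact map. -/
def upSource : Source n S M → Source n (S ⊕ M) (M ⊕ S)
  | .frame i => .frame i
  | .split s b => .split (.inl s) b
  | .merge t => .merge (.inl t)

/-- Auxiliary contact map. -/
def mirSource : Sink 0 S M → Source n (S ⊕ M) (M ⊕ S)
  | .split s => .merge (.inr s)
  | .merge t b => .split (.inr t) b

open Classical in
/-- Auxiliary contact map. -/
noncomputable def down (c : Cut n S M) (p : Source n S M) : Sink n (S ⊕ M) (M ⊕ S) :=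
  if h : ∃ q, c.g q = p then upSink h.choose else mirSink p

open Classical in
/-- Auxiliary contact map. -/
noncomputable def up (c : Cut n S M) (p : Source n S M) : Source n (S ⊕ M) (M ⊕ S) :=
  if h : ∃ q, c.g q = p then mirSource h.choose else upSource p

theorem down_g (c : Cut n S M) (q) : c.down (c.g q) = upSink q := by
  have h : ∃ q', c.g q' = c.g q := ⟨q, rfl⟩
  rw [down, dif_pos h, c.inj h.choose_spec]

theorem up_g (c : Cut n S M) (q) : c.up (c.g q) = mirSource q := by
  have h : ∃ q', c.g q' = c.g q := ⟨q, rfl⟩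
  rw [up, dif_pos h, c.inj h.choose_spec]

theorem down_of (c : Cut n S M) {p} (h : ¬ ∃ q, c.g q = p) : c.down p = mirSink p := dif_neg h

theorem up_of (c : Cut n S M) {p} (h : ¬ ∃ q, c.g q = p) : c.up p = upSource p := dif_neg h

/-- Auxiliary contact map. -/
noncomputable def doubleFun (c : Cut n S M) :
    Source n (S ⊕ M) (M ⊕ S) → Sink n (S ⊕ M) (M ⊕ S)
  | .frame i => c.down (.frame i)
  | .split (.inl s) b => c.down (.split s b)
  | .merge (.inl t) => c.down (.merge t)
  | .split (.inr t) b => mirSink (c.g (.merge t b))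
  | .merge (.inr s) => mirSink (c.g (.split s))

/-- Auxiliary contact map. -/
noncomputable def doubleInv (c : Cut n S M) :
    Sink n (S ⊕ M) (M ⊕ S) → Source n (S ⊕ M) (M ⊕ S)
  | .frame i => c.up (.frame i)
  | .split (.inl s) => upSource (c.g (.split s))
  | .merge (.inl t) b => upSource (c.g (.merge t b))
  | .split (.inr t) => c.up (.merge t)
  | .merge (.inr s) b => c.up (.split s b)

theorem doubleFun_up (c : Cut n S M) (p) : c.doubleFun (upSource p) = c.down p := by
  cases p <;> rfl

theorem doubleFun_mir (c : Cut n S M) (q) : c.doubleFun (mirSource q) = mirSink (c.g q) := by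
  rcases q with i | _ | _
  · exact i.elim0
  · rfl
  · rfl

theorem doubleInv_up (c : Cut n S M) (q) : c.doubleInv (upSink q) = upSource (c.g q) := by
  rcases q with i | _ | _
  · exact i.elim0
  · rfl
  · rfl

theorem doubleInv_mir (c : Cut n S M) (p) : c.doubleInv (mirSink p) = c.up p := by
  cases p <;> rfl

theorem source_cases (p : Source n (S ⊕ M) (M ⊕ S)) :
    (∃ r, p = upSource r) ∨ ∃ q, p = mirSource q := by
  rcases p with i | ⟨s | t, b⟩ | (t | s)
  · exact .inl ⟨.frame i, rfl⟩
  · exact .inl ⟨.split s b, rfl⟩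
  · exact .inr ⟨.merge t b, rfl⟩
  · exact .inl ⟨.merge t, rfl⟩
  · exact .inr ⟨.split s, rfl⟩

theorem sink_cases (p : Sink n (S ⊕ M) (M ⊕ S)) :
    (∃ r, p = upSink r) ∨ ∃ q, p = mirSink q := by
  rcases p with i | (s | t) | ⟨t | s, b⟩
  · exact .inr ⟨.frame i, rfl⟩
  · exact .inl ⟨.split s, rfl⟩
  · exact .inr ⟨.merge t, rfl⟩
  · exact .inl ⟨.merge t b, rfl⟩
  · exact .inr ⟨.split s b, rfl⟩

theorem double_acyclic (c : Cut n S M) (x : (S ⊕ M) ⊕ (M ⊕ S)) :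
    ¬ Relation.TransGen (Above c.doubleFun) x x := by
  have hsw : ∀ x y : S ⊕ M, Relation.TransGen (fun x y => ∃ q, (c.g q).transistor = some y ∧
      q.transistor = some x) x y → Relation.TransGen (fun x y => ∃ q, (c.g q).transistor = some x ∧
      q.transistor = some y) y x := by
    intro x y h
    induction h with
    | single h => exact .single h
    | tail _ h ih => exact .head h ih
  refine acyclic_of_two
    (rA := fun x y => ∃ q, (c.g q).transistor = some x ∧ q.transistor = some y)
    (rB := fun x y => ∃ q, (c.g q).transistor = some y ∧ q.transistor = some x)
    (Sum.map Sum.inl Sum.inl) (fun x : S ⊕ M => Sum.map Sum.inr Sum.inr x.swap) ?_ ?_ ?_ ?_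
    c.acyclic (fun x h => c.acyclic x (hsw x x h)) x
  · rintro ((s | t) | (t | s))
    · exact .inl ⟨.inl s, rfl⟩
    · exact .inr ⟨.inr t, rfl⟩
    · exact .inl ⟨.inr t, rfl⟩
    · exact .inr ⟨.inl s, rfl⟩
  · rintro b a ⟨p, hp, hq⟩
    rcases source_cases p with ⟨r, rfl⟩ | ⟨q, rfl⟩
    · rcases r <;> rcases b <;> simp [upSource, Source.transistor] at hp
    · rw [doubleFun_mir] at hq
      rcases h : c.g q <;> rcases a <;> simp [h, mirSink, Sink.transistor] at hq
  · rintro a a' ⟨p, hp, hq⟩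
    rcases source_cases p with ⟨r, rfl⟩ | ⟨q, rfl⟩
    · rw [doubleFun_up] at hq
      by_cases hr : ∃ q, c.g q = r
      · obtain ⟨q, rfl⟩ := hr
        rw [down_g] at hq
        refine ⟨q, ?_, ?_⟩
        · rcases h : c.g q <;> rcases a <;>
            simp [h, upSource, Source.transistor] at hp ⊢ <;> exact hp
        · rcases q with i | _ | _
          · exact i.elim0
          all_goals rcases a' <;> simp [upSink, Sink.transistor] at hq ⊢; exact hq
      · rw [down_of _ hr] at hq
        rcases r <;> rcases a' <;> simp [mirSink, Sink.transistor] at hq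
    · rcases q with i | _ | _
      · exact i.elim0
      all_goals rcases a <;> simp [mirSource, Source.transistor] at hp
  · rintro b b' ⟨p, hp, hq⟩
    rcases source_cases p with ⟨r, rfl⟩ | ⟨q, rfl⟩
    · rcases r <;> rcases b <;> simp [upSource, Source.transistor] at hp
    · rw [doubleFun_mir] at hq
      refine ⟨q, ?_, ?_⟩
      · rcases h : c.g q <;> rcases b' <;>
          simp [h, mirSink, Sink.transistor, Source.transistor] at hq ⊢ <;> exact hq
      · rcases q with i | _ | _
        · exact i.elim0
        all_goals
          rcases b <;> simp [mirSource, Source.transistor, Sink.transistor] at hp ⊢; exact hp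

/-- Auxiliary: a cut picture followed by its mirror image. -/
noncomputable def double (c : Cut n S M) : Picture n n where
  S := S ⊕ M
  M := M ⊕ S
  wire :=
    { toFun := c.doubleFun
      invFun := c.doubleInv
      left_inv := fun p => by
        rcases source_cases p with ⟨r, rfl⟩ | ⟨q, rfl⟩
        · rw [doubleFun_up]
          by_cases hr : ∃ q, c.g q = r
          · obtain ⟨q, rfl⟩ := hr
            rw [down_g, doubleInv_up]
          · rw [down_of _ hr, doubleInv_mir, up_of _ hr]
        · rw [doubleFun_mir, doubleInv_mir, up_g]
      right_inv := fun q => by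
        rcases sink_cases q with ⟨q, rfl⟩ | ⟨r, rfl⟩
        · rw [doubleInv_up, doubleFun_up, down_g]
        · rw [doubleInv_mir]
          by_cases hr : ∃ q, c.g q = r
          · obtain ⟨q, rfl⟩ := hr
            rw [up_g, doubleFun_mir]
          · rw [up_of _ hr, doubleFun_up, down_of _ hr] }
  acyclic := c.double_acyclic

theorem double_wire (c : Cut n S M) (p) : c.double.wire p = c.doubleFun p := rfl

/-- Auxiliary: remove some transistors. -/
theorem exists_restrict (c : Cut n S M) (fS : S' → S) (fM : M' → M) (hS : Function.Injective fS)
    (hM : Function.Injective fM)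
    (h : ∀ q : Sink 0 S' M', ∃ r : Source n S' M', c.g (q.map fS fM) = r.map fS fM) :
    ∃ c' : Cut n S' M', ∀ q, c.g (q.map fS fM) = (c'.g q).map fS fM := by
  choose g hg using h
  have hinj : Function.Injective (Sink.map fS fM : Sink 0 S' M' → Sink 0 S M) := by
    intro a b hab
    cases a <;> cases b <;> simp_all [Sink.map, hS.eq_iff, hM.eq_iff]
  refine ⟨⟨g, fun a b hab => hinj (c.inj (by rw [hg, hg, hab])), fun x hx =>
    c.acyclic (Sum.map fS fM x) ?_⟩, hg⟩
  refine Relation.TransGen.lift (Sum.map fS fM) ?_ x x hx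
  rintro a b ⟨q, h1, h2⟩
  refine ⟨q.map fS fM, ?_, ?_⟩
  · rw [hg]
    rcases h : g q <;> simp [h, Source.map, Source.transistor] at h1 ⊢ <;> rw [← h1] <;> rfl
  · cases q <;> simp [Sink.map, Sink.transistor] at h2 ⊢ <;> rw [← h2] <;> rfl

theorem removal_split (c : Cut n S M) (c' : Cut n S' M) (eS : Option S' ≃ S)
    (hmax : ∀ q b, c.g q ≠ .split (eS none) b)
    (hc : ∀ q, c.g (q.map (eS ∘ some) id) = (c'.g q).map (eS ∘ some) id) :
    IsDipoleRemoval c.double c'.double := by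
  set fS : Option (S' ⊕ M) ≃ S ⊕ M :=
    (optionSumLeft _ _).trans (Equiv.sumCongr eS (Equiv.refl _)) with hfS
  set fM : Option (M ⊕ S') ≃ M ⊕ S :=
    (optionSumRight _ _).trans (Equiv.sumCongr (Equiv.refl _) eS) with hfM
  suffices main : (∀ b, c.doubleFun (.split (fS none) b) = .merge (fM none) b) ∧
      ∀ p : Source n (S' ⊕ M) (M ⊕ S'),
        c.doubleFun (p.map (fS ∘ some) (fM ∘ some)) =
          (c'.doubleFun p).map (fS ∘ some) (fM ∘ some) ∨
        (c.doubleFun (p.map (fS ∘ some) (fM ∘ some)) = .split (fS none) ∧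
          c.doubleFun (.merge (fM none)) = (c'.doubleFun p).map (fS ∘ some) (fM ∘ some)) by
    exact ⟨fS, fM, .inl main⟩
  refine ⟨fun b => ?_, fun p => ?_⟩
  · exact c.down_of (p := .split (eS none) b) (by rintro ⟨q, hq⟩; exact hmax q b hq)
  · have hmir : ∀ r : Source n S' M, (mirSink (r.map (eS ∘ some) id) : Sink n (S ⊕ M) (M ⊕ S)) =
        (mirSink r).map (fS ∘ some) (fM ∘ some) := by
      rintro (_ | _ | _) <;> rfl
    rcases source_cases p with ⟨r, rfl⟩ | ⟨q, rfl⟩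
    · have e1 : c.doubleFun ((upSource r).map (fS ∘ some) (fM ∘ some)) =
          c.down (r.map (eS ∘ some) id) := by
        rcases r <;> rfl
      have e2 : c'.doubleFun (upSource r) = c'.down r := c'.doubleFun_up r
      rw [e1, e2]
      by_cases hr : ∃ q, c'.g q = r
      · obtain ⟨q, rfl⟩ := hr
        refine .inl ?_
        rw [← hc, down_g, down_g]
        rcases q with i | _ | _
        · exact i.elim0
        · rfl
        · rfl
      · rw [c'.down_of hr]
        by_cases hr' : ∃ q, c.g q = r.map (eS ∘ some) id
        · obtain ⟨q, hq⟩ := hr'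
          have hqs : q = .split (eS none) := by
            rcases q with i | s | ⟨t, b⟩
            · exact i.elim0
            · obtain ⟨o, rfl⟩ := eS.surjective s
              rcases o with _ | s
              · rfl
              · exfalso
                have := hc (.split s)
                simp only [Sink.map, Function.comp_apply] at this
                rw [this] at hq
                refine hr ⟨.split s, ?_⟩
                revert hq
                rcases c'.g (.split s) <;> rcases r <;> simp [Source.map]
            · exfalso
              have := hc (.merge t b)
              simp only [Sink.map, id] at this
              rw [this] at hq
              refine hr ⟨.merge t b, ?_⟩
              revert hq
              rcases c'.g (.merge t b) <;> rcases r <;> simp [Source.map]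
          subst hqs
          refine .inr ⟨?_, ?_⟩
          · rw [← hq, down_g]; rfl
          · have : c.doubleFun (.merge (fM none)) = mirSink (c.g (.split (eS none))) := rfl
            rw [this, hq, hmir]
        · rw [c.down_of hr']
          exact .inl (hmir r)
    · refine .inl ?_
      have e1 : c.doubleFun ((mirSource q).map (fS ∘ some) (fM ∘ some)) =
          mirSink (c.g (q.map (eS ∘ some) id)) := by
        rcases q with i | _ | _
        · exact i.elim0
        · rfl
        · rfl
      have e2 : c'.doubleFun (mirSource q) = mirSink (c'.g q) := c'.doubleFun_mir q
      rw [e1, e2, hc]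
      exact hmir _

theorem removal_merge (c : Cut n S M) (c' : Cut n S M') (eM : Option M' ≃ M)
    (hmax : ∀ q, c.g q ≠ .merge (eM none))
    (hc : ∀ q, c.g (q.map id (eM ∘ some)) = (c'.g q).map id (eM ∘ some)) :
    IsDipoleRemoval c.double c'.double := by
  set fS : Option (S ⊕ M') ≃ S ⊕ M :=
    (optionSumRight _ _).trans (Equiv.sumCongr (Equiv.refl _) eM) with hfS
  set fM : Option (M' ⊕ S) ≃ M ⊕ S :=
    (optionSumLeft _ _).trans (Equiv.sumCongr eM (Equiv.refl _)) with hfM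
  suffices main : c.doubleFun (.merge (fM none)) = .split (fS none) ∧
      ∀ p : Source n (S ⊕ M') (M' ⊕ S),
        c.doubleFun (p.map (fS ∘ some) (fM ∘ some)) =
          (c'.doubleFun p).map (fS ∘ some) (fM ∘ some) ∨
        ∃ b, c.doubleFun (p.map (fS ∘ some) (fM ∘ some)) = .merge (fM none) b ∧
          c.doubleFun (.split (fS none) b) = (c'.doubleFun p).map (fS ∘ some) (fM ∘ some) by
    exact ⟨fS, fM, .inr main⟩
  refine ⟨?_, fun p => ?_⟩
  · exact c.down_of (p := .merge (eM none)) (by rintro ⟨q, hq⟩; exact hmax q hq)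
  · have hmir : ∀ r : Source n S M', (mirSink (r.map id (eM ∘ some)) : Sink n (S ⊕ M) (M ⊕ S)) =
        (mirSink r).map (fS ∘ some) (fM ∘ some) := by
      rintro (_ | _ | _) <;> rfl
    rcases source_cases p with ⟨r, rfl⟩ | ⟨q, rfl⟩
    · have e1 : c.doubleFun ((upSource r).map (fS ∘ some) (fM ∘ some)) =
          c.down (r.map id (eM ∘ some)) := by
        rcases r <;> rfl
      have e2 : c'.doubleFun (upSource r) = c'.down r := c'.doubleFun_up r
      rw [e1, e2]
      by_cases hr : ∃ q, c'.g q = r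
      · obtain ⟨q, rfl⟩ := hr
        refine .inl ?_
        rw [← hc, down_g, down_g]
        rcases q with i | _ | _
        · exact i.elim0
        · rfl
        · rfl
      · rw [c'.down_of hr]
        by_cases hr' : ∃ q, c.g q = r.map id (eM ∘ some)
        · obtain ⟨q, hq⟩ := hr'
          have hqs : ∃ b, q = .merge (eM none) b := by
            rcases q with i | s | ⟨t, b⟩
            · exact i.elim0
            · exfalso
              have := hc (.split s)
              simp only [Sink.map, id] at this
              rw [this] at hq
              refine hr ⟨.split s, ?_⟩
              revert hq
              rcases c'.g (.split s) <;> rcases r <;> simp [Source.map]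
            · obtain ⟨o, rfl⟩ := eM.surjective t
              rcases o with _ | t
              · exact ⟨b, rfl⟩
              · exfalso
                have := hc (.merge t b)
                simp only [Sink.map, Function.comp_apply] at this
                rw [this] at hq
                refine hr ⟨.merge t b, ?_⟩
                revert hq
                rcases c'.g (.merge t b) <;> rcases r <;> simp [Source.map]
          obtain ⟨b, rfl⟩ := hqs
          refine .inr ⟨b, ?_, ?_⟩
          · rw [← hq, down_g]; rfl
          · have : c.doubleFun (.split (fS none) b) = mirSink (c.g (.merge (eM none) b)) := rfl
            rw [this, hq, hmir]
        · rw [c.down_of hr']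
          exact .inl (hmir r)
    · refine .inl ?_
      have e1 : c.doubleFun ((mirSource q).map (fS ∘ some) (fM ∘ some)) =
          mirSink (c.g (q.map id (eM ∘ some))) := by
        rcases q with i | _ | _
        · exact i.elim0
        · rfl
        · rfl
      have e2 : c'.doubleFun (mirSource q) = mirSink (c'.g q) := c'.doubleFun_mir q
      rw [e1, e2, hc]
      exact hmir _

open Classical in
theorem double_eq_one (N : ℕ) : ∀ (S M : Type) [Finite S] [Finite M] (c : Cut n S M),
    Nat.card (S ⊕ M) = N → DipoleEq c.double (ofPerm 1) := by
  induction N with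
  | zero =>
    intro S M _ _ c h
    have hE : IsEmpty (S ⊕ M) := by
      rcases Nat.card_eq_zero.1 h with h | h
      · exact h
      · exact absurd h (not_infinite_iff_finite.2 inferInstance)
    have hS : IsEmpty S := ⟨fun s => hE.elim (.inl s)⟩
    have hM : IsEmpty M := ⟨fun s => hE.elim (.inr s)⟩
    refine .of_iso ⟨Equiv.equivOfIsEmpty (S ⊕ M) Empty, Equiv.equivOfIsEmpty (M ⊕ S) Empty, ?_⟩
    rintro (i | ⟨s, b⟩ | t)
    · have : c.double.wire (.frame i) = .frame i := c.down_of (p := .frame i) (by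
        rintro ⟨q, hq⟩
        rcases q with i | s | ⟨t, b⟩
        · exact i.elim0
        · exact hS.elim s
        · exact hM.elim t)
      rw [this]; rfl
    · rcases s with s | s
      · exact hS.elim s
      · exact hM.elim s
    · rcases t with s | s
      · exact hM.elim s
      · exact hS.elim s
  | succ N ih =>
    intro S M _ _ c h
    let r : S ⊕ M → S ⊕ M → Prop := fun x y => Relation.TransGen
      (fun x y => ∃ q, (c.g q).transistor = some x ∧ q.transistor = some y) y x
    have : IsTrans _ r := ⟨fun _ _ _ h h' => Relation.TransGen.trans h' h⟩
    have : Std.Irrefl r := ⟨fun x h => c.acyclic x h⟩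
    have hwf : WellFounded r := Finite.wellFounded_of_trans_of_irrefl r
    have hne : Nonempty (S ⊕ M) := by
      by_contra hn
      rw [not_nonempty_iff] at hn
      simp at h
    obtain ⟨x, -, hx⟩ := hwf.has_min Set.univ Set.univ_nonempty
    have hmax : ∀ q, (c.g q).transistor ≠ some x := by
      intro q hq
      rcases q with i | s | ⟨t, b⟩
      · exact i.elim0
      · exact hx (.inl s) trivial (.single ⟨_, hq, rfl⟩)
      · exact hx (.inr t) trivial (.single ⟨_, hq, rfl⟩)
    rcases x with s | t
    · let eS : Option {a // a ≠ s} ≃ S := Equiv.optionSubtypeNe s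
      have hs : eS none = s := by simp [eS]
      have hm : ∀ q b, c.g q ≠ .split (eS none) b := by
        intro q b hq
        refine hmax q ?_
        rw [hq, hs]; rfl
      obtain ⟨c', hc'⟩ := c.exists_restrict (eS ∘ some) id
        (eS.injective.comp (Option.some_injective _)) Function.injective_id (by
          intro q
          rcases hq : c.g (q.map (eS ∘ some) id) with i | ⟨a, b⟩ | t
          · exact ⟨.frame i, rfl⟩
          · obtain ⟨o, rfl⟩ := eS.surjective a
            rcases o with _ | a
            · exact absurd hq (hm _ _)
            · exact ⟨.split a b, rfl⟩
          · exact ⟨.merge t, rfl⟩)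
      refine DipoleEq.trans (.rel _ _ (.inr (removal_split c c' eS hm hc'))) (ih _ _ c' ?_)
      have e : Nat.card (Option ({a // a ≠ s} ⊕ M)) = Nat.card (S ⊕ M) :=
        Nat.card_congr ((optionSumLeft _ _).trans (Equiv.sumCongr eS (Equiv.refl _)))
      rw [Finite.card_option] at e
      omega
    · let eM : Option {a // a ≠ t} ≃ M := Equiv.optionSubtypeNe t
      have hs : eM none = t := by simp [eM]
      have hm : ∀ q, c.g q ≠ .merge (eM none) := by
        intro q hq
        refine hmax q ?_
        rw [hq, hs]; rfl
      obtain ⟨c', hc'⟩ := c.exists_restrict id (eM ∘ some) Function.injective_id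
        (eM.injective.comp (Option.some_injective _)) (by
          intro q
          rcases hq : c.g (q.map id (eM ∘ some)) with i | ⟨a, b⟩ | t
          · exact ⟨.frame i, rfl⟩
          · exact ⟨.split a b, rfl⟩
          · obtain ⟨o, rfl⟩ := eM.surjective t
            rcases o with _ | a
            · exact absurd hq (hm _)
            · exact ⟨.merge a, rfl⟩)
      refine DipoleEq.trans (.rel _ _ (.inr (removal_merge c c' eM hm hc'))) (ih _ _ c' ?_)
      have e : Nat.card (Option (S ⊕ {a // a ≠ t})) = Nat.card (S ⊕ M) :=
        Nat.card_congr ((optionSumRight _ _).trans (Equiv.sumCongr (Equiv.refl _) eM))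
      rw [Finite.card_option] at e
      omega

end Cut

/-- Auxiliary: cut the wires at the bottom of the frame. -/
def toCut (P : Picture n m) : Cut n P.S P.M where
  g q := P.wire.symm (match q with
    | .split s => .split s
    | .merge t b => .merge t b)
  inj := by
    intro a b h
    have h := P.wire.symm.injective h
    rcases a with i | _ | _
    · exact i.elim0
    all_goals
      rcases b with i | _ | _
      · exact i.elim0
      all_goals simp_all
  acyclic x hx := by
    refine P.acyclic x (Relation.TransGen.mono ?_ x x hx)
    rintro a b ⟨q, h1, h2⟩
    refine ⟨_, h1, ?_⟩
    rw [Equiv.apply_symm_apply]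
    rcases q with i | _ | _
    · exact i.elim0
    all_goals exact h2

theorem concat_mirror (P : Picture n m) (hP : P.IsFinite) :
    DipoleEq (P.concat P.mirror) (ofPerm 1) := by
  have : Finite P.S := hP.1
  have : Finite P.M := hP.2
  refine DipoleEq.trans (.of_iso ?_) (P.toCut.double_eq_one _ _ _ rfl)
  have hm : ∀ q : Sink m P.S P.M, (P.mirror.wire ((flip m P.S P.M).symm q)).map Sum.inr Sum.inr =
      (Cut.mirSink (P.wire.symm q) : Sink n (P.S ⊕ P.M) (P.M ⊕ P.S)) := by
    intro q
    have e : P.mirror.wire ((flip m P.S P.M).symm q) = flip n P.M P.S ((P.wire.symm q)) := by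
      have := congrArg (fun x => flip n P.M P.S (P.wire.symm x))
        ((flip m P.S P.M).apply_symm_apply q)
      exact this
    rw [e]
    rcases P.wire.symm q <;> rfl
  have hd : ∀ q : Sink m P.S P.M, P.toCut.down (P.wire.symm q) = concatDown P P.mirror q := by
    rintro (j | s | ⟨t, b⟩)
    · rw [Cut.down_of, ← hm]
      · rfl
      · rintro ⟨q, hq⟩
        have hq := P.wire.symm.injective hq
        rcases q with i | _ | _
        · exact i.elim0
        all_goals simp at hq
    · exact P.toCut.down_g (.split s)
    · exact P.toCut.down_g (.merge t b)
  have hd' : ∀ p, P.toCut.down p = concatDown P P.mirror (P.wire p) := by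
    intro p
    rw [← hd, Equiv.symm_apply_apply]
  have hI : ∀ q : Sink n (P.S ⊕ P.M) (P.M ⊕ P.S), q.map (Equiv.refl _) (Equiv.refl _) = q := by
    rintro (_ | _ | _) <;> rfl
  refine ⟨Equiv.refl _, Equiv.refl _, ?_⟩
  rintro (i | ⟨s | t, b⟩ | (t | s))
  · exact (hd' _).trans (hI _).symm
  · exact (hd' _).trans (hI _).symm
  · exact (hm (.merge t b)).symm.trans (hI _).symm
  · exact (hd' _).trans (hI _).symm
  · exact (hm (.split s)).symm.trans (hI _).symm

/-- Mirroring twice gives back the picture. -/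
def mirrorMirror (P : Picture n m) : Iso P.mirror.mirror P where
  eS := Equiv.refl _
  eM := Equiv.refl _
  wire p := by
    have h1 : ∀ q : Source n P.S P.M, P.mirror.mirror.wire q = P.wire q := by
      intro q
      have h : flip m P.S P.M ((flip m P.S P.M).symm
          (P.wire ((flip n P.M P.S).symm (flip n P.M P.S q)))) = P.wire q := by simp
      exact h
    have h2 : ∀ q : Source n P.S P.M, q.map (Equiv.refl P.S) (Equiv.refl P.M) = q := by
      rintro (_ | _ | _) <;> rfl
    have h3 : ∀ q : Sink m P.S P.M, q.map (Equiv.refl P.S) (Equiv.refl P.M) = q := by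
      rintro (_ | _ | _) <;> rfl
    exact ((congrArg P.wire (h2 p)).trans (h1 p).symm).trans (h3 _).symm

theorem mirror_concat (P : Picture n m) (hP : P.IsFinite) :
    DipoleEq (P.mirror.concat P) (ofPerm 1) :=
  (DipoleEq.concat (.refl _) (.of_iso P.mirrorMirror.symm)).trans
    (P.mirror.concat_mirror ⟨hP.2, hP.1⟩)

theorem ofPerm_mirror (σ : Equiv.Perm (Fin n)) : Nonempty (Iso (ofPerm σ⁻¹) (ofPerm σ).mirror) :=
  ⟨⟨Equiv.refl _, Equiv.refl _, by rintro (i | ⟨⟨⟩, _⟩ | ⟨⟨⟩⟩); rfl⟩⟩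

/-- The mirror image of a concatenation. -/
def concatMirror (P : Picture n k) (Q : Picture k m) :
    Iso (Q.mirror.concat P.mirror) (P.concat Q).mirror where
  eS := Equiv.sumComm _ _
  eM := Equiv.sumComm _ _
  wire p := by
    have hd : ∀ q : Source k Q.S Q.M, flip n _ _ (concatUp P Q q) =
        (concatDown Q.mirror P.mirror (flip k _ _ q)).map
          (Equiv.sumComm _ _) (Equiv.sumComm _ _) := by
      have hP : ∀ q : Source n P.S P.M, flip n _ _ (q.map Sum.inl Sum.inl :
          Source n (P.S ⊕ Q.S) (P.M ⊕ Q.M)) =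
          ((flip n _ _ q).map Sum.inr Sum.inr : Sink n (Q.M ⊕ P.M) (Q.S ⊕ P.S)).map
            (Equiv.sumComm _ _) (Equiv.sumComm _ _) := by
        rintro (_ | _ | _) <;> rfl
      rintro (j | _ | _)
      · exact hP _
      · rfl
      · rfl
    have hP : ∀ q : Source n P.S P.M, flip n _ _ (q.map Sum.inl Sum.inl :
        Source n (P.S ⊕ Q.S) (P.M ⊕ Q.M)) =
        ((flip n _ _ q).map Sum.inr Sum.inr : Sink n (Q.M ⊕ P.M) (Q.S ⊕ P.S)).map
          (Equiv.sumComm _ _) (Equiv.sumComm _ _) := by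
      rintro (_ | _ | _) <;> rfl
    rcases p with i | ⟨s | s, b⟩ | (t | t)
    · exact hd _
    · exact hd _
    · exact hP _
    · exact hd _
    · exact hP _

/-- The mirror images of isomorphic pictures are isomorphic. -/
def Iso.mirror {P Q : Picture n m} (e : Iso P Q) : Iso P.mirror Q.mirror where
  eS := e.eM
  eM := e.eS
  wire p := by
    have h1 : ∀ q : Sink m P.S P.M, Q.wire.symm (q.map e.eS e.eM) =
        (P.wire.symm q).map e.eS e.eM := by
      intro q
      rw [Equiv.symm_apply_eq, e.wire, Equiv.apply_symm_apply]
    have h2 : ∀ q : Source n P.S P.M, flip n _ _ (q.map e.eS e.eM) =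
        (flip n _ _ q).map e.eM e.eS := by
      rintro (_ | _ | _) <;> rfl
    rcases p with i | ⟨t, b⟩ | s
    · exact (congrArg (flip n _ _) (h1 (.frame i))).trans (h2 _)
    · exact (congrArg (flip n _ _) (h1 (.merge t b))).trans (h2 _)
    · exact (congrArg (flip n _ _) (h1 (.split s))).trans (h2 _)

/-- The picture with one transistor, an `(x², x)`-transistor attached to the first two of the
`n + 2` contacts on the top of the frame, in this order; the other wires run straight down. -/
def mergeFirst (n : ℕ) : Picture (n + 2) (n + 1) := (splitFirst n).mirror

/-- A finite picture is annular if it can be drawn, without crossings of wires and respecting the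
orientations of the transistors and of the frame, in the annulus, with the top of the frame
wrapped around the inner boundary circle and the bottom wrapped around the outer one. Reading such a
drawing from the inner to the outer circle, one transistor at a time, the pictures that can be
drawn in this way are the ones that are composed of cyclic rotations of the contacts and of single
transistors attached to consecutive contacts. -/
inductive IsAnnular : ∀ {n m : ℕ}, Picture n m → Prop
  | rotation (n : ℕ) (j : ℤ) : IsAnnular (ofPerm (finRotate n ^ j))
  | split (n : ℕ) : IsAnnular (splitFirst n)
  | merge (n : ℕ) : IsAnnular (mergeFirst n)
  | concat {n k m : ℕ} {P : Picture n k} {Q : Picture k m} :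
      IsAnnular P → IsAnnular Q → IsAnnular (P.concat Q)
  | iso {n m : ℕ} {P Q : Picture n m} : Nonempty (Iso P Q) → IsAnnular P → IsAnnular Q

theorem isFinite_one : (ofPerm (1 : Equiv.Perm (Fin n))).IsFinite :=
  ⟨inferInstanceAs (Finite Empty), inferInstanceAs (Finite Empty)⟩

theorem IsFinite.concat {P : Picture n k} {Q : Picture k m} (hP : P.IsFinite) (hQ : Q.IsFinite) :
    (P.concat Q).IsFinite := by
  have := hP.1
  have := hP.2
  have := hQ.1
  have := hQ.2
  exact ⟨inferInstanceAs (Finite (P.S ⊕ Q.S)), inferInstanceAs (Finite (P.M ⊕ Q.M))⟩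

theorem IsFinite.mirror {P : Picture n m} (hP : P.IsFinite) : P.mirror.IsFinite := ⟨hP.2, hP.1⟩

theorem IsAnnular.isFinite {P : Picture n m} (h : IsAnnular P) : P.IsFinite := by
  induction h with
  | rotation n j => exact ⟨inferInstanceAs (Finite Empty), inferInstanceAs (Finite Empty)⟩
  | split n => exact ⟨inferInstanceAs (Finite Unit), inferInstanceAs (Finite Empty)⟩
  | merge n => exact ⟨inferInstanceAs (Finite Empty), inferInstanceAs (Finite Unit)⟩
  | concat _ _ h h' => exact h.concat h'
  | iso e _ h =>
    obtain ⟨e⟩ := e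
    have := h.1
    have := h.2
    exact ⟨Finite.of_equiv _ e.eS, Finite.of_equiv _ e.eM⟩

theorem IsAnnular.mirror {P : Picture n m} (h : IsAnnular P) : IsAnnular P.mirror := by
  induction h with
  | rotation n j =>
    refine .iso (ofPerm_mirror _) ?_
    rw [← zpow_neg]
    exact .rotation n (-j)
  | split n => exact .merge n
  | merge n => exact .iso ⟨(mirrorMirror _).symm⟩ (.split n)
  | concat _ _ h h' => exact .iso ⟨concatMirror _ _⟩ (.concat h' h)
  | iso e _ h =>
    obtain ⟨e⟩ := e
    exact .iso ⟨e.mirror⟩ h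

theorem IsAnnular.one : IsAnnular (ofPerm (1 : Equiv.Perm (Fin n))) := by
  have := IsAnnular.rotation n 0
  rwa [zpow_zero] at this

/-- `Q` is obtained from the picture `P` by keeping only the transistors in `A` and the wires
attached to the top of the frame or to their bottoms: `P` is a concatenation of `Q` and some
picture, and `A` is the set of transistors contributed by `Q`. -/
def IsTruncation (P : Picture n m) (A : Set P.Transistor) (Q : Picture n k) : Prop :=
  ∃ (R : Picture k m) (e : Iso (Q.concat R) P),
    A = Set.range fun x : Q.Transistor => Sum.map (e.eS ∘ Sum.inl) (e.eM ∘ Sum.inl) x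

/-- The infinite picture whose wires and transistors form the full infinite ordered rooted binary
tree. All transistors are `(x, x²)`-transistors; they are labelled by the finite binary words, where
the word `b :: w` belongs to the transistor below the left (`b = false`) or right (`b = true`)
bottom contact of the transistor `w`. No wire reaches the bottom of the frame. -/
def infiniteTree : Picture 1 0 where
  S := List Bool
  M := Empty
  wire :=
    { toFun := fun p => match p with
        | .frame _ => .split []
        | .split w b => .split (b :: w)
      invFun := fun q => match q with
        | .split [] => .frame 0
        | .split (b :: w) => .split w b
      left_inv := fun p => by
        rcases p with i | ⟨w, b⟩ | ⟨⟨⟩⟩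
        · rw [Subsingleton.elim i 0]
        · rfl
      right_inv := fun q => by
        rcases q with i | w | ⟨⟨⟩, _⟩
        · exact i.elim0
        · cases w <;> rfl }
  acyclic := by
    refine fun x hx => ?_
    have hlt : ∀ x y : List Bool ⊕ Empty, Relation.TransGen (Above fun p : Source 1 (List Bool) Empty =>
        (match p with
        | .frame _ => .split []
        | .split w b => .split (b :: w) : Sink 0 (List Bool) Empty)) x y →
        x.elim List.length (fun _ => 0) < y.elim List.length (fun _ => 0) := by
      have h1 : ∀ x y : List Bool ⊕ Empty, Above (fun p : Source 1 (List Bool) Empty =>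
          (match p with
          | .frame _ => .split []
          | .split w b => .split (b :: w) : Sink 0 (List Bool) Empty)) x y →
          x.elim List.length (fun _ => 0) < y.elim List.length (fun _ => 0) := by
        rintro x y ⟨p, hp, hq⟩
        rcases p with i | ⟨w, b⟩ | ⟨⟨⟩⟩
        · simp [Source.transistor] at hp
        · simp only [Source.transistor, Option.some.injEq, Sink.transistor] at hp hq
          subst hp hq
          simp
      intro x y h
      induction h with
      | single h => exact h1 _ _ h
      | tail _ h ih => exact ih.trans (h1 _ _ h)
    exact lt_irrefl _ (hlt x x hx)

end Picture

open Picture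

/-- A class of finite pictures that contains the identity pictures and is closed under
concatenation and mirroring. -/
structure PictureClass where
  Mem : ∀ {n m : ℕ}, Picture n m → Prop
  isFinite : ∀ {n m : ℕ} {P : Picture n m}, Mem P → P.IsFinite
  one : ∀ {n : ℕ}, Mem (ofPerm (1 : Equiv.Perm (Fin n)))
  concat : ∀ {n k m : ℕ} {P : Picture n k} {Q : Picture k m}, Mem P → Mem Q → Mem (P.concat Q)
  mirror : ∀ {n m : ℕ} {P : Picture n m}, Mem P → Mem P.mirror

/-- The class of all finite ("braided") pictures. -/
def braided : PictureClass where
  Mem := IsFinite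
  isFinite := id
  one := isFinite_one
  concat := IsFinite.concat
  mirror := IsFinite.mirror

/-- The class of all annular pictures. -/
def annular : PictureClass where
  Mem := IsAnnular
  isFinite := IsAnnular.isFinite
  one := IsAnnular.one
  concat := IsAnnular.concat
  mirror := IsAnnular.mirror

/-- The diagram group of a class of pictures: the `(x, x)`-pictures in the class modulo dipoles. -/
def DiagramGroup (C : PictureClass) : Type 1 :=
  Quot fun P Q : {P : Picture 1 1 // C.Mem P} => DipoleEq P.1 Q.1

namespace DiagramGroup

variable {C : PictureClass}

/-- The element of the diagram group represented by a picture. -/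
def mk (P : Picture 1 1) (hP : C.Mem P) : DiagramGroup C := Quot.mk _ ⟨P, hP⟩

theorem sound {P Q : Picture 1 1} {hP : C.Mem P} {hQ : C.Mem Q} (h : DipoleEq P Q) :
    mk P hP = mk Q hQ := Quot.sound h

theorem mirror_eq {P Q : Picture 1 1} (hP : P.IsFinite) (hQ : Q.IsFinite) (h : DipoleEq P Q) :
    DipoleEq P.mirror Q.mirror :=
  (DipoleEq.of_iso (Iso.concatOne P.mirror)).symm.trans <|
    ((DipoleEq.refl _).concat (Q.concat_mirror hQ).symm).trans <|
    (DipoleEq.of_iso (Iso.assoc _ _ _)).symm.trans <|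
    (((DipoleEq.refl _).concat h.symm).concat (.refl _)).trans <|
    ((P.mirror_concat hP).concat (.refl _)).trans (.of_iso (Iso.oneConcat _))

/-- The diagram group of a class of pictures; the product is induced by concatenation. -/
instance : Group (DiagramGroup C) where
  mul := Quot.map₂ (fun P Q => ⟨P.1.concat Q.1, C.concat P.2 Q.2⟩)
    (fun P _ _ h => (DipoleEq.refl P.1).concat h) (fun _ _ Q h => h.concat (.refl Q.1))
  one := mk (ofPerm 1) C.one
  inv := Quot.map (fun P => ⟨P.1.mirror, C.mirror P.2⟩)
    (fun P Q h => mirror_eq (C.isFinite P.2) (C.isFinite Q.2) h)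
  mul_assoc := by
    rintro ⟨P⟩ ⟨Q⟩ ⟨R⟩
    exact Quot.sound (.of_iso (Iso.assoc P.1 Q.1 R.1))
  one_mul := by
    rintro ⟨P⟩
    exact Quot.sound (.of_iso (Iso.oneConcat P.1))
  mul_one := by
    rintro ⟨P⟩
    exact Quot.sound (.of_iso (Iso.concatOne P.1))
  inv_mul_cancel := by
    rintro ⟨P⟩
    exact Quot.sound (P.1.mirror_concat (C.isFinite P.2))

end DiagramGroup

/-- Thompson's group `T`, as the annular diagram group over `⟨x ∣ x = x²⟩` based at `x`. -/
abbrev ThompsonT : Type 1 := DiagramGroup annular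

/-- Thompson's group `V`, as the braided diagram group over `⟨x ∣ x = x²⟩` based at `x`. -/
abbrev ThompsonV : Type 1 := DiagramGroup braided

namespace PictureClass

variable (C : PictureClass)

/-- The vertices of the diagram complex: the pictures in the class with one contact on the top of
the frame, where two pictures are identified if, modulo dipoles, they differ by the concatenation with a
permutation picture in the class. Every vertex has a reduced representative. -/
def Vertex : Type 1 :=
  Quot fun P Q : Σ n, {P : Picture 1 n // C.Mem P} =>
    ∃ Ψ : Picture P.1 Q.1, C.Mem Ψ ∧ Ψ.IsPermutation ∧ DipoleEq (P.2.1.concat Ψ) Q.2.1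

variable {C}

/-- The vertex represented by a picture. -/
def vertex {n : ℕ} (P : Picture 1 n) (hP : C.Mem P) : C.Vertex := Quot.mk _ ⟨n, P, hP⟩

/-- The action of the diagram group on the vertices of the diagram complex by concatenation. -/
instance : MulAction (DiagramGroup C) C.Vertex where
  smul := Quot.map₂ (fun g P => ⟨P.1, g.1.concat P.2.1, C.concat g.2 P.2.2⟩)
    (fun g P Q ⟨Ψ, hΨ, hΨ', h⟩ => ⟨Ψ, hΨ, hΨ',
      (DipoleEq.of_iso (Iso.assoc _ _ _)).trans ((DipoleEq.refl _).concat h)⟩)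
    (fun g g' P h => ⟨ofPerm 1, C.one,
      ⟨inferInstanceAs (IsEmpty Empty), inferInstanceAs (IsEmpty Empty)⟩,
      (DipoleEq.of_iso (Iso.concatOne _)).trans (DipoleEq.concat h (.refl _))⟩)
  one_smul := by
    rintro ⟨P⟩
    exact Quot.sound ⟨ofPerm 1, C.one,
      ⟨inferInstanceAs (IsEmpty Empty), inferInstanceAs (IsEmpty Empty)⟩,
      (DipoleEq.of_iso (Iso.concatOne _)).trans (.of_iso (Iso.oneConcat _))⟩
  mul_smul := by
    rintro ⟨g⟩ ⟨h⟩ ⟨P⟩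
    exact Quot.sound ⟨ofPerm 1, C.one,
      ⟨inferInstanceAs (IsEmpty Empty), inferInstanceAs (IsEmpty Empty)⟩,
      (DipoleEq.of_iso (Iso.concatOne _)).trans (.of_iso (Iso.assoc _ _ _))⟩

variable (C)

/-- The base vertex of the diagram complex: the vertex without transistors. -/
def base : C.Vertex := vertex (ofPerm 1) C.one

/-- The (finite or infinite) picture `P`, after all transistors outside the set `A` have been left
off, represents the vertex `v`. -/
def Represents {n : ℕ} (P : Picture 1 n) (A : Set P.Transistor) (v : C.Vertex) : Prop :=
  ∃ (m : ℕ) (Q : Picture 1 m) (hQ : C.Mem Q), P.IsTruncation A Q ∧ v = vertex Q hQ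

/-- The edges of the diagram complex, written as pairs of vertices: a reduced picture in the
class with one white maximal transistor `x` is an edge from the vertex where `x` is
left off to the vertex where `x` is filled in. -/
def IsEdge (e : C.Vertex × C.Vertex) : Prop :=
  ∃ (n : ℕ) (P : Picture 1 n) (x : P.Transistor), C.Mem P ∧ P.IsReduced ∧ P.IsMaximal x ∧
    C.Represents P {x}ᶜ e.1 ∧ C.Represents P Set.univ e.2

/-- Opposite edges of a square of the diagram complex. A reduced picture in the class with
two white maximal transistors `x` and `y` is a square; its edges along which `x` is added are
`e`, where `y` is left off, and `f`, where `y` is filled in. -/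
def IsParallel (e f : C.Vertex × C.Vertex) : Prop :=
  ∃ (n : ℕ) (P : Picture 1 n) (x y : P.Transistor), C.Mem P ∧ P.IsReduced ∧
    P.IsMaximal x ∧ P.IsMaximal y ∧ x ≠ y ∧
    C.Represents P {x, y}ᶜ e.1 ∧ C.Represents P {y}ᶜ e.2 ∧
    C.Represents P {x}ᶜ f.1 ∧ C.Represents P Set.univ f.2

/-- The combinatorial hyperplane of an edge: its class under square equivalence. -/
def hyperplane (e : C.Vertex × C.Vertex) : Set (C.Vertex × C.Vertex) :=
  {f | Relation.EqvGen C.IsParallel e f}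

/-- The vertices of the positive half-space of a hyperplane `H`: those that cannot be joined to the
base vertex by an edge path that does not cross `H`. -/
def halfSpace (H : Set (C.Vertex × C.Vertex)) : Set C.Vertex :=
  {v | ¬ Relation.EqvGen (fun a b => C.IsEdge (a, b) ∧ (a, b) ∉ H) C.base v}

/-- The positive half-spaces of the diagram complex, as sets of vertices. -/
def IsPositive (A : Set C.Vertex) : Prop := ∃ e, C.IsEdge e ∧ A = C.halfSpace (C.hyperplane e)

/-- A profile is a non-empty collection of positive half-spaces such that (1) any finitely many of
its members have a common vertex, (2) it has no maximal element and (3) it is closed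
downwards, where positive half-spaces are ordered by reverse inclusion. -/
structure IsProfile (𝓗 : Set (Set C.Vertex)) : Prop where
  isPositive : ∀ A ∈ 𝓗, C.IsPositive A
  nonempty : 𝓗.Nonempty
  inter_nonempty : ∀ F ⊆ 𝓗, F.Finite → (⋂₀ F).Nonempty
  exists_gt : ∀ A ∈ 𝓗, ∃ B ∈ 𝓗, B ⊂ A
  mem_of_le : ∀ A ∈ 𝓗, ∀ B, C.IsPositive B → A ⊆ B → B ∈ 𝓗

/-- The translate `g * 𝓗` of a profile `𝓗`: the profile that is cofinal with the collection of
those half-spaces `g • A`, `A ∈ 𝓗`, which are positive. -/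
def translate (g : DiagramGroup C) (𝓗 : Set (Set C.Vertex)) : Set (Set C.Vertex) :=
  {B | C.IsPositive B ∧ ∃ A ∈ 𝓗, C.IsPositive ((g • ·) '' A) ∧ (g • ·) '' A ⊆ B}

/-- The collection of positive half-spaces determined by an infinite picture `P`: a transistor `x`
of `P` corresponds to the hyperplane of the edge which adds the transistor `x` to the
finite set of all transistors above `x`. -/
def profileOf (P : Picture 1 0) : Set (Set C.Vertex) :=
  {A | ∃ (x : P.Transistor) (e : C.Vertex × C.Vertex), C.Represents P {y | P.Lt y x} e.1 ∧
    C.Represents P {y | P.Lt y x ∨ y = x} e.2 ∧ A = C.halfSpace (C.hyperplane e)}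

/-- The profile `Δ_∞` of the full infinite binary tree. -/
def treeProfile : Set (Set C.Vertex) := C.profileOf infiniteTree

end PictureClass

end DiagramProfile

/-! Label the wires of a picture with one contact on top by self-maps of the Cantor set of binary
sequences. The top wire carries the identity, an (x, x²)-transistor restricts a map to the two
halves of the Cantor set, and an (x², x)-transistor glues two maps along the halves. Labels survive
the removal of dipoles, so a vertex `v` has a well-defined finite set `pieces v` of labels at the
bottom, and these maps send a disjoint union of Cantor sets bijectively onto the Cantor set. The set
determines the vertex (`eq_of_pieces_eq`): splits of different pieces commute (`exists_diamond`), a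
split can be cancelled (`Split.cancel`), and any two vertices can be split down to a common flat
vertex, all of whose pieces are words of one length (`exists_chain_flat`).

A label is a word if it merely puts a finite word in front of its argument. In a reduced picture the
labels above (x, x²)-transistors are words and those below (x², x)-transistors are not
(`IsReduced.isNormal`), and this property forces the picture to be reduced (`IsNormal.isReduced`).
Hence the label `h` of an edge decides the type of its transistor, and two edges lie in the same
hyperplane exactly when their labels agree (`edge_iff_of_eqvGen`, `Edge.eqvGen`). Crossing that
hyperplane means gaining or losing a piece that restricts to `h`. The base vertex has such a piece
if and only if `h` is a word, which describes the positive half-space `half h`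
(`halfSpace_hyperplane`).

A group element acts on labels by composition with a bijection `γ`, and it takes `half h` to `half
(γ ∘ h)` when `h` and `γ ∘ h` are both words or both non-words; otherwise the translate is not
positive. The profile of the tree consists of the half-spaces of words (`treeProfile_eq`). It is
invariant because `γ` maps all sufficiently long words to words (`Induces.translate_words`).

Conversely, let an invariant profile contain `half h` with `h` not a word. Regrouping the wires
below `h` shows that the group moves `h` to `h ∘ σ`, where `σ` is `shift` or its square, so that `h
∘ σ` is again not a word. The two labels have the same image but differ, so no vertex has pieces
restricting to both: two members of the profile are disjoint, which is impossible
(`IsProfile.isWord_of_half_mem`). So only words occur. Since there is no maximal element, words of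
every length occur, and the group permutes the words of one length transitively
(`IsProfile.eq_words`).

Only rotations are needed to bring wires next to each other, so one argument covers the annular and
the braided class; `PictureClass.IsNice` lists what the two have in common. -/

namespace DiagramProfile

/-! ### Self-maps of the Cantor set -/

/-- The Cantor set, as the set of infinite binary sequences. -/
abbrev Cantor : Type := ℕ → Bool

/-- Put a bit in front of a sequence. -/
def cons (b : Bool) (c : Cantor) : Cantor := fun i => Nat.casesOn i b c

/-- Remove the first bit of a sequence. -/
def tail (c : Cantor) : Cantor := fun i => c (i + 1)

@[simp] theorem cons_zero (b : Bool) (c : Cantor) : cons b c 0 = b := rfl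
@[simp] theorem cons_succ (b : Bool) (c : Cantor) (i : ℕ) : cons b c (i + 1) = c i := rfl
@[simp] theorem tail_cons (b : Bool) (c : Cantor) : tail (cons b c) = c := rfl
@[simp] theorem cons_tail (c : Cantor) : cons (c 0) (tail c) = c := by
  funext i; cases i <;> rfl

theorem cons_injective {b b' : Bool} {c c' : Cantor} (h : cons b c = cons b' c') :
    b = b' ∧ c = c' :=
  ⟨congrFun h 0, congrArg tail h⟩

theorem exists_cons (c : Cantor) : ∃ b c', c = cons b c' := ⟨c 0, tail c, (cons_tail c).symm⟩

/-- A self-map of the Cantor set; the wires of a picture will be labelled by these. -/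
abbrev Piece : Type := Cantor → Cantor

namespace Piece

/-- The restriction of a map to one half of the Cantor set. -/
def sub (f : Piece) (b : Bool) : Piece := fun c => f (cons b c)

/-- The map with given restrictions to the two halves of the Cantor set. -/
def join (f g : Piece) : Piece := fun c => if c 0 then g (tail c) else f (tail c)

@[simp] theorem sub_join (f g : Piece) (b : Bool) : (join f g).sub b = if b then g else f := by
  funext c; cases b <;> simp [sub, join]

theorem ext_sub {f g : Piece} (h : ∀ b, f.sub b = g.sub b) : f = g := by
  funext c
  obtain ⟨b, c, rfl⟩ := exists_cons c
  exact congrFun (h b) c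

end Piece

/-- Put a finite word in front of a sequence; the head of the list is the last letter. -/
def pre : List Bool → Piece
  | [] => id
  | b :: w => fun c => pre w (cons b c)

@[simp] theorem pre_nil : pre [] = id := rfl

theorem pre_cons (b : Bool) (w : List Bool) : pre (b :: w) = (pre w).sub b := rfl

theorem comp_pre_cons (f : Piece) (b : Bool) (w : List Bool) :
    f ∘ pre (b :: w) = Piece.sub (f ∘ pre w) b := rfl

/-- Lists are stored with the last letter first, so a half chosen before the cone `w` contributes
the first letter, which stands at the end of the list. -/
theorem sub_comp_pre (f : Piece) (b : Bool) (w : List Bool) :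
    f.sub b ∘ pre w = f ∘ pre (w ++ [b]) := by
  induction w with
  | nil => rfl
  | cons a w ih => rw [comp_pre_cons, ih]; rfl

theorem pre_concat (w : List Bool) (b : Bool) (c : Cantor) :
    pre (w ++ [b]) c = cons b (pre w c) := by
  induction w generalizing c with
  | nil => rfl
  | cons a w ih => exact ih _

/-- As a consequence, the cone of `u ++ w` lies inside the cone of `w`: longer words have the
shorter ones as suffixes of the list. -/
theorem pre_append (u w : List Bool) : pre (u ++ w) = pre w ∘ pre u := by
  induction u with
  | nil => rfl
  | cons a u ih => rw [List.cons_append, pre_cons, ih]; rfl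

theorem pre_injective (w : List Bool) : Function.Injective (pre w) := by
  induction w with
  | nil => exact Function.injective_id
  | cons b w ih => exact fun c c' h => (cons_injective (ih h)).2

/-- Words whose cones meet are comparable. -/
theorem comparable_of_pre_eq {u w : List Bool} {c d : Cantor} (h : pre u c = pre w d) :
    (∃ t, u = t ++ w) ∨ ∃ t, w = t ++ u := by
  induction u using List.reverseRecOn generalizing w with
  | nil => exact .inr ⟨w, by simp⟩
  | append_singleton u b ih =>
    rcases List.eq_nil_or_concat w with rfl | ⟨w, b', rfl⟩
    · exact .inl ⟨u ++ [b], by simp⟩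
    · rw [List.concat_eq_append] at h ⊢
      rw [pre_concat, pre_concat] at h
      obtain ⟨rfl, h'⟩ := cons_injective h
      rcases ih h' with ⟨t, rfl⟩ | ⟨t, rfl⟩
      · exact .inl ⟨t, by simp⟩
      · exact .inr ⟨t, by simp⟩

theorem exists_pre_eq (n : ℕ) (c : Cantor) : ∃ w d, w.length = n ∧ pre w d = c := by
  induction n generalizing c with
  | zero => exact ⟨[], c, rfl, rfl⟩
  | succ n ih =>
    obtain ⟨w, d, hw, rfl⟩ := ih c
    exact ⟨d 0 :: w, tail d, by simp [hw], by simp [pre_cons, Piece.sub]⟩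

theorem eq_nil_of_surjective {u : List Bool} (h : Function.Surjective (pre u)) : u = [] := by
  rcases List.eq_nil_or_concat u with rfl | ⟨w, b, rfl⟩
  · rfl
  · obtain ⟨c, hc⟩ := h (fun _ => !b)
    rw [List.concat_eq_append, pre_concat] at hc
    have := congrFun hc 0
    cases b <;> simp at this

/-- The image of a cone determines the word. -/
theorem eq_of_range_pre_eq {u w : List Bool} (h : Set.range (pre u) = Set.range (pre w)) :
    u = w := by
  have key : ∀ {t w : List Bool}, Set.range (pre w) ⊆ Set.range (pre (t ++ w)) → t = [] := by
    intro t w h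
    refine eq_nil_of_surjective fun c => ?_
    obtain ⟨d, hd⟩ := h ⟨c, rfl⟩
    rw [pre_append] at hd
    exact ⟨d, pre_injective w hd⟩
  -- A test point lies in both cones, so the words are comparable, and `key` shows that the excess
  -- letters are absent.
  obtain ⟨d, hd⟩ : pre u (fun _ => true) ∈ Set.range (pre w) := h ▸ ⟨_, rfl⟩
  rcases comparable_of_pre_eq hd with ⟨t, rfl⟩ | ⟨t, rfl⟩
  · rw [key h.le]; rfl
  · rw [key h.ge]; rfl

theorem pre_inj {u w : List Bool} (h : pre u = pre w) : u = w :=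
  eq_of_range_pre_eq (by rw [h])

theorem comp_pre_inj {f : Piece} (hf : Function.Injective f) {u w : List Bool}
    (h : f ∘ pre u = f ∘ pre w) : u = w :=
  pre_inj (funext fun c => hf (congrFun h c))

/-- A piece is a word if it puts a fixed finite word in front of its argument. -/
def IsWord (f : Piece) : Prop := ∃ w, f = pre w

theorem IsWord.sub {f : Piece} (h : IsWord f) (b : Bool) : IsWord (f.sub b) := by
  obtain ⟨w, rfl⟩ := h; exact ⟨b :: w, rfl⟩

/-- A piece is a word of length `N`. -/
def IsWordOf (N : ℕ) (f : Piece) : Prop := ∃ w : List Bool, w.length = N ∧ f = pre w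

/-- A piece whose restrictions to all sufficiently small cones are words. -/
def Tame (f : Piece) : Prop := ∃ n, ∀ u : List Bool, n ≤ u.length → IsWord (f ∘ pre u)

theorem tame_id : Tame id := ⟨0, fun u _ => ⟨u, rfl⟩⟩

theorem Tame.sub {f : Piece} (h : Tame f) (b : Bool) : Tame (f.sub b) := by
  obtain ⟨n, h⟩ := h
  refine ⟨n, fun u hu => ?_⟩
  rw [sub_comp_pre]
  exact h _ (by simp; omega)

theorem Tame.of_sub {f : Piece} (h : ∀ b, Tame (f.sub b)) : Tame f := by
  obtain ⟨n, hn⟩ := h false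
  obtain ⟨k, hk⟩ := h true
  -- The summand `1` makes the word non-empty, so that its first letter selects a half; `n + k`
  -- bounds the depths needed in both halves.
  refine ⟨n + k + 1, fun u hu => ?_⟩
  rcases List.eq_nil_or_concat u with rfl | ⟨u, b, rfl⟩
  · simp at hu
  · rw [List.concat_eq_append] at hu ⊢
    rw [← sub_comp_pre]
    simp at hu
    cases b
    · exact hn u (by omega)
    · exact hk u (by omega)

/-- A piece can be cut into pieces with the property `T` by cutting pieces with the property `A`
into halves. -/
inductive Cuts (T A : Piece → Prop) : Piece → Prop
  | leaf {f : Piece} : T f → Cuts T A f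
  | node {f : Piece} : A f → Cuts T A (f.sub false) → Cuts T A (f.sub true) → Cuts T A f

theorem forall_sub_comp_pre {A : Piece → Prop} {f : Piece} (h : ∀ u, A (f ∘ pre u)) (b : Bool)
    (u : List Bool) : A (f.sub b ∘ pre u) := by
  rw [sub_comp_pre]
  exact h _

/-- Here `k` counts the levels between `w` and the target length `N`; every cone on these levels is
cut. -/
theorem cuts_pre {N : ℕ} {A : Piece → Prop} : ∀ (k : ℕ) (w : List Bool), w.length + k = N →
    (∀ u, A (pre w ∘ pre u)) → Cuts (IsWordOf N) A (pre w)
  | 0, w, h, _ => .leaf ⟨w, by omega, rfl⟩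
  | k + 1, w, h, hA => .node (hA [])
      (cuts_pre k (false :: w) (by simp; omega) (forall_sub_comp_pre hA false))
      (cuts_pre k (true :: w) (by simp; omega) (forall_sub_comp_pre hA true))

/-- The words of length `n` give pieces of bounded word length. -/
theorem Tame.cuts {f : Piece} (h : Tame f) : ∃ N₀, ∀ N, N₀ ≤ N → ∀ A : Piece → Prop,
    (∀ u, A (f ∘ pre u)) → Cuts (IsWordOf N) A f := by
  obtain ⟨n, h⟩ := h
  induction n generalizing f with
  | zero =>
    obtain ⟨w, hw⟩ := h [] le_rfl
    have hw : f = pre w := hw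
    exact ⟨w.length, fun N hN A hA => by
      subst hw; exact cuts_pre (N - w.length) w (by omega) hA⟩
  | succ n ih =>
    have h' : ∀ b, ∃ N₀, ∀ N, N₀ ≤ N → ∀ A : Piece → Prop, (∀ u, A (f.sub b ∘ pre u)) →
        Cuts (IsWordOf N) A (f.sub b) := fun b => ih fun u hu => by
      rw [sub_comp_pre]; exact h _ (by simp; omega)
    obtain ⟨n1, h1⟩ := h' false
    obtain ⟨n2, h2⟩ := h' true
    exact ⟨n1 + n2, fun N hN A hA => .node (hA [])
      (h1 N (by omega) A (forall_sub_comp_pre hA false))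
      (h2 N (by omega) A (forall_sub_comp_pre hA true))⟩

/-- A tame piece can be cut into words without cutting words. -/
theorem Tame.cuts_isWord {f : Piece} (h : Tame f) : Cuts IsWord (fun f => ¬ IsWord f) f := by
  obtain ⟨n, h⟩ := h
  induction n generalizing f with
  | zero => exact .leaf (h [] le_rfl)
  | succ n ih =>
    by_cases hf : IsWord f
    · exact .leaf hf
    · have h' : ∀ b, Cuts IsWord (fun f => ¬ IsWord f) (f.sub b) := fun b => ih fun u hu => by
        rw [sub_comp_pre]; exact h _ (by simp; omega)
      exact .node hf (h' false) (h' true)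

/-- A family of pieces that maps a disjoint union of Cantor sets bijectively to the Cantor set. -/
def IsPartition {ι : Type} (o : ι → Piece) : Prop :=
  Function.Bijective fun x : ι × Cantor => o x.1 x.2

namespace IsPartition

variable {ι : Type} {o : ι → Piece}

theorem eq_of_apply (h : IsPartition o) {i j : ι} {c d : Cantor} (e : o i c = o j d) :
    i = j ∧ c = d := by
  have := h.1 (a₁ := (i, c)) (a₂ := (j, d)) e
  simpa using this

theorem piece_injective (h : IsPartition o) (i : ι) : Function.Injective (o i) :=
  fun _ _ e => (h.eq_of_apply e).2

theorem injective (h : IsPartition o) : Function.Injective o := fun _ _ e =>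
  (h.eq_of_apply (congrFun e fun _ => true)).1

theorem exists_apply (h : IsPartition o) (c : Cantor) : ∃ i d, o i d = c := by
  obtain ⟨x, hx⟩ := h.2 c
  exact ⟨_, _, hx⟩

end IsPartition

end DiagramProfile

/-! ### Truncations and the complementary lower part of a picture -/

namespace DiagramProfile

theorem Source.map_injective {n : ℕ} {S M S' M' : Type} {f : S → S'} {g : M → M'}
    (hf : Function.Injective f) (hg : Function.Injective g) :
    Function.Injective (Source.map f g : Source n S M → Source n S' M') := by
  intro a b h
  cases a <;> cases b <;> simp_all [Source.map, hf.eq_iff, hg.eq_iff]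

theorem Sink.map_injective {n : ℕ} {S M S' M' : Type} {f : S → S'} {g : M → M'}
    (hf : Function.Injective f) (hg : Function.Injective g) :
    Function.Injective (Sink.map f g : Sink n S M → Sink n S' M') := by
  intro a b h
  cases a <;> cases b <;> simp_all [Sink.map, hf.eq_iff, hg.eq_iff]

theorem Sink.transistor_map {n : ℕ} {S M S' M' : Type} (f : S → S') (g : M → M')
    (p : Sink n S M) : (p.map f g).transistor = p.transistor.map (Sum.map f g) := by
  cases p <;> rfl

namespace Picture

variable {n m k l : ℕ}

/-- The permutation picture of a bijection between the contacts on the top and on the bottom. -/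
def ofEquiv (e : Fin n ≃ Fin m) : Picture n m where
  S := Empty
  M := Empty
  wire :=
    { toFun := fun p => match p with
        | .frame i => .frame (e i)
      invFun := fun q => match q with
        | .frame i => .frame (e.symm i)
      left_inv := fun p => by rcases p with i | ⟨⟨⟩, _⟩ | ⟨⟨⟩⟩; simp
      right_inv := fun q => by rcases q with i | ⟨⟨⟩⟩ | ⟨⟨⟩, _⟩; simp }
  acyclic := fun x => by rcases x with ⟨⟨⟩⟩ | ⟨⟨⟩⟩

theorem ofEquiv_isPermutation (e : Fin n ≃ Fin m) : (ofEquiv e).IsPermutation :=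
  ⟨inferInstanceAs (IsEmpty Empty), inferInstanceAs (IsEmpty Empty)⟩

theorem ofEquiv_isFinite (e : Fin n ≃ Fin m) : (ofEquiv e).IsFinite :=
  ⟨inferInstanceAs (Finite Empty), inferInstanceAs (Finite Empty)⟩

/-- The permutation picture of a permutation. -/
def ofEquivIso (σ : Equiv.Perm (Fin n)) : Iso (ofEquiv σ) (ofPerm σ) :=
  ⟨Equiv.refl _, Equiv.refl _, by rintro (i | ⟨⟨⟩, _⟩ | ⟨⟨⟩⟩); rfl⟩

/-- Isomorphisms compose. -/
def Iso.trans {P Q R : Picture n m} (e : Iso P Q) (f : Iso Q R) : Iso P R where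
  eS := e.eS.trans f.eS
  eM := e.eM.trans f.eM
  wire p := by
    have h1 : ∀ p : Source n P.S P.M,
        p.map (e.eS.trans f.eS) (e.eM.trans f.eM) = (p.map e.eS e.eM).map f.eS f.eM := by
      rintro (_ | _ | _) <;> rfl
    have h2 : ∀ p : Sink m P.S P.M,
        p.map (e.eS.trans f.eS) (e.eM.trans f.eM) = (p.map e.eS e.eM).map f.eS f.eM := by
      rintro (_ | _ | _) <;> rfl
    rw [h1, h2, f.wire, e.wire]

theorem Iso.symm_wire {P Q : Picture n m} (e : Iso P Q) (q : Sink m P.S P.M) :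
    Q.wire.symm (q.map e.eS e.eM) = (P.wire.symm q).map e.eS e.eM := by
  rw [Equiv.symm_apply_eq, e.wire, Equiv.apply_symm_apply]

theorem Iso.isFinite {P Q : Picture n m} (e : Iso P Q) (h : P.IsFinite) : Q.IsFinite := by
  have := h.1
  have := h.2
  exact ⟨Finite.of_equiv _ e.eS, Finite.of_equiv _ e.eM⟩

section Complement

variable {P : Picture n m} {Q : Picture n k} {fS : Q.S → P.S} {fM : Q.M → P.M}

/-- A wire of `P` that is not a wire between transistors of the truncation `Q`. -/
def complementSource (Q : Picture n k) (fS : Q.S → P.S) (fM : Q.M → P.M) :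
    Source k {s // s ∉ Set.range fS} {t // t ∉ Set.range fM} → Source n P.S P.M
  | .frame j => (Q.wire.symm (.frame j)).map fS fM
  | .split s b => .split s.1 b
  | .merge t => .merge t.1

theorem complementSource_injective (hfS : Function.Injective fS) (hfM : Function.Injective fM) :
    Function.Injective (complementSource Q fS fM) := by
  have key : ∀ j (p : Source k {s // s ∉ Set.range fS} {t // t ∉ Set.range fM}),
      complementSource Q fS fM (.frame j) = complementSource Q fS fM p → .frame j = p := by
    rintro j (i | ⟨⟨s, hs⟩, b⟩ | ⟨t, ht⟩) h
    · have := Q.wire.symm.injective (Source.map_injective hfS hfM h)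
      simpa using this
    · simp only [complementSource] at h
      rcases h' : Q.wire.symm (.frame j) with i | ⟨s', b'⟩ | t' <;>
        simp [h', Source.map] at h
      exact absurd ⟨s', h.1⟩ hs
    · simp only [complementSource] at h
      rcases h' : Q.wire.symm (.frame j) with i | ⟨s', b'⟩ | t' <;>
        simp [h', Source.map] at h
      exact absurd ⟨t', h⟩ ht
  rintro p q h
  rcases p with i | ⟨s, b⟩ | t
  · exact key _ _ h
  · rcases q with j | ⟨s', b'⟩ | t'
    · exact (key _ _ h.symm).symm
    · simp only [complementSource, Source.split.injEq] at h
      rw [Subtype.ext h.1, h.2]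
    · simp [complementSource] at h
  · rcases q with j | ⟨s', b'⟩ | t'
    · exact (key _ _ h.symm).symm
    · simp [complementSource] at h
    · simp only [complementSource, Source.merge.injEq] at h
      rw [Subtype.ext h]

/-- By `hS` and `hM`, a wire that ends on a transistor of the upper part comes from a wire of `Q`
that does not reach the bottom of the frame of `Q`. Hence a wire that leaves the upper part, or
starts below it, cannot lead back into it. -/
theorem exists_complementSink (hS : ∀ s, P.wire.symm (.split (fS s)) = (Q.wire.symm (.split s)).map fS fM)
    (hM : ∀ t b, P.wire.symm (.merge (fM t) b) = (Q.wire.symm (.merge t b)).map fS fM)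
    (hfS : Function.Injective fS) (hfM : Function.Injective fM)
    (p : Source k {s // s ∉ Set.range fS} {t // t ∉ Set.range fM}) :
    ∃ q : Sink m {s // s ∉ Set.range fS} {t // t ∉ Set.range fM},
      P.wire (complementSource Q fS fM p) = q.map Subtype.val Subtype.val := by
  have key : ∀ q : Source n Q.S Q.M, complementSource Q fS fM p = q.map fS fM →
      ∃ j, Q.wire q = .frame j := by
    intro q hq
    rcases p with i | ⟨⟨s, hs⟩, b⟩ | ⟨t, ht⟩
    · exact ⟨i, by rw [← Source.map_injective hfS hfM hq, Equiv.apply_symm_apply]⟩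
    · rcases q with j | ⟨s', b'⟩ | t' <;> simp [complementSource, Source.map] at hq
      exact absurd ⟨s', hq.1.symm⟩ hs
    · rcases q with j | ⟨s', b'⟩ | t' <;> simp [complementSource, Source.map] at hq
      exact absurd ⟨t', hq.symm⟩ ht
  rcases h : P.wire (complementSource Q fS fM p) with j | s | ⟨t, b⟩
  · exact ⟨.frame j, rfl⟩
  · refine ⟨.split ⟨s, ?_⟩, rfl⟩
    rintro ⟨s', rfl⟩
    rw [← Equiv.eq_symm_apply, hS] at h
    obtain ⟨j, hj⟩ := key _ h
    simp at hj
  · refine ⟨.merge ⟨t, ?_⟩ b, rfl⟩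
    rintro ⟨t', rfl⟩
    rw [← Equiv.eq_symm_apply, hM] at h
    obtain ⟨j, hj⟩ := key _ h
    simp at hj

/-- A wire that ends outside the upper part either starts outside it or extends a wire of `Q`. In
the second case the wire of `Q` must reach the bottom of its frame, since otherwise it would end in
the upper part. -/
theorem exists_complementSource
    (hS : ∀ s, P.wire.symm (.split (fS s)) = (Q.wire.symm (.split s)).map fS fM)
    (hM : ∀ t b, P.wire.symm (.merge (fM t) b) = (Q.wire.symm (.merge t b)).map fS fM)
    (q : Sink m {s // s ∉ Set.range fS} {t // t ∉ Set.range fM}) :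
    ∃ p : Source k {s // s ∉ Set.range fS} {t // t ∉ Set.range fM},
      P.wire (complementSource Q fS fM p) = q.map Subtype.val Subtype.val := by
  have key : ∀ r : Source n Q.S Q.M, P.wire (r.map fS fM) = q.map Subtype.val Subtype.val →
      ∃ p : Source k {s // s ∉ Set.range fS} {t // t ∉ Set.range fM},
        P.wire (complementSource Q fS fM p) = q.map Subtype.val Subtype.val := by
    intro r hr
    rcases h : Q.wire r with j | s | ⟨t, b⟩ <;> rw [← Equiv.eq_symm_apply] at h <;> subst h
    · exact ⟨.frame j, hr⟩
    · rw [← hS, Equiv.apply_symm_apply] at hr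
      rcases q with j | ⟨s', hs'⟩ | ⟨t', b'⟩ <;> simp [Sink.map] at hr
      exact absurd ⟨s, hr⟩ hs'
    · rw [← hM, Equiv.apply_symm_apply] at hr
      rcases q with j | s' | ⟨⟨t', ht'⟩, b'⟩ <;> simp [Sink.map] at hr
      exact absurd ⟨t, hr.1⟩ ht'
  obtain ⟨p, hq⟩ := P.wire.surjective (q.map Subtype.val Subtype.val)
  rcases p with i | ⟨s, b⟩ | t
  · exact key (.frame i) hq
  · by_cases hs : s ∈ Set.range fS
    · obtain ⟨s, rfl⟩ := hs
      exact key (.split s b) hq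
    · exact ⟨.split ⟨s, hs⟩ b, hq⟩
  · by_cases ht : t ∈ Set.range fM
    · obtain ⟨t, rfl⟩ := ht
      exact key (.merge t) hq
    · exact ⟨.merge ⟨t, ht⟩, hq⟩

variable (hS : ∀ s, P.wire.symm (.split (fS s)) = (Q.wire.symm (.split s)).map fS fM)
  (hM : ∀ t b, P.wire.symm (.merge (fM t) b) = (Q.wire.symm (.merge t b)).map fS fM)
  (hfS : Function.Injective fS) (hfM : Function.Injective fM)

/-- The wires of the lower part of a picture `P` with upper part `Q`. -/
noncomputable def complementWire : Source k {s // s ∉ Set.range fS} {t // t ∉ Set.range fM} ≃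
    Sink m {s // s ∉ Set.range fS} {t // t ∉ Set.range fM} :=
  Equiv.ofBijective (fun p => (exists_complementSink hS hM hfS hfM p).choose) <| by
    have h := fun p => (exists_complementSink hS hM hfS hfM p).choose_spec
    refine ⟨fun p p' e => ?_, fun q => ?_⟩
    · dsimp only at e
      exact complementSource_injective hfS hfM (P.wire.injective
        ((h p).trans ((congrArg _ e).trans (h p').symm)))
    · obtain ⟨p, hp⟩ := exists_complementSource hS hM q
      exact ⟨p, Sink.map_injective Subtype.val_injective Subtype.val_injective
        ((h p).symm.trans hp)⟩

theorem complementWire_spec (p) : P.wire (complementSource Q fS fM p) =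
    (complementWire hS hM hfS hfM p).map Subtype.val Subtype.val :=
  (exists_complementSink hS hM hfS hfM p).choose_spec

/-- The lower part of a picture `P` with upper part `Q`. -/
noncomputable def complement : Picture k m where
  S := {s // s ∉ Set.range fS}
  M := {t // t ∉ Set.range fM}
  wire := complementWire hS hM hfS hfM
  acyclic x hx := by
    refine P.acyclic (Sum.map Subtype.val Subtype.val x) ?_
    refine Relation.TransGen.lift (Sum.map Subtype.val Subtype.val) ?_ x x hx
    rintro a b ⟨p, hp, hq⟩
    refine ⟨complementSource Q fS fM p, ?_, ?_⟩
    · rcases p with j | ⟨s, c⟩ | t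
      · simp [Source.transistor] at hp
      · simp only [Source.transistor, Option.some.injEq] at hp
        subst hp; rfl
      · simp only [Source.transistor, Option.some.injEq] at hp
        subst hp; rfl
    · rw [complementWire_spec hS hM hfS hfM, Sink.transistor_map, hq]
      rfl

open Classical in
/-- A picture is the concatenation of its upper and its lower part. -/
noncomputable def complementIso : Iso (Q.concat (complement hS hM hfS hfM)) P where
  eS := (Equiv.sumCongr (Equiv.ofInjective fS hfS) (Equiv.refl _)).trans
    (Equiv.Set.sumCompl (Set.range fS))
  eM := (Equiv.sumCongr (Equiv.ofInjective fM hfM) (Equiv.refl _)).trans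
    (Equiv.Set.sumCompl (Set.range fM))
  wire p := by
    have hl : ∀ p : Source n Q.S Q.M, (p.map Sum.inl Sum.inl :
        Source n (Q.S ⊕ {s // s ∉ Set.range fS}) (Q.M ⊕ {t // t ∉ Set.range fM})).map
          ((Equiv.sumCongr (Equiv.ofInjective fS hfS) (Equiv.refl _)).trans
            (Equiv.Set.sumCompl (Set.range fS)))
          ((Equiv.sumCongr (Equiv.ofInjective fM hfM) (Equiv.refl _)).trans
            (Equiv.Set.sumCompl (Set.range fM))) = p.map fS fM := by
      rintro (_ | _ | _) <;> rfl
    have hr : ∀ q : Sink m {s // s ∉ Set.range fS} {t // t ∉ Set.range fM},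
        (q.map Sum.inr Sum.inr :
        Sink m (Q.S ⊕ {s // s ∉ Set.range fS}) (Q.M ⊕ {t // t ∉ Set.range fM})).map
          ((Equiv.sumCongr (Equiv.ofInjective fS hfS) (Equiv.refl _)).trans
            (Equiv.Set.sumCompl (Set.range fS)))
          ((Equiv.sumCongr (Equiv.ofInjective fM hfM) (Equiv.refl _)).trans
            (Equiv.Set.sumCompl (Set.range fM))) = q.map Subtype.val Subtype.val := by
      rintro (_ | _ | _) <;> rfl
    have hu : ∀ p : Source k {s // s ∉ Set.range fS} {t // t ∉ Set.range fM},
        (concatUp Q (complement hS hM hfS hfM) p).map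
          ((Equiv.sumCongr (Equiv.ofInjective fS hfS) (Equiv.refl _)).trans
            (Equiv.Set.sumCompl (Set.range fS)))
          ((Equiv.sumCongr (Equiv.ofInjective fM hfM) (Equiv.refl _)).trans
            (Equiv.Set.sumCompl (Set.range fM))) = complementSource Q fS fM p := by
      rintro (_ | _ | _)
      · exact hl _
      · rfl
      · rfl
    rcases concat_inl_or Q (complement hS hM hfS hfM) p with ⟨p, rfl⟩ | ⟨p, rfl⟩
    · refine (congrArg P.wire (hl p)).trans (Eq.trans ?_ (congrArg (Sink.map _ _)
        (concatFun_inl Q (complement hS hM hfS hfM) p)).symm)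
      rcases h : Q.wire p with j | s | ⟨t, b⟩ <;> rw [← Equiv.eq_symm_apply] at h <;> subst h
      · exact (complementWire_spec hS hM hfS hfM (.frame j)).trans (hr _).symm
      · rw [← hS, Equiv.apply_symm_apply]; rfl
      · rw [← hM, Equiv.apply_symm_apply]; rfl
    · refine (congrArg P.wire (hu p)).trans (Eq.trans ?_ (congrArg (Sink.map _ _)
        (concatFun_up Q (complement hS hM hfS hfM) p)).symm)
      exact (complementWire_spec hS hM hfS hfM p).trans (hr _).symm

/-- A truncation is recognised by looking upwards only: it is enough that wires ending on
transistors of `Q` have the same upper ends in `P`. The remaining transistors then form the lower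
part automatically. -/
theorem isTruncation_range
    (hS : ∀ s, P.wire.symm (.split (fS s)) = (Q.wire.symm (.split s)).map fS fM)
    (hM : ∀ t b, P.wire.symm (.merge (fM t) b) = (Q.wire.symm (.merge t b)).map fS fM)
    (hfS : Function.Injective fS) (hfM : Function.Injective fM) :
    P.IsTruncation (Set.range (Sum.map fS fM)) Q :=
  ⟨complement hS hM hfS hfM, complementIso hS hM hfS hfM, rfl⟩

end Complement

theorem IsPermutation.exists_ofEquiv {P : Picture n m} (h : P.IsPermutation) :
    ∃ e : Fin n ≃ Fin m, Nonempty (Iso P (ofEquiv e)) := by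
  have := h.1
  have := h.2
  have h1 : ∀ i, ∃ j, P.wire (.frame i) = .frame j := by
    intro i
    rcases P.wire (.frame i) with j | s | ⟨t, b⟩
    · exact ⟨j, rfl⟩
    · exact h.1.elim s
    · exact h.2.elim t
  have h2 : ∀ j, ∃ i, P.wire.symm (.frame j) = .frame i := by
    intro j
    rcases P.wire.symm (.frame j) with j | ⟨s, b⟩ | t
    · exact ⟨j, rfl⟩
    · exact h.1.elim s
    · exact h.2.elim t
  choose f hf using h1
  choose g hg using h2
  refine ⟨⟨f, g, fun i => ?_, fun j => ?_⟩, 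
    ⟨⟨Equiv.equivOfIsEmpty P.S Empty, Equiv.equivOfIsEmpty P.M Empty, ?_⟩⟩⟩
  · have := hg (f i)
    rw [← hf, Equiv.symm_apply_apply] at this
    simpa using this.symm
  · have := hf (g j)
    rw [← hg, Equiv.apply_symm_apply] at this
    simpa using this.symm
  · rintro (i | ⟨s, b⟩ | t)
    · rw [hf]; rfl
    · exact h.1.elim s
    · exact h.2.elim t

/-- A picture is determined up to a permutation of the contacts on the bottom of the frame by the
wires that end on transistors. -/
theorem exists_iso_concat_ofEquiv {P : Picture n m} {Q : Picture n k} (eS : Q.S ≃ P.S)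
    (eM : Q.M ≃ P.M)
    (hS : ∀ s, P.wire.symm (.split (eS s)) = (Q.wire.symm (.split s)).map eS eM)
    (hM : ∀ t b, P.wire.symm (.merge (eM t) b) = (Q.wire.symm (.merge t b)).map eS eM) :
    ∃ e : Fin k ≃ Fin m, Nonempty (Iso (Q.concat (ofEquiv e)) P) := by
  have hp : (complement hS hM eS.injective eM.injective).IsPermutation :=
    ⟨⟨fun s => s.2 (eS.surjective _)⟩, ⟨fun s => s.2 (eM.surjective _)⟩⟩
  obtain ⟨e, ⟨f⟩⟩ := hp.exists_ofEquiv
  exact ⟨e, ⟨((Iso.refl Q).concat f.symm).trans (complementIso hS hM _ _)⟩⟩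

end Picture
end DiagramProfile

/-! ### Splitting off maximal transistors, and induction over finite pictures -/

namespace DiagramProfile

theorem exists_equiv_zero {n : ℕ} (i : Fin n) :
    ∃ (r : ℕ) (α : Fin n ≃ Fin (r + 1)), α.symm 0 = i := by
  rcases n with _ | r
  · exact i.elim0
  · exact ⟨r, Equiv.swap 0 i, by simp⟩

theorem exists_equiv_zero_one {n : ℕ} {i j : Fin n} (h : i ≠ j) :
    ∃ (r : ℕ) (α : Fin n ≃ Fin (r + 2)), α.symm 0 = i ∧ α.symm 1 = j := by
  rcases n with _ | _ | r
  · exact i.elim0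
  · exact absurd (Subsingleton.elim (α := Fin 1) i j) h
  · have hx : Equiv.swap 0 i j ≠ 0 := by
      intro hx
      have := congrArg (Equiv.swap 0 i) hx
      simp at this
      exact h this.symm
    -- The product inside `.symm` sends `0` to `i`, because its right factor fixes `0`, and `1` to
    -- `swap 0 i j` and from there back to `j`.
    refine ⟨r, (Equiv.swap 0 i * Equiv.swap 1 (Equiv.swap 0 i j)).symm, ?_, ?_⟩
    · simp only [Equiv.symm_symm, Equiv.Perm.mul_apply]
      rw [Equiv.swap_apply_of_ne_of_ne (by simp) hx.symm]
      simp
    · simp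

namespace Picture

variable {n m k l : ℕ}

theorem mergeFirst_symm_merge (r : ℕ) (b : Bool) :
    (mergeFirst r).wire.symm (.merge () b) = .frame (if b then 1 else 0) := by
  cases b <;> rfl

theorem concat_ofEquiv_symm (P : Picture n m) (e : Fin m ≃ Fin k) (j : Fin k) :
    (P.concat (ofEquiv e)).wire.symm (.frame j) =
      (P.wire.symm (.frame (e.symm j))).map Sum.inl Sum.inl := rfl

/-- A picture with one transistor, of type `(x, x²)`. -/
theorem exists_iso_split {R : Picture n m} (s : R.S) (hs : ∀ s', s' = s) (hM : IsEmpty R.M)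
    {r : ℕ} (α : Fin n ≃ Fin (r + 1)) (h : R.wire.symm (.split s) = .frame (α.symm 0)) :
    ∃ σ : Fin (r + 2) ≃ Fin m,
      Nonempty (Iso (((ofEquiv α).concat (splitFirst r)).concat (ofEquiv σ)) R) := by
  let eS : Empty ⊕ Unit ≃ R.S := ⟨fun _ => s, fun _ => .inr (), fun x => by
    rcases x with ⟨⟨⟩⟩ | ⟨⟩; rfl, fun x => (hs x).symm⟩
  let eM : Empty ⊕ Empty ≃ R.M := Equiv.equivOfIsEmpty _ _
  refine exists_iso_concat_ofEquiv (Q := (ofEquiv α).concat (splitFirst r)) eS eM ?_ ?_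
  · rintro (⟨⟨⟩⟩ | ⟨⟩)
    exact h
  · rintro (⟨⟨⟩⟩ | ⟨⟨⟩⟩)

/-- A picture with one transistor, of type `(x², x)`. -/
theorem exists_iso_merge {R : Picture n m} (t : R.M) (ht : ∀ t', t' = t) (hS : IsEmpty R.S)
    {r : ℕ} (α : Fin n ≃ Fin (r + 2)) (h0 : R.wire.symm (.merge t false) = .frame (α.symm 0))
    (h1 : R.wire.symm (.merge t true) = .frame (α.symm 1)) :
    ∃ σ : Fin (r + 1) ≃ Fin m,
      Nonempty (Iso (((ofEquiv α).concat (mergeFirst r)).concat (ofEquiv σ)) R) := by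
  let eM : Empty ⊕ Unit ≃ R.M := ⟨fun _ => t, fun _ => .inr (), fun x => by
    rcases x with ⟨⟨⟩⟩ | ⟨⟩; rfl, fun x => (ht x).symm⟩
  let eS : Empty ⊕ Empty ≃ R.S := Equiv.equivOfIsEmpty _ _
  refine exists_iso_concat_ofEquiv (Q := (ofEquiv α).concat (mergeFirst r)) eS eM ?_ ?_
  · rintro (⟨⟨⟩⟩ | ⟨⟨⟩⟩)
  · rintro (⟨⟨⟩⟩ | ⟨⟩) b
    cases b
    · exact h0
    · exact h1

/-- Close a cut picture by leading the loose wires to the bottom of the frame. -/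
noncomputable def ofCut {S M : Type} (c : Cut n S M) {k : ℕ}
    (e : {p : Source n S M // ∀ q, c.g q ≠ p} ≃ Fin k) : Picture n k :=
  let f : Sink k S M → Source n S M := fun q => match q with
    | .frame j => (e.symm j).1
    | .split s => c.g (.split s)
    | .merge t b => c.g (.merge t b)
  have hf : Function.Bijective f := by
    constructor
    · rintro (j | s | ⟨t, b⟩) (j' | s' | ⟨t', b'⟩) h <;> dsimp only [f] at h
      · rw [e.symm.injective (Subtype.ext h)]
      · exact absurd h.symm ((e.symm j).2 _)
      · exact absurd h.symm ((e.symm j).2 _)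
      · exact absurd h ((e.symm j').2 _)
      · have := c.inj h
        simp_all
      · have := c.inj h
        simp_all
      · exact absurd h ((e.symm j').2 _)
      · have := c.inj h
        simp_all
      · have := c.inj h
        simp_all
    · intro p
      by_cases hp : ∃ q, c.g q = p
      · obtain ⟨q, rfl⟩ := hp
        rcases q with j | s | ⟨t, b⟩
        · exact j.elim0
        · exact ⟨.split s, rfl⟩
        · exact ⟨.merge t b, rfl⟩
      · push Not at hp
        exact ⟨.frame (e ⟨p, hp⟩), by simp [f]⟩
  { S := S
    M := M
    wire := (Equiv.ofBijective f hf).symm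
    acyclic := by
      intro x hx
      refine c.acyclic x (Relation.TransGen.mono ?_ x x hx)
      rintro a b ⟨p, hp, hq⟩
      obtain ⟨q, rfl⟩ := (Equiv.ofBijective f hf).surjective p
      rw [Equiv.symm_apply_apply] at hq
      rcases q with j | s | ⟨t, d⟩
      · simp [Sink.transistor] at hq
      · exact ⟨.split s, hp, hq⟩
      · exact ⟨.merge t d, hp, hq⟩ }

theorem finite_source {S M : Type} [Finite S] [Finite M] : Finite (Source n S M) := by
  refine Finite.of_surjective (α := Fin n ⊕ (S × Bool) ⊕ M) (fun x => match x with
    | .inl i => .frame i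
    | .inr (.inl x) => .split x.1 x.2
    | .inr (.inr t) => .merge t) ?_
  rintro (i | ⟨s, b⟩ | t)
  · exact ⟨.inl i, rfl⟩
  · exact ⟨.inr (.inl (s, b)), rfl⟩
  · exact ⟨.inr (.inr t), rfl⟩

theorem card_lt_of_injective {α β : Type} [Finite β] {f : α → β} (hf : Function.Injective f)
    {b : β} (hb : b ∉ Set.range f) : Nat.card α < Nat.card β := by
  have := Finite.of_injective f hf
  have := Fintype.ofFinite α
  have := Fintype.ofFinite β
  rw [Nat.card_eq_fintype_card, Nat.card_eq_fintype_card]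
  exact Fintype.card_lt_of_injective_of_notMem f hf hb

theorem wellFounded_lt {P : Picture n m} (h : P.IsFinite) : WellFounded P.Lt := by
  have := h.1
  have := h.2
  have : IsTrans _ P.Lt := ⟨fun _ _ _ h h' => Relation.TransGen.trans h h'⟩
  have : Std.Irrefl P.Lt := ⟨fun x h => P.acyclic x h⟩
  exact Finite.wellFounded_of_trans_of_irrefl _

theorem wellFounded_gt {P : Picture n m} (h : P.IsFinite) :
    WellFounded fun x y => P.Lt y x := by
  have := h.1
  have := h.2
  have : IsTrans P.Transistor fun x y => P.Lt y x :=
    ⟨fun _ _ _ h h' => Relation.TransGen.trans h' h⟩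
  have : Std.Irrefl fun x y => P.Lt y x := ⟨fun x h => P.acyclic x h⟩
  exact Finite.wellFounded_of_trans_of_irrefl _

theorem IsMaximal.source_ne {P : Picture n m} {x : P.Transistor} (hx : P.IsMaximal x)
    {q : Sink m P.S P.M} {y : P.Transistor} (hq : q.transistor = some y) :
    (P.wire.symm q).transistor ≠ some x :=
  fun h => hx y (.single ⟨_, h, by rw [Equiv.apply_symm_apply]; exact hq⟩)

/-- Associativity for four factors. -/
def assoc₄ {a b c d e : ℕ} (A : Picture a b) (B : Picture b c) (C : Picture c d) (D : Picture d e) :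
    Iso (((A.concat B).concat C).concat D) (A.concat ((B.concat C).concat D)) :=
  ((Iso.assoc A B C).concat (Iso.refl D)).trans (Iso.assoc A (B.concat C) D)

/-- A maximal `(x, x²)`-transistor of a finite picture can be split off. -/
theorem exists_peel_split {P : Picture n m} (hP : P.IsFinite) (s : P.S)
    (hs : P.IsMaximal (.inl s)) :
    ∃ (r : ℕ) (Q : Picture n (r + 1)) (σ : Fin (r + 2) ≃ Fin m), Q.IsFinite ∧
      Nat.card Q.Transistor < Nat.card P.Transistor ∧
      Nonempty (Iso ((Q.concat (splitFirst r)).concat (ofEquiv σ)) P) := by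
  have := hP.1
  have := hP.2
  -- As `s` is maximal, no wire leads from `s` to another transistor, so the remaining transistors
  -- still form a cut picture.
  obtain ⟨c, hc⟩ := P.toCut.exists_restrict (S' := {a // a ≠ s}) Subtype.val id
    Subtype.val_injective Function.injective_id (by
      intro q
      have hm : (P.toCut.g (q.map Subtype.val id)).transistor ≠ some (.inl s) := by
        rcases q with i | a | ⟨t, b⟩
        · exact i.elim0
        · exact hs.source_ne (q := .split a.1) (y := .inl a.1) rfl
        · exact hs.source_ne (q := .merge t b) (y := .inr t) rfl
      rcases hq : P.toCut.g (q.map Subtype.val id) with i | ⟨a, b⟩ | t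
      · exact ⟨.frame i, rfl⟩
      · rw [hq] at hm
        exact ⟨.split ⟨a, fun h => hm (by rw [h]; rfl)⟩ b, rfl⟩
      · exact ⟨.merge t, rfl⟩)
  have : Finite (Source n {a // a ≠ s} P.M) := finite_source
  -- The loose wires are led to the bottom of the frame in an arbitrary order; the bijections `α`
  -- and `σ` below make up for this choice.
  let e := Finite.equivFin {p : Source n {a // a ≠ s} P.M // ∀ q, c.g q ≠ p}
  have hS : ∀ a, P.wire.symm (.split (Subtype.val a)) =
      ((ofCut c e).wire.symm (.split a)).map Subtype.val id := fun a => hc (.split a)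
  have hM : ∀ t b, P.wire.symm (.merge (id t) b) =
      ((ofCut c e).wire.symm (.merge t b)).map Subtype.val id := fun t b => hc (.merge t b)
  have hv : Function.Injective (fun a : {a // a ≠ s} => a.1) := Subtype.val_injective
  have hi : Function.Injective (id : P.M → P.M) := Function.injective_id
  have f := complementIso (P := P) (Q := ofCut c e) (fS := Subtype.val) (fM := id) hS hM hv hi
  set R := complement (P := P) (Q := ofCut c e) (fS := Subtype.val) (fM := id) hS hM hv hi with hR
  obtain ⟨s0, hs0⟩ : ∃ s0 : R.S, s0 = ⟨s, fun ⟨a, ha⟩ => a.2 ha⟩ := ⟨_, rfl⟩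
  have hu : ∀ s' : R.S, s' = s0 := by
    rintro ⟨a, ha⟩
    rw [hs0]
    refine Subtype.ext ?_
    by_contra hn
    exact ha ⟨⟨a, hn⟩, rfl⟩
  have hE : IsEmpty R.M := ⟨fun t => t.2 ⟨t.1, rfl⟩⟩
  -- `R` has no transistor other than `s0`, so a wire from a transistor to `s0` would close a cycle.
  have hj : ∃ j, R.wire.symm (.split s0) = .frame j := by
    rcases h : R.wire.symm (.split s0) with j | ⟨a, b⟩ | t
    · exact ⟨j, rfl⟩
    · refine absurd (.single ⟨.split a b, rfl, ?_⟩) (R.acyclic (.inl a))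
      rw [← h, Equiv.apply_symm_apply, hu a]; rfl
    · exact hE.elim t
  obtain ⟨j, hj⟩ := hj
  obtain ⟨r, α, hα⟩ := exists_equiv_zero j
  obtain ⟨σ, ⟨g⟩⟩ := exists_iso_split s0 hu hE α (by rw [hj, hα])
  have hfin : (ofCut c e).IsFinite := ⟨inferInstanceAs (Finite {a // a ≠ s}), hP.2⟩
  refine ⟨r, (ofCut c e).concat (ofEquiv α), σ, hfin.concat (ofEquiv_isFinite _), ?_,
    ⟨(assoc₄ _ _ _ _).trans (((Iso.refl _).concat g).trans f)⟩⟩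
  have h1 : Nat.card (((ofCut c e).concat (ofEquiv α)).Transistor) =
      Nat.card ({a // a ≠ s} ⊕ P.M) :=
    Nat.card_congr (Equiv.sumCongr (Equiv.sumEmpty _ Empty) (Equiv.sumEmpty _ Empty))
  rw [h1]
  have h2 : Function.Injective (Sum.map Subtype.val id : {a // a ≠ s} ⊕ P.M → P.S ⊕ P.M) :=
    Sum.map_injective.2 ⟨Subtype.val_injective, Function.injective_id⟩
  refine card_lt_of_injective h2 (b := .inl s) ?_
  rintro ⟨(⟨a, ha⟩ | t), h⟩
  · exact ha (Sum.inl_injective h)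
  · simp at h

/-- A maximal `(x², x)`-transistor of a finite picture can be split off. -/
theorem exists_peel_merge {P : Picture n m} (hP : P.IsFinite) (t : P.M)
    (ht : P.IsMaximal (.inr t)) :
    ∃ (r : ℕ) (Q : Picture n (r + 2)) (σ : Fin (r + 1) ≃ Fin m), Q.IsFinite ∧
      Nat.card Q.Transistor < Nat.card P.Transistor ∧
      Nonempty (Iso ((Q.concat (mergeFirst r)).concat (ofEquiv σ)) P) := by
  have := hP.1
  have := hP.2
  obtain ⟨c, hc⟩ := P.toCut.exists_restrict (M' := {a // a ≠ t}) id Subtype.val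
    Function.injective_id Subtype.val_injective (by
      intro q
      have hm : (P.toCut.g (q.map id Subtype.val)).transistor ≠ some (.inr t) := by
        rcases q with i | a | ⟨a, b⟩
        · exact i.elim0
        · exact ht.source_ne (q := .split a) (y := .inl a) rfl
        · exact ht.source_ne (q := .merge a.1 b) (y := .inr a.1) rfl
      rcases hq : P.toCut.g (q.map id Subtype.val) with i | ⟨a, b⟩ | a
      · exact ⟨.frame i, rfl⟩
      · exact ⟨.split a b, rfl⟩
      · rw [hq] at hm
        exact ⟨.merge ⟨a, fun h => hm (by rw [h]; rfl)⟩, rfl⟩)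
  have : Finite (Source n P.S {a // a ≠ t}) := finite_source
  let e := Finite.equivFin {p : Source n P.S {a // a ≠ t} // ∀ q, c.g q ≠ p}
  have hS : ∀ a, P.wire.symm (.split (id a)) =
      ((ofCut c e).wire.symm (.split a)).map id Subtype.val := fun a => hc (.split a)
  have hM : ∀ a b, P.wire.symm (.merge (Subtype.val a) b) =
      ((ofCut c e).wire.symm (.merge a b)).map id Subtype.val := fun t b => hc (.merge t b)
  have hv : Function.Injective (fun a : {a // a ≠ t} => a.1) := Subtype.val_injective
  have hi : Function.Injective (id : P.S → P.S) := Function.injective_id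
  have f := complementIso (P := P) (Q := ofCut c e) (fS := id) (fM := Subtype.val) hS hM hi hv
  set R := complement (P := P) (Q := ofCut c e) (fS := id) (fM := Subtype.val) hS hM hi hv with hR
  obtain ⟨t0, ht0⟩ : ∃ t0 : R.M, t0 = ⟨t, fun ⟨a, ha⟩ => a.2 ha⟩ := ⟨_, rfl⟩
  have hu : ∀ t' : R.M, t' = t0 := by
    rintro ⟨a, ha⟩
    rw [ht0]
    refine Subtype.ext ?_
    by_contra hn
    exact ha ⟨⟨a, hn⟩, rfl⟩
  have hE : IsEmpty R.S := ⟨fun t => t.2 ⟨t.1, rfl⟩⟩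
  have hj : ∀ b, ∃ j, R.wire.symm (.merge t0 b) = .frame j := by
    intro b
    rcases h : R.wire.symm (.merge t0 b) with j | ⟨a, b⟩ | a
    · exact ⟨j, rfl⟩
    · exact hE.elim a
    · refine absurd (.single ⟨.merge a, rfl, ?_⟩) (R.acyclic (.inr a))
      rw [← h, Equiv.apply_symm_apply, hu a]; rfl
  choose j hj using hj
  have hne : j false ≠ j true := by
    intro h
    have := (hj false).trans ((congrArg Source.frame h).trans (hj true).symm)
    simpa using R.wire.symm.injective this
  obtain ⟨r, α, hα, hα'⟩ := exists_equiv_zero_one hne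
  obtain ⟨σ, ⟨g⟩⟩ := exists_iso_merge t0 hu hE α (by rw [hj, hα]) (by rw [hj, hα'])
  have hfin : (ofCut c e).IsFinite := ⟨hP.1, inferInstanceAs (Finite {a // a ≠ t})⟩
  refine ⟨r, (ofCut c e).concat (ofEquiv α), σ, hfin.concat (ofEquiv_isFinite _), ?_,
    ⟨(assoc₄ _ _ _ _).trans (((Iso.refl _).concat g).trans f)⟩⟩
  have h1 : Nat.card (((ofCut c e).concat (ofEquiv α)).Transistor) =
      Nat.card (P.S ⊕ {a // a ≠ t}) :=
    Nat.card_congr (Equiv.sumCongr (Equiv.sumEmpty _ Empty) (Equiv.sumEmpty _ Empty))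
  rw [h1]
  have h2 : Function.Injective (Sum.map id Subtype.val : P.S ⊕ {a // a ≠ t} → P.S ⊕ P.M) :=
    Sum.map_injective.2 ⟨Function.injective_id, Subtype.val_injective⟩
  refine card_lt_of_injective h2 (b := .inr t) ?_
  rintro ⟨(a | ⟨a, ha⟩), h⟩
  · simp at h
  · exact ha (Sum.inr_injective h)

/-- Finite pictures are generated by permutation pictures and single transistors. -/
theorem IsFinite.induction {Φ : ∀ m, Picture n m → Prop}
    (iso : ∀ m (P Q : Picture n m), Nonempty (Iso P Q) → Φ m P → Φ m Q)
    (one : Φ n (ofPerm 1))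
    (perm : ∀ m m' (P : Picture n m) (e : Fin m ≃ Fin m'), P.IsFinite → Φ m P →
      Φ m' (P.concat (ofEquiv e)))
    (split : ∀ r (P : Picture n (r + 1)), P.IsFinite → Φ _ P → Φ _ (P.concat (splitFirst r)))
    (merge : ∀ r (P : Picture n (r + 2)), P.IsFinite → Φ _ P → Φ _ (P.concat (mergeFirst r)))
    {m : ℕ} (P : Picture n m) (hP : P.IsFinite) : Φ m P := by
  induction h : Nat.card P.Transistor using Nat.strong_induction_on generalizing m with
  | _ N ih =>
    subst h
    have := hP.1
    have := hP.2
    by_cases hT : Nonempty P.Transistor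
    · obtain ⟨x, -, hx⟩ := (wellFounded_gt hP).has_min Set.univ Set.univ_nonempty
      have hx : P.IsMaximal x := fun y hy => hx y trivial hy
      rcases x with s | t
      · obtain ⟨r, Q, σ, hQ, hc, e⟩ := exists_peel_split hP s hx
        exact iso _ _ _ e (perm _ _ _ _ (hQ.concat (IsAnnular.split r).isFinite)
          (split _ _ hQ (ih _ hc Q hQ rfl)))
      · obtain ⟨r, Q, σ, hQ, hc, e⟩ := exists_peel_merge hP t hx
        exact iso _ _ _ e (perm _ _ _ _ (hQ.concat (IsAnnular.merge r).isFinite)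
          (merge _ _ hQ (ih _ hc Q hQ rfl)))
    · have hp : P.IsPermutation :=
        ⟨⟨fun s => hT ⟨.inl s⟩⟩, ⟨fun s => hT ⟨.inr s⟩⟩⟩
      obtain ⟨e, ⟨f⟩⟩ := hp.exists_ofEquiv
      exact iso _ _ _ ⟨(Iso.oneConcat _).trans f.symm⟩ (perm _ _ _ e isFinite_one one)

end Picture
end DiagramProfile

/-! ### Labellings of wires by self-maps of the Cantor set -/

namespace DiagramProfile
namespace Picture

variable {n m k l : ℕ}

/-- The wires of a picture are labelled by self-maps of the Cantor set, starting from the labels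
`a` at the top of the frame, such that an `(x, x²)`-transistor cuts a map into its two halves
and an `(x², x)`-transistor joins two maps to one. -/
structure IsLabelling (P : Picture n m) (a : Fin n → Piece) (φ : Source n P.S P.M → Piece) :
    Prop where
  frame : ∀ i, φ (.frame i) = a i
  split : ∀ s b, φ (.split s b) = (φ (P.wire.symm (.split s))).sub b
  merge : ∀ t b, (φ (.merge t)).sub b = φ (P.wire.symm (.merge t b))

/-- A picture with labels `a` at the top of the frame has labels `o` at the bottom. -/
def Yields (P : Picture n m) (a : Fin n → Piece) (o : Fin m → Piece) : Prop :=
  ∃ φ, P.IsLabelling a φ ∧ ∀ j, φ (P.wire.symm (.frame j)) = o j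

/-- Labels are forced from the top downwards, by induction along the order of the transistors. Below
an (x², x)-transistor both halves of the label are known, and they determine it. -/
theorem IsLabelling.unique {P : Picture n m} (hP : P.IsFinite) {a : Fin n → Piece}
    {φ ψ : Source n P.S P.M → Piece} (hφ : P.IsLabelling a φ) (hψ : P.IsLabelling a ψ) : φ = ψ := by
  have key : ∀ (x : P.Transistor) p, p.transistor = some x → φ p = ψ p := by
    intro x
    induction x using (wellFounded_lt hP).induction with
    | _ x ih =>
      have step : ∀ q : Sink m P.S P.M, q.transistor = some x →
          φ (P.wire.symm q) = ψ (P.wire.symm q) := by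
        intro q hq
        rcases h : P.wire.symm q with i | ⟨s, b⟩ | t
        · rw [hφ.frame, hψ.frame]
        · exact ih (.inl s) (.single ⟨.split s b, rfl, by rw [← h, Equiv.apply_symm_apply]; exact hq⟩) _ rfl
        · exact ih (.inr t) (.single ⟨.merge t, rfl, by rw [← h, Equiv.apply_symm_apply]; exact hq⟩) _ rfl
      rintro (i | ⟨s, b⟩ | t) hp
      · simp [Source.transistor] at hp
      · rw [hφ.split, hψ.split, step (.split s) hp]
      · exact Piece.ext_sub fun b => by rw [hφ.merge, hψ.merge, step (.merge t b) hp]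
  funext p
  rcases p with i | ⟨s, b⟩ | t
  · rw [hφ.frame, hψ.frame]
  · exact key (.inl s) _ rfl
  · exact key (.inr t) _ rfl

theorem Yields.unique {P : Picture n m} (hP : P.IsFinite) {a : Fin n → Piece}
    {o o' : Fin m → Piece} (h : P.Yields a o) (h' : P.Yields a o') : o = o' := by
  obtain ⟨φ, hφ, ho⟩ := h
  obtain ⟨ψ, hψ, ho'⟩ := h'
  funext j
  rw [← ho, ← ho', hφ.unique hP hψ]

theorem Yields.iso {P Q : Picture n m} (e : Iso P Q) {a : Fin n → Piece} {o : Fin m → Piece}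
    (h : P.Yields a o) : Q.Yields a o := by
  obtain ⟨φ, hφ, ho⟩ := h
  have key : ∀ q : Sink m Q.S Q.M, (Q.wire.symm q).map e.symm.eS e.symm.eM =
      P.wire.symm (q.map e.symm.eS e.symm.eM) := fun q => (e.symm.symm_wire q).symm
  refine ⟨fun p => φ (p.map e.symm.eS e.symm.eM), ⟨hφ.frame, fun s b => ?_, fun t b => ?_⟩,
    fun j => (congrArg φ (key (.frame j))).trans (ho j)⟩
  · rw [key]; exact hφ.split _ _
  · rw [key]; exact hφ.merge _ _

/-- Cutting a map and gluing its halves in order gives back the map, and so does gluing followed by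
cutting. Hence the two wires of `P` that are glued across the dipole carry the same label. -/
theorem Yields.of_removal {P Q : Picture n m} (h : IsDipoleRemoval P Q) {a : Fin n → Piece}
    {o : Fin m → Piece} (hP : P.Yields a o) : Q.Yields a o := by
  obtain ⟨φ, hφ, ho⟩ := hP
  obtain ⟨eS, eM, h⟩ := h
  have key : ∀ p : Source n Q.S Q.M,
      φ (P.wire.symm ((Q.wire p).map (eS ∘ some) (eM ∘ some))) =
        φ (p.map (eS ∘ some) (eM ∘ some)) := by
    intro p
    rcases h with ⟨h1, h2⟩ | ⟨h1, h2⟩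
    · rcases h2 p with h | ⟨h, h'⟩
      · rw [← h, Equiv.symm_apply_apply]
      · rw [← h', Equiv.symm_apply_apply]
        refine Piece.ext_sub fun b => ?_
        rw [hφ.merge, ← h1 b, Equiv.symm_apply_apply, hφ.split, ← h, Equiv.symm_apply_apply]
    · rcases h2 p with h | ⟨b, h, h'⟩
      · rw [← h, Equiv.symm_apply_apply]
      · rw [← h', Equiv.symm_apply_apply, hφ.split, ← h1, Equiv.symm_apply_apply, hφ.merge, ← h,
          Equiv.symm_apply_apply]
  have key' : ∀ q : Sink m Q.S Q.M,
      φ ((Q.wire.symm q).map (eS ∘ some) (eM ∘ some)) =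
        φ (P.wire.symm (q.map (eS ∘ some) (eM ∘ some))) := by
    intro q
    rw [← key, Equiv.apply_symm_apply]
  refine ⟨fun p => φ (p.map (eS ∘ some) (eM ∘ some)), ⟨hφ.frame, fun s b => ?_, fun t b => ?_⟩,
    fun j => (key' (.frame j)).trans (ho j)⟩
  · rw [key']; exact hφ.split _ _
  · rw [key']; exact hφ.merge _ _

theorem Yields.concat {P : Picture n k} {Q : Picture k m} {a : Fin n → Piece}
    {b : Fin k → Piece} {c : Fin m → Piece} (hP : P.Yields a b) (hQ : Q.Yields b c) :
    (P.concat Q).Yields a c := by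
  obtain ⟨φ, hφ, hb⟩ := hP
  obtain ⟨ψ, hψ, hc⟩ := hQ
  let χ : Source n (P.S ⊕ Q.S) (P.M ⊕ Q.M) → Piece := fun p => match p with
    | .frame i => φ (.frame i)
    | .split (.inl s) b => φ (.split s b)
    | .split (.inr s) b => ψ (.split s b)
    | .merge (.inl t) => φ (.merge t)
    | .merge (.inr t) => ψ (.merge t)
  have h1 : ∀ p : Source n P.S P.M, χ (p.map Sum.inl Sum.inl) = φ p := by
    rintro (_ | _ | _) <;> rfl
  have h2 : ∀ p : Source k Q.S Q.M, χ (concatUp P Q p) = ψ p := by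
    rintro (j | _ | _)
    · exact (h1 _).trans ((hb j).trans (hψ.frame j).symm)
    · rfl
    · rfl
  refine ⟨χ, ⟨hφ.frame, ?_, ?_⟩, fun j => (h2 _).trans (hc j)⟩
  · rintro (s | s) b
    · exact (hφ.split s b).trans (congrArg (Piece.sub · b) (h1 _).symm)
    · exact (hψ.split s b).trans (congrArg (Piece.sub · b) (h2 _).symm)
  · rintro (t | t) b
    · exact (hφ.merge t b).trans (h1 _).symm
    · exact (hψ.merge t b).trans (h2 _).symm

theorem yields_ofEquiv (e : Fin n ≃ Fin m) (a : Fin n → Piece) :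
    (ofEquiv e).Yields a (fun j => a (e.symm j)) :=
  ⟨fun p => match p with
    | .frame i => a i, ⟨fun _ => rfl, fun s => Empty.elim s, fun t => Empty.elim t⟩, fun _ => rfl⟩

theorem yields_ofPerm (σ : Equiv.Perm (Fin n)) (a : Fin n → Piece) :
    (ofPerm σ).Yields a (fun j => a (σ.symm j)) :=
  (yields_ofEquiv σ a).iso (ofEquivIso σ)

theorem yields_splitFirst (r : ℕ) (a : Fin (r + 1) → Piece) :
    (splitFirst r).Yields a (Fin.cons ((a 0).sub false) (Fin.cons ((a 0).sub true)
      fun i => a i.succ)) := by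
  refine ⟨fun p => match p with
    | .frame i => a i
    | .split _ b => (a 0).sub b, ⟨fun _ => rfl, fun _ _ => rfl, fun t => Empty.elim t⟩, fun j => ?_⟩
  cases j using Fin.cases with
  | zero => rfl
  | succ j =>
    cases j using Fin.cases with
    | zero => rfl
    | succ j => rfl

theorem yields_mergeFirst (r : ℕ) (a : Fin (r + 2) → Piece) :
    (mergeFirst r).Yields a (Fin.cons (Piece.join (a 0) (a 1)) fun i => a i.succ.succ) := by
  refine ⟨fun p => match p with
    | .frame i => a i
    | .merge _ => Piece.join (a 0) (a 1),
    ⟨fun _ => rfl, fun s => Empty.elim s, fun t b => ?_⟩, fun j => ?_⟩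
  · cases b
    · exact Piece.sub_join _ _ _
    · exact Piece.sub_join _ _ _
  · cases j using Fin.cases with
    | zero => rfl
    | succ j => rfl

theorem IsFinite.exists_yields {P : Picture n m} (hP : P.IsFinite) (a : Fin n → Piece) :
    ∃ o, P.Yields a o := by
  refine hP.induction (Φ := fun m P => ∃ o, P.Yields a o) ?_ ⟨_, yields_ofPerm 1 a⟩ ?_ ?_ ?_
  · rintro m P Q ⟨e⟩ ⟨o, h⟩
    exact ⟨o, h.iso e⟩
  · rintro m m' P e - ⟨o, h⟩
    exact ⟨_, h.concat (yields_ofEquiv e o)⟩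
  · rintro r P - ⟨o, h⟩
    exact ⟨_, h.concat (yields_splitFirst r o)⟩
  · rintro r P - ⟨o, h⟩
    exact ⟨_, h.concat (yields_mergeFirst r o)⟩

theorem IsDipoleRemoval.isFinite_iff {P Q : Picture n m} (h : IsDipoleRemoval P Q) :
    P.IsFinite ↔ Q.IsFinite := by
  obtain ⟨eS, eM, -⟩ := h
  constructor
  · rintro ⟨hS, hM⟩
    have := Finite.of_equiv _ eS.symm
    have := Finite.of_equiv _ eM.symm
    exact ⟨Finite.of_injective _ (Option.some_injective _),
      Finite.of_injective _ (Option.some_injective _)⟩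
  · rintro ⟨hS, hM⟩
    exact ⟨Finite.of_equiv _ eS, Finite.of_equiv _ eM⟩

theorem DipoleEq.isFinite_iff {P Q : Picture n m} (h : DipoleEq P Q) :
    P.IsFinite ↔ Q.IsFinite := by
  induction h with
  | rel P Q h =>
    rcases h with ⟨⟨e⟩⟩ | h
    · exact ⟨e.isFinite, e.symm.isFinite⟩
    · exact h.isFinite_iff
  | refl P => rfl
  | symm _ _ _ ih => exact ih.symm
  | trans _ _ _ _ _ ih ih' => exact ih.trans ih'

/-- A removal transports labels only from the larger picture to the smaller one. For the converse,
the larger picture has some labels at the bottom; these pass to the smaller picture, where they are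
unique. -/
theorem DipoleEq.yields_iff {P Q : Picture n m} (h : DipoleEq P Q) (hP : P.IsFinite)
    {a : Fin n → Piece} {o : Fin m → Piece} : P.Yields a o ↔ Q.Yields a o := by
  have key : ∀ {P Q : Picture n m}, P.IsFinite → Q.IsFinite → (P.Yields a o → Q.Yields a o) →
      (Q.IsFinite → (∀ o', P.Yields a o' → Q.Yields a o')) → (P.Yields a o ↔ Q.Yields a o) := by
    intro P Q hP hQ h1 h2
    refine ⟨h1, fun h => ?_⟩
    obtain ⟨o', ho'⟩ := hP.exists_yields a
    rwa [h.unique hQ (h2 hQ o' ho')]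
  induction h with
  | rel P Q h =>
    rcases h with ⟨⟨e⟩⟩ | h
    · exact ⟨fun h => h.iso e, fun h => h.iso e.symm⟩
    · exact key hP (h.isFinite_iff.1 hP) (fun h' => h'.of_removal h) fun _ _ h' => h'.of_removal h
  | refl P => rfl
  | symm P Q h ih => exact (ih ((DipoleEq.isFinite_iff h).2 hP)).symm
  | trans P Q R h h' ih ih' =>
    exact (ih hP).trans (ih' ((DipoleEq.isFinite_iff h).1 hP))

open Classical in
/-- The labels at the bottom of a finite picture with given labels at the top. -/
noncomputable def out (P : Picture n m) (a : Fin n → Piece) : Fin m → Piece :=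
  if h : ∃ o, P.Yields a o then h.choose else fun _ => id

theorem IsFinite.yields_out {P : Picture n m} (hP : P.IsFinite) (a : Fin n → Piece) :
    P.Yields a (P.out a) := by
  have h := hP.exists_yields a
  rw [out, dif_pos h]
  exact h.choose_spec

theorem Yields.out_eq {P : Picture n m} {a : Fin n → Piece} {o : Fin m → Piece}
    (h : P.Yields a o) (hP : P.IsFinite) : P.out a = o :=
  (hP.yields_out a).unique hP h

theorem DipoleEq.out_eq {P Q : Picture n m} (h : DipoleEq P Q) (hP : P.IsFinite)
    (a : Fin n → Piece) : P.out a = Q.out a :=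
  ((DipoleEq.yields_iff h hP).2 (((DipoleEq.isFinite_iff h).1 hP).yields_out a)).out_eq hP

theorem out_concat {P : Picture n k} {Q : Picture k m} (hP : P.IsFinite) (hQ : Q.IsFinite)
    (a : Fin n → Piece) : (P.concat Q).out a = Q.out (P.out a) :=
  ((hP.yields_out a).concat (hQ.yields_out _)).out_eq (hP.concat hQ)

theorem out_ofEquiv (e : Fin n ≃ Fin m) (a : Fin n → Piece) :
    (ofEquiv e).out a = fun j => a (e.symm j) :=
  (yields_ofEquiv e a).out_eq (ofEquiv_isFinite e)

theorem out_ofPerm (σ : Equiv.Perm (Fin n)) (a : Fin n → Piece) :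
    (ofPerm σ).out a = fun j => a (σ.symm j) :=
  (yields_ofPerm σ a).out_eq ⟨inferInstanceAs (Finite Empty), inferInstanceAs (Finite Empty)⟩

theorem splitFirst_isFinite (r : ℕ) : (splitFirst r).IsFinite := (IsAnnular.split r).isFinite

theorem mergeFirst_isFinite (r : ℕ) : (mergeFirst r).IsFinite := (IsAnnular.merge r).isFinite

theorem out_splitFirst (r : ℕ) (a : Fin (r + 1) → Piece) :
    (splitFirst r).out a = Fin.cons ((a 0).sub false) (Fin.cons ((a 0).sub true)
      fun i => a i.succ) :=
  (yields_splitFirst r a).out_eq (splitFirst_isFinite r)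

theorem out_mergeFirst (r : ℕ) (a : Fin (r + 2) → Piece) :
    (mergeFirst r).out a = Fin.cons (Piece.join (a 0) (a 1)) fun i => a i.succ.succ :=
  (yields_mergeFirst r a).out_eq (mergeFirst_isFinite r)

/-- Composition on the left commutes with restriction to halves, which is a composition on the
right. This is why the diagram group acts on labels by composition. -/
theorem out_comp {P : Picture n m} (hP : P.IsFinite) (γ : Piece) (a : Fin n → Piece) :
    P.out (fun i => γ ∘ a i) = fun j => γ ∘ P.out a j := by
  obtain ⟨φ, hφ, ho⟩ := hP.yields_out a
  refine Yields.out_eq ⟨fun p => γ ∘ φ p, ⟨fun i => ?_, fun s b => ?_, fun t b => ?_⟩,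
    fun j => ?_⟩ hP
  · rw [hφ.frame]
  · rw [hφ.split]; rfl
  · rw [← hφ.merge]; rfl
  · exact congrArg (γ ∘ ·) (ho j)

theorem isPartition_comp_equiv {ι κ : Type} {o : ι → Piece} (h : IsPartition o) (e : κ ≃ ι) :
    IsPartition fun j => o (e j) := by
  exact h.comp (Equiv.prodCongr e (Equiv.refl Cantor)).bijective

/-- Cut the first of finitely many Cantor sets into halves. -/
def halve (r : ℕ) : Fin (r + 2) × Cantor ≃ Fin (r + 1) × Cantor where
  toFun x := Fin.cases (0, cons false x.2)
    (fun j => Fin.cases (0, cons true x.2) (fun j => (j.succ, x.2)) j) x.1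
  invFun x := Fin.cases (cond (x.2 0) (Fin.succ 0, tail x.2) (0, tail x.2))
    (fun j => (j.succ.succ, x.2)) x.1
  left_inv := by
    rintro ⟨j, c⟩
    cases j using Fin.cases with
    | zero => rfl
    | succ j => cases j using Fin.cases <;> rfl
  right_inv := by
    rintro ⟨j, c⟩
    obtain ⟨b, c, rfl⟩ := exists_cons c
    cases j using Fin.cases with
    | zero => cases b <;> rfl
    | succ j => rfl

theorem isPartition_split {r : ℕ} {a : Fin (r + 1) → Piece} (h : IsPartition a) :
    IsPartition (Fin.cons ((a 0).sub false) (Fin.cons ((a 0).sub true)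
      fun i => a i.succ) : Fin (r + 2) → Piece) := by
  have := Function.Bijective.comp h (halve r).bijective
  refine (congrArg Function.Bijective ?_).mp this
  funext ⟨j, c⟩
  cases j using Fin.cases with
  | zero => rfl
  | succ j => cases j using Fin.cases <;> rfl

theorem isPartition_merge {r : ℕ} {a : Fin (r + 2) → Piece} (h : IsPartition a) :
    IsPartition (Fin.cons (Piece.join (a 0) (a 1)) fun i => a i.succ.succ :
      Fin (r + 1) → Piece) := by
  have := Function.Bijective.comp h (halve r).symm.bijective
  refine (congrArg Function.Bijective ?_).mp this
  funext ⟨j, c⟩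
  obtain ⟨b, c, rfl⟩ := exists_cons c
  cases j using Fin.cases with
  | zero => cases b <;> rfl
  | succ j => rfl

/-- Each transistor merely regroups the disjoint union of Cantor sets by the bijection `halve` or
its inverse. -/
theorem isPartition_out {P : Picture n m} (hP : P.IsFinite) {a : Fin n → Piece}
    (ha : IsPartition a) : IsPartition (P.out a) := by
  refine hP.induction (Φ := fun m P => P.IsFinite ∧ IsPartition (P.out a)) ?_ ?_ ?_ ?_ ?_ |>.2
  · rintro m P Q ⟨e⟩ ⟨hP, h⟩
    rw [← DipoleEq.out_eq (.of_iso e) hP]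
    exact ⟨e.isFinite hP, h⟩
  · rw [out_ofPerm]
    exact ⟨isFinite_one, ha⟩
  · rintro m m' P e hP ⟨-, h⟩
    rw [out_concat hP (ofEquiv_isFinite e), out_ofEquiv]
    exact ⟨hP.concat (ofEquiv_isFinite e), isPartition_comp_equiv h e.symm⟩
  · rintro r P hP ⟨-, h⟩
    rw [out_concat hP (splitFirst_isFinite r), out_splitFirst]
    exact ⟨hP.concat (splitFirst_isFinite r), isPartition_split h⟩
  · rintro r P hP ⟨-, h⟩
    rw [out_concat hP (mergeFirst_isFinite r), out_mergeFirst]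
    exact ⟨hP.concat (mergeFirst_isFinite r), isPartition_merge h⟩

theorem tame_out {P : Picture n m} (hP : P.IsFinite) {a : Fin n → Piece}
    (ha : ∀ i, Tame (a i)) : ∀ j, Tame (P.out a j) := by
  refine hP.induction (Φ := fun m P => P.IsFinite ∧ ∀ j, Tame (P.out a j)) ?_ ?_ ?_ ?_ ?_ |>.2
  · rintro m P Q ⟨e⟩ ⟨hP, h⟩
    rw [← DipoleEq.out_eq (.of_iso e) hP]
    exact ⟨e.isFinite hP, h⟩
  · rw [out_ofPerm]
    exact ⟨isFinite_one, ha⟩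
  · rintro m m' P e hP ⟨-, h⟩
    rw [out_concat hP (ofEquiv_isFinite e), out_ofEquiv]
    exact ⟨hP.concat (ofEquiv_isFinite e), fun j => h _⟩
  · rintro r P hP ⟨-, h⟩
    rw [out_concat hP (splitFirst_isFinite r), out_splitFirst]
    refine ⟨hP.concat (splitFirst_isFinite r), fun j => ?_⟩
    cases j using Fin.cases with
    | zero => exact (h 0).sub _
    | succ j =>
      cases j using Fin.cases with
      | zero => exact (h 0).sub _
      | succ j => exact h _
  · rintro r P hP ⟨-, h⟩
    rw [out_concat hP (mergeFirst_isFinite r), out_mergeFirst]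
    refine ⟨hP.concat (mergeFirst_isFinite r), fun j => ?_⟩
    cases j using Fin.cases with
    | zero =>
      refine Tame.of_sub fun b => ?_
      rw [Fin.cons_zero, Piece.sub_join]
      cases b
      · exact h 0
      · exact h 1
    | succ j => exact h _

end Picture
end DiagramProfile

namespace DiagramProfile

open Picture

/-! ### Rotations -/

/-- A cyclic rotation of the contacts. -/
def IsRotation {n m : ℕ} (e : Fin n ≃ Fin m) : Prop :=
  n = m ∧ ∃ k, ∀ i, (e i : ℕ) = (i + k) % n

theorem finRotate_pow_val {n : ℕ} (k : ℕ) (i : Fin n) :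
    (((finRotate n ^ k : Equiv.Perm (Fin n)) i : Fin n) : ℕ) = (i + k) % n := by
  rcases n with _ | n
  · exact i.elim0
  induction k with
  | zero => simp [Nat.mod_eq_of_lt i.2]
  | succ k ih =>
    rw [pow_succ', Equiv.Perm.mul_apply, finRotate_apply, Fin.val_add, ih]
    -- In `Fin 1` the number `1` has value `0`, so the case of a single contact is separate.
    rcases n with _ | n
    · simp [Nat.mod_one]
    · simp [Nat.add_assoc]

/-- The rotation that moves the contact `0` to the contact `k`. -/
def rotation {n m : ℕ} (h : n = m) (k : ℕ) : Fin n ≃ Fin m :=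
  Equiv.trans (finRotate n ^ k : Equiv.Perm (Fin n)) (finCongr h)

theorem rotation_val {n m : ℕ} (h : n = m) (k : ℕ) (i : Fin n) :
    (rotation h k i : ℕ) = (i + k) % n :=
  finRotate_pow_val k i

theorem isRotation_rotation {n m : ℕ} (h : n = m) (k : ℕ) : IsRotation (rotation h k) :=
  ⟨h, k, rotation_val h k⟩

theorem IsRotation.isAnnular {n m : ℕ} {e : Fin n ≃ Fin m} (h : IsRotation e) :
    IsAnnular (ofEquiv e) := by
  obtain ⟨rfl, k, hk⟩ := h
  have : e = (finRotate n ^ k : Equiv.Perm (Fin n)) := by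
    ext i
    rw [hk, finRotate_pow_val]
  rw [this]
  refine .iso ⟨(ofEquivIso _).symm⟩ ?_
  have := IsAnnular.rotation n k
  rwa [zpow_natCast] at this

/-- Putting `l'` in front pushes the entries of `l` back by `l'.length` places, which is the amount
of the rotation. Indices in `l` move without wrapping around, and those in `l'` wrap around once. -/
theorem ofFn_rotation {α : Type} {n m : ℕ} {a : Fin n → α} {l l' : List α}
    (h : List.ofFn a = l ++ l') (hm : n = m) :
    List.ofFn (fun j => a ((rotation hm l'.length).symm j)) = l' ++ l := by
  have hn : n = l.length + l'.length := by
    have := congrArg List.length h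
    simpa using this
  have ha : ∀ i : Fin n, some (a i) = (l ++ l')[(i : ℕ)]? := by
    intro i
    rw [← h]
    simp
  subst hm
  apply List.ext_getElem?
  intro j
  by_cases hj : j < n
  · obtain ⟨i, hi⟩ := (rotation rfl l'.length).surjective (⟨j, hj⟩ : Fin n)
    have hv := congrArg Fin.val hi
    rw [rotation_val] at hv
    change _ = j at hv
    rw [List.getElem?_ofFn, dif_pos hj, ← hi, Equiv.symm_apply_apply, ha]
    have hi2 := i.2
    by_cases hc : (i : ℕ) < l.length
    · rw [Nat.mod_eq_of_lt (by omega)] at hv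
      rw [List.getElem?_append_left hc, ← hv, List.getElem?_append_right (by omega)]
      simp
    · have : ((i : ℕ) + l'.length) % n = i - l.length := by
        rw [Nat.mod_eq_sub_mod (by omega), Nat.mod_eq_of_lt (by omega)]
        omega
      rw [this] at hv
      rw [List.getElem?_append_right (by omega), ← hv, List.getElem?_append_left (by omega)]
  · rw [List.getElem?_eq_none (by simp; omega), List.getElem?_eq_none (by simp; omega)]

/-- A rearrangement that rotates a list without repetitions is a rotation. -/
theorem isRotation_of_ofFn {α : Type} {n m : ℕ} {a : Fin n → α} (ha : Function.Injective a)
    {l l' : List α} (h : List.ofFn a = l ++ l') (σ : Fin n ≃ Fin m)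
    (hσ : List.ofFn (fun j => a (σ.symm j)) = l' ++ l) : IsRotation σ := by
  have hm : n = m := by simpa using Fintype.card_congr σ
  rw [← ofFn_rotation h hm, List.ofFn_injective.eq_iff] at hσ
  have : σ = rotation hm l'.length := by
    have h1 : σ.symm = (rotation hm l'.length).symm := by
      ext1 j
      exact ha (congrFun hσ j)
    rw [← Equiv.symm_symm σ, h1, Equiv.symm_symm]
  rw [this]
  exact isRotation_rotation _ _

theorem rotation_symm_zero {n r : ℕ} (h : n = r + 1) {i k : ℕ} (hi : i + k = n) (hk : 0 < k) :
    ((rotation h k).symm 0 : ℕ) = i := by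
  have : (rotation h k).symm 0 = ⟨i, by omega⟩ := by
    rw [Equiv.symm_apply_eq]
    ext
    rw [rotation_val]
    simp [hi]
  rw [this]

/-! ### Permutation pictures -/

namespace Picture

variable {n m k l : ℕ}

/-- Permutation pictures compose like permutations. -/
def ofEquivConcat (e : Fin n ≃ Fin m) (f : Fin m ≃ Fin k) :
    Iso ((ofEquiv e).concat (ofEquiv f)) (ofEquiv (e.trans f)) where
  eS := Equiv.emptySum Empty Empty
  eM := Equiv.emptySum Empty Empty
  wire p := by
    rcases p with i | ⟨⟨⟨⟩⟩ | ⟨⟨⟩⟩, b⟩ | (⟨⟨⟩⟩ | ⟨⟨⟩⟩)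
    rfl

/-- The trivial permutation picture is a unit. -/
def concatRefl (P : Picture n m) : Iso (P.concat (ofEquiv (Equiv.refl _))) P :=
  ((Iso.refl P).concat (ofEquivIso 1)).trans (Iso.concatOne P)

/-- A permutation picture followed by its inverse. -/
def concatSymm (P : Picture n m) (e : Fin m ≃ Fin k) :
    Iso ((P.concat (ofEquiv e)).concat (ofEquiv e.symm)) P :=
  (Iso.assoc _ _ _).trans <| ((Iso.refl P).concat ((ofEquivConcat e e.symm).trans (by
    rw [Equiv.self_trans_symm]
    exact Iso.refl _))).trans (concatRefl P)

/-- The mirror image of a permutation picture. -/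
def ofEquivMirror (e : Fin n ≃ Fin m) : Iso (ofEquiv e).mirror (ofEquiv e.symm) :=
  ⟨Equiv.refl _, Equiv.refl _, by rintro (i | ⟨⟨⟩, _⟩ | ⟨⟨⟩⟩); rfl⟩

theorem DipoleEq.split_merge (r : ℕ) :
    DipoleEq ((splitFirst r).concat (mergeFirst r)) (ofPerm 1) :=
  concat_mirror _ (splitFirst_isFinite r)

theorem DipoleEq.merge_split (r : ℕ) :
    DipoleEq ((mergeFirst r).concat (splitFirst r)) (ofPerm 1) :=
  mirror_concat _ (splitFirst_isFinite r)

theorem DipoleEq.concat_split_merge {r : ℕ} (P : Picture n (r + 1)) :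
    DipoleEq ((P.concat (splitFirst r)).concat (mergeFirst r)) P :=
  (DipoleEq.of_iso (Iso.assoc _ _ _)).trans <|
    (DipoleEq.concat (.refl P) (.split_merge r)).trans (.of_iso (Iso.concatOne P))

theorem DipoleEq.concat_merge_split {r : ℕ} (P : Picture n (r + 2)) :
    DipoleEq ((P.concat (mergeFirst r)).concat (splitFirst r)) P :=
  (DipoleEq.of_iso (Iso.assoc _ _ _)).trans <|
    (DipoleEq.concat (.refl P) (.merge_split r)).trans (.of_iso (Iso.concatOne P))

/-- A permutation that fixes the contact carrying the transistor can be pushed below the transistor,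
since the wire above the transistor is unchanged. -/
theorem exists_iso_ofEquiv_split {r : ℕ} (e : Fin (r + 1) ≃ Fin (r + 1)) (h : e 0 = 0) :
    ∃ f : Fin (r + 2) ≃ Fin (r + 2), Nonempty (Iso ((splitFirst r).concat (ofEquiv f))
      ((ofEquiv e).concat (splitFirst r))) := by
  refine exists_iso_concat_ofEquiv (P := (ofEquiv e).concat (splitFirst r)) (Q := splitFirst r)
    (Equiv.emptySum Empty Unit).symm (Equiv.emptySum Empty Empty).symm ?_ ?_
  · rintro ⟨⟩
    have : e.symm 0 = 0 := by rw [Equiv.symm_apply_eq, h]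
    exact congrArg Source.frame this
  · rintro ⟨⟩

theorem exists_iso_ofEquiv_merge {r : ℕ} (e : Fin (r + 2) ≃ Fin (r + 2)) (h : e 0 = 0)
    (h' : e 1 = 1) :
    ∃ f : Fin (r + 1) ≃ Fin (r + 1), Nonempty (Iso ((mergeFirst r).concat (ofEquiv f))
      ((ofEquiv e).concat (mergeFirst r))) := by
  refine exists_iso_concat_ofEquiv (P := (ofEquiv e).concat (mergeFirst r)) (Q := mergeFirst r)
    (Equiv.emptySum Empty Empty).symm (Equiv.emptySum Empty Unit).symm ?_ ?_
  · rintro ⟨⟩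
  · rintro ⟨⟩ b
    have h0 : e.symm 0 = 0 := by rw [Equiv.symm_apply_eq, h]
    have h1 : e.symm 1 = 1 := by rw [Equiv.symm_apply_eq, h']
    cases b
    · exact congrArg Source.frame h0
    · exact congrArg Source.frame h1

/-- Without transistors only rotations can occur in the construction of an annular picture, and
their amounts add up. The conclusion is phrased through the wires so that it passes to isomorphic
pictures. -/
theorem IsAnnular.rotation_of_isPermutation {P : Picture n m} (h : IsAnnular P)
    (hP : P.IsPermutation) :
    n = m ∧ ∃ k : ℕ, ∀ i j, P.wire (.frame i) = .frame j → (j : ℕ) = (i + k) % n := by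
  induction h with
  | rotation n j =>
    -- The rotation has finite order, so an integer power is also a natural one.
    obtain ⟨k, hk⟩ : ∃ k : ℕ, finRotate n ^ k = finRotate n ^ j := by
      have : finRotate n ^ j ∈ Submonoid.powers (finRotate n) :=
        mem_powers_iff_mem_zpowers.2 ⟨j, rfl⟩
      exact this
    refine ⟨rfl, k, fun i i' h => ?_⟩
    rw [← hk] at h
    have : (finRotate n ^ k) i = i' := Sink.frame.inj h
    rw [← this, finRotate_pow_val]
  | split n => exact hP.1.elim ()
  | merge n => exact hP.2.elim ()
  | @concat n k m P Q _ _ ih ih' =>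
    obtain ⟨rfl, a, ha⟩ := ih ⟨⟨fun s => hP.1.elim (.inl s)⟩, ⟨fun s => hP.2.elim (.inl s)⟩⟩
    obtain ⟨rfl, b, hb⟩ := ih' ⟨⟨fun s => hP.1.elim (.inr s)⟩, ⟨fun s => hP.2.elim (.inr s)⟩⟩
    refine ⟨rfl, a + b, fun i j h => ?_⟩
    have h1 : concatDown P Q (P.wire (.frame i)) = .frame j := h
    rcases h2 : P.wire (.frame i) with i' | s | ⟨t, c⟩
    · rw [h2] at h1
      have h1 : (Q.wire (.frame i')).map Sum.inr Sum.inr = .frame j := h1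
      rcases h3 : Q.wire (.frame i') with j' | s | ⟨t, c⟩ <;> simp [h3, Sink.map] at h1
      subst h1
      rw [hb _ _ h3, ha _ _ h2]
      simp [Nat.add_assoc]
    · exact hP.1.elim (.inl s)
    · exact hP.2.elim (.inl t)
  | @iso n m P Q e _ ih =>
    obtain ⟨e⟩ := e
    obtain ⟨rfl, k, hk⟩ := ih ⟨⟨fun s => hP.1.elim (e.eS s)⟩, ⟨fun s => hP.2.elim (e.eM s)⟩⟩
    refine ⟨rfl, k, fun i j h => hk i j ?_⟩
    have h1 := e.symm.wire (.frame i)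
    rw [h] at h1
    exact h1

end Picture

/-! ### Classes of pictures -/

/-- The properties of a class of pictures that are used below. -/
structure PictureClass.IsNice (C : PictureClass) : Prop where
  annular : ∀ {n m : ℕ} {P : Picture n m}, IsAnnular P → C.Mem P
  iso : ∀ {n m : ℕ} {P Q : Picture n m}, Iso P Q → C.Mem P → C.Mem Q
  induction : ∀ {Φ : ∀ m, Picture 1 m → Prop},
    (∀ m (P Q : Picture 1 m), Nonempty (Iso P Q) → C.Mem P → Φ m P → Φ m Q) →
    Φ 1 (ofPerm 1) →
    (∀ m m' (P : Picture 1 m) (e : Fin m ≃ Fin m'), C.Mem P → C.Mem (ofEquiv e) → Φ m P →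
      Φ m' (P.concat (ofEquiv e))) →
    (∀ r (P : Picture 1 (r + 1)), C.Mem P → Φ _ P → Φ _ (P.concat (splitFirst r))) →
    (∀ r (P : Picture 1 (r + 2)), C.Mem P → Φ _ P → Φ _ (P.concat (mergeFirst r))) →
    ∀ {m : ℕ} (P : Picture 1 m), C.Mem P → Φ m P
  -- This dichotomy lets both classes be treated together: a rotation with a fixed contact is
  -- trivial, whereas the braided class contains all permutations.
  stab : ∀ {n : ℕ} (σ : Fin (n + 1) ≃ Fin (n + 1)), C.Mem (ofEquiv σ) → σ 0 = 0 →
    σ = Equiv.refl _ ∨ ∀ {k m : ℕ} (τ : Fin k ≃ Fin m), C.Mem (ofEquiv τ)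

theorem braided_isNice : braided.IsNice where
  annular h := h.isFinite
  iso e h := e.isFinite h
  induction {Φ} iso one perm split merge m P hP := by
    refine (IsFinite.induction (Φ := fun m P => P.IsFinite ∧ Φ m P) ?_ ⟨isFinite_one, one⟩
      ?_ ?_ ?_ P hP).2
    · rintro m P Q ⟨e⟩ ⟨h, h'⟩
      exact ⟨e.isFinite h, iso _ _ _ ⟨e⟩ h h'⟩
    · rintro m m' P e h ⟨-, h'⟩
      exact ⟨h.concat (ofEquiv_isFinite e), perm _ _ _ _ h (ofEquiv_isFinite e) h'⟩
    · rintro r P h ⟨-, h'⟩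
      exact ⟨h.concat (splitFirst_isFinite r), split _ _ h h'⟩
    · rintro r P h ⟨-, h'⟩
      exact ⟨h.concat (mergeFirst_isFinite r), merge _ _ h h'⟩
  stab _ _ _ := .inr fun τ => ofEquiv_isFinite τ

theorem annular_isNice : annular.IsNice where
  annular h := h
  iso e h := .iso ⟨e⟩ h
  induction {Φ} iso one perm split merge m P hP := by
    -- Annular pictures are built by arbitrary concatenations, while the claim adds one generator at
    -- a time at the bottom. The induction therefore runs over a picture `Q` hanging below an
    -- arbitrary `P`.
    have key : ∀ {n m : ℕ} {Q : Picture n m}, IsAnnular Q → ∀ P : Picture 1 n, IsAnnular P →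
        Φ n P → Φ m (P.concat Q) := by
      intro n m Q hQ
      induction hQ with
      | rotation n j =>
        intro P hP h
        have hr : IsAnnular (ofEquiv (finRotate n ^ j : Equiv.Perm (Fin n))) :=
          .iso ⟨(ofEquivIso _).symm⟩ (.rotation n j)
        exact iso _ _ _ ⟨(Iso.refl P).concat (ofEquivIso _)⟩ (hP.concat hr)
          (perm _ _ P _ hP hr h)
      | split n => exact fun P hP h => split _ _ hP h
      | merge n => exact fun P hP h => merge _ _ hP h
      | @concat _ _ _ Q Q' hQ hQ' ih ih' =>
        exact fun P hP h => iso _ _ _ ⟨Iso.assoc _ _ _⟩ ((hP.concat hQ).concat hQ')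
          (ih' _ (hP.concat hQ) (ih _ hP h))
      | iso e hQ ih =>
        obtain ⟨e⟩ := e
        exact fun P hP h => iso _ _ _ ⟨(Iso.refl P).concat e⟩ (hP.concat hQ) (ih _ hP h)
    exact iso _ _ _ ⟨Iso.oneConcat P⟩ (IsAnnular.one.concat hP) (key hP _ .one one)
  stab {n} σ hσ h0 := by
    left
    obtain ⟨-, k, hk⟩ := IsAnnular.rotation_of_isPermutation hσ (ofEquiv_isPermutation σ)
    have hk : ∀ i, (σ i : ℕ) = (i + k) % (n + 1) := fun i => hk i (σ i) rfl
    have := hk 0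
    rw [h0] at this
    ext i
    rw [hk, Nat.add_mod]
    simp at this
    rw [← this]
    simp [Nat.mod_eq_of_lt i.2]

end DiagramProfile

namespace DiagramProfile

open Picture

/-! ### The pieces of a vertex -/

/-- The labels at the bottom of a picture with one contact at the top. -/
noncomputable abbrev Picture.outs {n : ℕ} (P : Picture 1 n) : Fin n → Piece := P.out fun _ => id

theorem isPartition_outs {n : ℕ} {P : Picture 1 n} (hP : P.IsFinite) : IsPartition P.outs := by
  refine isPartition_out hP ⟨?_, fun c => ⟨(0, c), rfl⟩⟩
  rintro ⟨i, c⟩ ⟨j, d⟩ h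
  exact Prod.ext (Subsingleton.elim _ _) h

theorem Picture.DipoleEq.outs_eq {n : ℕ} {P Q : Picture 1 n} (h : DipoleEq P Q)
    (hP : P.IsFinite) : P.outs = Q.outs := h.out_eq hP _

theorem outs_concat_ofEquiv {n m : ℕ} {P : Picture 1 n} (hP : P.IsFinite) (e : Fin n ≃ Fin m) :
    (P.concat (ofEquiv e)).outs = fun j => P.outs (e.symm j) := by
  rw [outs, out_concat hP (ofEquiv_isFinite e), out_ofEquiv]

theorem outs_concat_split {r : ℕ} {P : Picture 1 (r + 1)} (hP : P.IsFinite) :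
    (P.concat (splitFirst r)).outs = Fin.cons ((P.outs 0).sub false)
      (Fin.cons ((P.outs 0).sub true) fun i => P.outs i.succ) := by
  rw [outs, out_concat hP (splitFirst_isFinite r), out_splitFirst]

theorem outs_concat_merge {r : ℕ} {P : Picture 1 (r + 2)} (hP : P.IsFinite) :
    (P.concat (mergeFirst r)).outs = Fin.cons (Piece.join (P.outs 0) (P.outs 1))
      fun i => P.outs i.succ.succ := by
  rw [outs, out_concat hP (mergeFirst_isFinite r), out_mergeFirst]

/-- The set `V` arises from the set `U` by cutting the piece `h ∈ U` into halves. -/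
def Halved (h : Piece) (U V : Set Piece) : Prop :=
  h ∈ U ∧ V = (U \ {h}) ∪ {h.sub false, h.sub true}

theorem range_split {r : ℕ} {a : Fin (r + 1) → Piece} (ha : Function.Injective a) :
    Halved (a 0) (Set.range a) (Set.range (Fin.cons ((a 0).sub false)
      (Fin.cons ((a 0).sub true) fun i => a i.succ) : Fin (r + 2) → Piece)) := by
  refine ⟨⟨0, rfl⟩, ?_⟩
  ext f
  constructor
  · rintro ⟨j, rfl⟩
    cases j using Fin.cases with
    | zero => exact .inr (.inl rfl)
    | succ j =>
      cases j using Fin.cases with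
      | zero => exact .inr (.inr rfl)
      | succ j => exact .inl ⟨⟨_, rfl⟩, fun h => Fin.succ_ne_zero _ (ha h)⟩
  · rintro (⟨⟨j, rfl⟩, hj⟩ | rfl | rfl)
    · cases j using Fin.cases with
      | zero => exact absurd rfl hj
      | succ j => exact ⟨j.succ.succ, rfl⟩
    · exact ⟨0, rfl⟩
    · exact ⟨Fin.succ 0, rfl⟩

namespace PictureClass

variable {C : PictureClass}

theorem vertex_eq_of_dipoleEq {n : ℕ} {P Q : Picture 1 n} {hP : C.Mem P} {hQ : C.Mem Q}
    (h : DipoleEq P Q) : C.vertex P hP = C.vertex Q hQ :=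
  Quot.sound ⟨ofPerm 1, C.one, ⟨inferInstanceAs (IsEmpty Empty), inferInstanceAs (IsEmpty Empty)⟩,
    (DipoleEq.of_iso (Iso.concatOne P)).trans h⟩

theorem vertex_concat_ofEquiv {n m : ℕ} {P : Picture 1 n} {hP : C.Mem P} {e : Fin n ≃ Fin m}
    (he : C.Mem (ofEquiv e)) :
    C.vertex (P.concat (ofEquiv e)) (C.concat hP he) = C.vertex P hP :=
  (Quot.sound ⟨ofEquiv e, he, ofEquiv_isPermutation e, DipoleEq.refl _⟩).symm

theorem exists_rep (v : C.Vertex) : ∃ (n : ℕ) (P : Picture 1 n) (hP : C.Mem P),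
    v = vertex P hP := by
  obtain ⟨⟨n, P, hP⟩⟩ := v
  exact ⟨n, P, hP, rfl⟩

theorem IsNice.symm (hC : C.IsNice) {n m : ℕ} {e : Fin n ≃ Fin m} (he : C.Mem (ofEquiv e)) :
    C.Mem (ofEquiv e.symm) :=
  hC.iso (ofEquivMirror e) (C.mirror he)

theorem IsNice.rotation (hC : C.IsNice) {n m : ℕ} (h : n = m) (k : ℕ) :
    C.Mem (ofEquiv (rotation h k)) :=
  hC.annular (isRotation_rotation h k).isAnnular

theorem IsNice.split (hC : C.IsNice) (r : ℕ) : C.Mem (splitFirst r) := hC.annular (.split r)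

theorem IsNice.merge (hC : C.IsNice) (r : ℕ) : C.Mem (mergeFirst r) := hC.annular (.merge r)

/-- Two pictures represent the same vertex if and only if they agree modulo dipoles up to a
permutation in the class. -/
theorem IsNice.vertex_eq_iff (hC : C.IsNice) {n m : ℕ} {P : Picture 1 n} {Q : Picture 1 m}
    {hP : C.Mem P} {hQ : C.Mem Q} : C.vertex P hP = C.vertex Q hQ ↔
      ∃ e : Fin n ≃ Fin m, C.Mem (ofEquiv e) ∧ DipoleEq (P.concat (ofEquiv e)) Q := by
  constructor
  · intro h
    have h := Quot.eqvGen_exact h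
    have key : ∀ X Y : Σ n, {P : Picture 1 n // C.Mem P}, Relation.EqvGen (fun P Q :
        Σ n, {P : Picture 1 n // C.Mem P} => ∃ Ψ : Picture P.1 Q.1, C.Mem Ψ ∧ Ψ.IsPermutation ∧
          DipoleEq (P.2.1.concat Ψ) Q.2.1) X Y →
        ∃ e : Fin X.1 ≃ Fin Y.1, C.Mem (ofEquiv e) ∧
          DipoleEq (X.2.1.concat (ofEquiv e)) Y.2.1 := by
      intro X Y h
      induction h with
      | rel X Y h =>
        obtain ⟨Ψ, h1, h2, h3⟩ := h
        obtain ⟨e, ⟨f⟩⟩ := h2.exists_ofEquiv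
        exact ⟨e, hC.iso f h1, (DipoleEq.of_iso ((Iso.refl _).concat f.symm)).trans h3⟩
      | refl X => exact ⟨Equiv.refl _, hC.iso (ofEquivIso 1).symm C.one, .of_iso (concatRefl _)⟩
      | symm X Y _ ih =>
        obtain ⟨e, he, h⟩ := ih
        exact ⟨e.symm, hC.symm he, (h.symm.concat (.refl _)).trans (.of_iso (concatSymm _ e))⟩
      | trans X Y Z _ _ ih ih' =>
        obtain ⟨e, he, h⟩ := ih
        obtain ⟨f, hf, h'⟩ := ih'
        exact ⟨e.trans f, hC.iso (ofEquivConcat e f) (C.concat he hf),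
          (DipoleEq.of_iso (((Iso.refl _).concat (ofEquivConcat e f).symm).trans
            (Iso.assoc _ _ _).symm)).trans ((h.concat (.refl _)).trans h')⟩
    exact key _ _ h
  · rintro ⟨e, he, h⟩
    rw [← vertex_concat_ofEquiv he, vertex_eq_of_dipoleEq h]

/-- The set of labels at the bottom of a picture that represents a vertex. -/
noncomputable def pieces (v : C.Vertex) : Set Piece :=
  Quot.lift (fun P : Σ n, {P : Picture 1 n // C.Mem P} => Set.range P.2.1.outs) (by
    rintro ⟨n, P, hP⟩ ⟨m, Q, hQ⟩ ⟨Ψ, h1, h2, h3⟩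
    obtain ⟨e, ⟨f⟩⟩ := h2.exists_ofEquiv
    change Fin n ≃ Fin m at e
    change Set.range P.outs = Set.range Q.outs
    have h4 : DipoleEq (P.concat (ofEquiv e)) Q :=
      (DipoleEq.of_iso ((Iso.refl _).concat f.symm)).trans h3
    rw [← h4.outs_eq ((C.isFinite hP).concat (ofEquiv_isFinite e)),
      outs_concat_ofEquiv (C.isFinite hP)]
    exact (e.symm.surjective.range_comp P.outs).symm) v

theorem pieces_vertex {n : ℕ} (P : Picture 1 n) (hP : C.Mem P) :
    pieces (C.vertex P hP) = Set.range P.outs := rfl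

theorem pieces_base : pieces C.base = {id} := by
  rw [base, pieces_vertex, outs, out_ofPerm]
  exact Set.range_const

/-- This combines the disjointness of the images of different pieces with the injectivity of each
piece. -/
theorem pieces_eq_of_apply {v : C.Vertex} {f g : Piece} (hf : f ∈ pieces v) (hg : g ∈ pieces v)
    {c d : Cantor} (h : f c = g d) : f = g ∧ c = d := by
  obtain ⟨n, P, hP, rfl⟩ := exists_rep v
  obtain ⟨i, rfl⟩ := hf
  obtain ⟨j, rfl⟩ := hg
  obtain ⟨h1, h2⟩ := (isPartition_outs (C.isFinite hP)).eq_of_apply h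
  exact ⟨congrArg _ h1, h2⟩

theorem piece_injective {v : C.Vertex} {f : Piece} (hf : f ∈ pieces v) : Function.Injective f :=
  fun _ _ h => (pieces_eq_of_apply hf hf h).2

theorem exists_piece (v : C.Vertex) (c : Cantor) : ∃ f ∈ pieces v, ∃ d, f d = c := by
  obtain ⟨n, P, hP, rfl⟩ := exists_rep v
  obtain ⟨i, d, h⟩ := (isPartition_outs (C.isFinite hP)).exists_apply c
  exact ⟨_, ⟨i, rfl⟩, d, h⟩

theorem pieces_finite (v : C.Vertex) : (pieces v).Finite := by
  obtain ⟨n, P, hP, rfl⟩ := exists_rep v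
  exact Set.finite_range _

theorem pieces_tame {v : C.Vertex} {f : Piece} (hf : f ∈ pieces v) : Tame f := by
  obtain ⟨n, P, hP, rfl⟩ := exists_rep v
  obtain ⟨i, rfl⟩ := hf
  exact tame_out (C.isFinite hP) (fun _ => tame_id) i

/-- Two pieces of a vertex have no common restriction. -/
theorem pieces_eq_of_comp_pre {v : C.Vertex} {f g : Piece} (hf : f ∈ pieces v)
    (hg : g ∈ pieces v) {u w : List Bool} (h : f ∘ pre u = g ∘ pre w) : f = g ∧ u = w := by
  obtain ⟨rfl, -⟩ := pieces_eq_of_apply hf hg (congrFun h fun _ => true)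
  exact ⟨rfl, comp_pre_inj (piece_injective hf) h⟩

theorem sub_notMem {v : C.Vertex} {f : Piece} (hf : f ∈ pieces v) (b : Bool) :
    f.sub b ∉ pieces v := by
  intro h
  have := pieces_eq_of_comp_pre h hf (u := []) (w := [b]) rfl
  simp at this

theorem sub_ne {v : C.Vertex} {f : Piece} (hf : f ∈ pieces v) : f.sub false ≠ f.sub true := by
  intro h
  have := pieces_eq_of_comp_pre hf hf (u := [false]) (w := [true]) h
  simp at this

/-- The pieces of `v` already cover the Cantor set, and further pieces of `w` would have images
disjoint from theirs. -/
theorem eq_of_pieces_subset {v w : C.Vertex} (h : pieces v ⊆ pieces w) : pieces v = pieces w := by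
  refine h.antisymm fun f hf => ?_
  obtain ⟨g, hg, d, hd⟩ := exists_piece v (f fun _ => true)
  rwa [← (pieces_eq_of_apply (h hg) hf hd).1]

/-- The vertex is represented by a picture with the list `l` of labels at the bottom. -/
def HasList (v : C.Vertex) (l : List Piece) : Prop :=
  ∃ (n : ℕ) (P : Picture 1 n) (hP : C.Mem P), v = vertex P hP ∧ List.ofFn P.outs = l

theorem exists_hasList (v : C.Vertex) : ∃ l, HasList v l := by
  obtain ⟨n, P, hP, rfl⟩ := exists_rep v
  exact ⟨_, n, P, hP, rfl, rfl⟩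

theorem HasList.mem_iff {v : C.Vertex} {l : List Piece} (h : HasList v l) {f : Piece} :
    f ∈ l ↔ f ∈ pieces v := by
  obtain ⟨n, P, hP, rfl, rfl⟩ := h
  rw [List.mem_ofFn, pieces_vertex]
  exact Iff.rfl

theorem HasList.nodup {v : C.Vertex} {l : List Piece} (h : HasList v l) : l.Nodup := by
  obtain ⟨n, P, hP, rfl, rfl⟩ := h
  exact List.nodup_ofFn.2 (isPartition_outs (C.isFinite hP)).injective

theorem ofFn_rotate {n m : ℕ} {P : Picture 1 n} (hP : C.Mem P)
    {l l' : List Piece} (h : List.ofFn P.outs = l ++ l') (hm : n = m) :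
    List.ofFn (P.concat (ofEquiv (DiagramProfile.rotation hm l'.length))).outs = l' ++ l := by
  rw [outs_concat_ofEquiv (C.isFinite hP)]
  exact ofFn_rotation h hm

theorem HasList.rotate (hC : C.IsNice) {v : C.Vertex} {l l' : List Piece}
    (h : HasList v (l ++ l')) : HasList v (l' ++ l) := by
  obtain ⟨n, P, hP, rfl, h⟩ := h
  exact ⟨n, _, C.concat hP (hC.rotation rfl l'.length), (vertex_concat_ofEquiv (hC.rotation rfl l'.length)).symm,
    ofFn_rotate hP h rfl⟩

/-- Rotations belong to every nice class and do not change the vertex, so any piece may be assumed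
to stand first. -/
theorem exists_hasList_cons (hC : C.IsNice) {v : C.Vertex} {f : Piece} (hf : f ∈ pieces v) :
    ∃ l, HasList v (f :: l) := by
  obtain ⟨l, hl⟩ := exists_hasList v
  obtain ⟨l1, l2, rfl⟩ := List.append_of_mem (hl.mem_iff.2 hf)
  exact ⟨_, hl.rotate hC⟩

theorem HasList.cons {v : C.Vertex} {f : Piece} {l : List Piece} (h : HasList v (f :: l)) :
    ∃ (P : Picture 1 (l.length + 1)) (hP : C.Mem P), v = vertex P hP ∧ P.outs 0 = f ∧
      List.ofFn P.outs = f :: l := by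
  obtain ⟨n, P, hP, rfl, h⟩ := h
  have hn : n = l.length + 1 := by simpa using congrArg List.length h
  subst hn
  refine ⟨P, hP, rfl, ?_, h⟩
  rw [List.ofFn_succ] at h
  exact (List.cons.inj h).1

/-- The vertex `w` arises from the vertex `v` by splitting the piece `g` with a transistor. -/
def Split (hC : C.IsNice) (g : Piece) (v w : C.Vertex) : Prop :=
  ∃ (r : ℕ) (P : Picture 1 (r + 1)) (hP : C.Mem P), P.outs 0 = g ∧ v = vertex P hP ∧
    w = vertex (P.concat (splitFirst r)) (C.concat hP (hC.split r))

theorem Split.halved {hC : C.IsNice} {g : Piece} {v w : C.Vertex} (h : Split hC g v w) :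
    Halved g (pieces v) (pieces w) := by
  obtain ⟨r, P, hP, rfl, rfl, rfl⟩ := h
  rw [pieces_vertex, pieces_vertex, outs_concat_split (C.isFinite hP)]
  exact range_split (isPartition_outs (C.isFinite hP)).injective

theorem ofFn_split {r : ℕ} {P : Picture 1 (r + 1)} (hP : P.IsFinite) {f : Piece} {l : List Piece}
    (h : List.ofFn P.outs = f :: l) :
    List.ofFn (P.concat (splitFirst r)).outs = f.sub false :: f.sub true :: l := by
  rw [outs_concat_split hP, List.ofFn_cons, List.ofFn_cons]
  rw [List.ofFn_succ] at h
  obtain ⟨rfl, rfl⟩ := List.cons.inj h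
  rfl

theorem ofFn_merge {r : ℕ} {P : Picture 1 (r + 2)} (hP : P.IsFinite) {f : Piece} {l : List Piece}
    (h : List.ofFn P.outs = f.sub false :: f.sub true :: l) :
    List.ofFn (P.concat (mergeFirst r)).outs = f :: l := by
  rw [outs_concat_merge hP, List.ofFn_cons]
  rw [List.ofFn_succ, List.ofFn_succ] at h
  obtain ⟨h1, h⟩ := List.cons.inj h
  obtain ⟨h2, rfl⟩ := List.cons.inj h
  have h2 : P.outs 1 = f.sub true := h2
  rw [h1, h2]
  congr 1
  refine Piece.ext_sub fun b => ?_
  rw [Piece.sub_join]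
  cases b <;> rfl

theorem exists_split (hC : C.IsNice) {v : C.Vertex} {g : Piece} (hg : g ∈ pieces v) :
    ∃ w, Split hC g v w := by
  obtain ⟨l, hl⟩ := exists_hasList_cons hC hg
  obtain ⟨P, hP, rfl, h0, -⟩ := hl.cons
  exact ⟨_, _, P, hP, h0, rfl, rfl⟩

/-- The point is that the permutation below the transistor stays in the class: by `stab`, either the
given one is trivial, or all permutations are available. -/
theorem IsNice.exists_split_comm (hC : C.IsNice) {r : ℕ} {e : Fin (r + 1) ≃ Fin (r + 1)}
    (he : C.Mem (ofEquiv e)) (h0 : e 0 = 0) :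
    ∃ f : Fin (r + 2) ≃ Fin (r + 2), C.Mem (ofEquiv f) ∧
      Nonempty (Iso ((splitFirst r).concat (ofEquiv f)) ((ofEquiv e).concat (splitFirst r))) := by
  rcases hC.stab e he h0 with rfl | h
  · refine ⟨Equiv.refl _, hC.iso (ofEquivIso 1).symm C.one, ⟨(concatRefl _).trans ?_⟩⟩
    exact (Iso.oneConcat _).symm.trans ((ofEquivIso 1).symm.concat (Iso.refl _))
  · obtain ⟨f, hf⟩ := exists_iso_ofEquiv_split e h0
    exact ⟨f, h f, hf⟩

theorem IsNice.exists_merge_comm (hC : C.IsNice) {r : ℕ} {e : Fin (r + 2) ≃ Fin (r + 2)}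
    (he : C.Mem (ofEquiv e)) (h0 : e 0 = 0) (h1 : e 1 = 1) :
    ∃ f : Fin (r + 1) ≃ Fin (r + 1), C.Mem (ofEquiv f) ∧
      Nonempty (Iso ((mergeFirst r).concat (ofEquiv f)) ((ofEquiv e).concat (mergeFirst r))) := by
  rcases hC.stab e he h0 with rfl | h
  · refine ⟨Equiv.refl _, hC.iso (ofEquivIso 1).symm C.one, ⟨(concatRefl _).trans ?_⟩⟩
    exact (Iso.oneConcat _).symm.trans ((ofEquivIso 1).symm.concat (Iso.refl _))
  · obtain ⟨f, hf⟩ := exists_iso_ofEquiv_merge e h0 h1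
    exact ⟨f, h f, hf⟩

/-- The result of splitting a piece of a vertex is unique. -/
theorem Split.unique {hC : C.IsNice} {g : Piece} {v w w' : C.Vertex} (h : Split hC g v w)
    (h' : Split hC g v w') : w = w' := by
  obtain ⟨r, P, hP, h0, rfl, rfl⟩ := h
  obtain ⟨r', P', hP', h0', h, rfl⟩ := h'
  obtain ⟨e, he, hd⟩ := hC.vertex_eq_iff.1 h
  obtain rfl : r = r' := by simpa using Fintype.card_congr e
  have hout := hd.outs_eq ((C.isFinite hP).concat (ofEquiv_isFinite e))
  -- Both pictures carry `g` at the contact `0`. Since bottom labels are distinct, `e` fixes this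
  -- contact and passes below the transistor.
  have h2 := congrFun hout 0
  rw [h0', ← h0, outs_concat_ofEquiv (C.isFinite hP)] at h2
  have h3 := (isPartition_outs (C.isFinite hP)).injective h2
  obtain ⟨f, hf, ⟨i⟩⟩ := hC.exists_split_comm he (by rw [← Equiv.eq_symm_apply, h3])
  refine hC.vertex_eq_iff.2 ⟨f, hf, ?_⟩
  refine (DipoleEq.of_iso ((Iso.assoc _ _ _).trans (((Iso.refl P).concat i).trans
    (Iso.assoc _ _ _).symm))).trans ?_
  exact hd.concat (.refl _)

/-- A vertex is determined by the result of splitting one of its pieces. -/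
theorem Split.cancel {hC : C.IsNice} {g : Piece} {v v' w : C.Vertex} (h : Split hC g v w)
    (h' : Split hC g v' w) : v = v' := by
  obtain ⟨r, P, hP, h0, rfl, rfl⟩ := h
  obtain ⟨r', P', hP', h0', rfl, h⟩ := h'
  obtain ⟨e, he, hd⟩ := hC.vertex_eq_iff.1 h
  obtain rfl : r = r' := by simpa using Fintype.card_congr e
  have hS := (C.isFinite hP).concat (splitFirst_isFinite r)
  have hout := hd.outs_eq (hS.concat (ofEquiv_isFinite e))
  have hi := (isPartition_outs hS).injective
  -- The halves of `g` occupy the contacts `0` and `1` in both pictures, so `e` fixes these two. It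
  -- then passes below an (x², x)-transistor, which cancels the split on either side.
  have key : ∀ j : Fin (r + 2), (P.concat (splitFirst r)).outs j =
      (P'.concat (splitFirst r)).outs j → e j = j := by
    intro j hj
    rw [← hout, outs_concat_ofEquiv hS] at hj
    rw [← Equiv.eq_symm_apply]
    exact hi hj
  obtain ⟨f, hf, ⟨i⟩⟩ := hC.exists_merge_comm he
    (key 0 (by rw [outs_concat_split (C.isFinite hP), outs_concat_split (C.isFinite hP'), h0, h0']; rfl))
    (key 1 (by rw [outs_concat_split (C.isFinite hP), outs_concat_split (C.isFinite hP'), h0, h0']; rfl))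
  have h1 : DipoleEq (((P.concat (splitFirst r)).concat (ofEquiv e)).concat (mergeFirst r)) P' :=
    (hd.concat (.refl _)).trans (.concat_split_merge P')
  refine hC.vertex_eq_iff.2 ⟨f, hf, ?_⟩
  refine DipoleEq.trans ?_ h1
  refine ((DipoleEq.concat_split_merge P).symm.concat (.refl _)).trans (.of_iso ?_)
  exact (Iso.assoc _ _ _).trans (((Iso.refl _).concat i).trans (Iso.assoc _ _ _).symm)

end PictureClass

end DiagramProfile

namespace DiagramProfile

open Picture

/-! ### Elementary pictures -/

/-- The number of contacts on the top of a transistor: `false` stands for the type `(x, x²)`, and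
`true` for the type `(x², x)`. -/
def arity : Bool → ℕ
  | false => 1
  | true => 2

/-- A picture with one transistor, which is attached to the first wires. -/
def Picture.elementary : (b : Bool) → (r : ℕ) → Picture (r + arity b) (r + arity (!b))
  | false, r => splitFirst r
  | true, r => mergeFirst r

/-- A piece or its two halves: the labels above a transistor of the given type with label `h`. -/
def ends : Bool → Piece → List Piece
  | false, h => [h]
  | true, h => [h.sub false, h.sub true]

theorem length_ends (b : Bool) (h : Piece) : (ends b h).length = arity b := by cases b <;> rfl

theorem elementary_isFinite (b : Bool) (r : ℕ) : (elementary b r).IsFinite := by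
  cases b
  · exact splitFirst_isFinite r
  · exact mergeFirst_isFinite r

/-- The transistors of elementary pictures of the same type. -/
def elementaryS (b : Bool) (r r' : ℕ) : (elementary b r).S ≃ (elementary b r').S :=
  match b with
  | false => Equiv.refl Unit
  | true => Equiv.refl Empty

/-- The transistors of elementary pictures of the same type. -/
def elementaryM (b : Bool) (r r' : ℕ) : (elementary b r).M ≃ (elementary b r').M :=
  match b with
  | false => Equiv.refl Empty
  | true => Equiv.refl Unit

/-- The transistor of an elementary picture. -/
def elementaryT : (b : Bool) → (r : ℕ) → (elementary b r).Transistor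
  | false, _ => .inl ()
  | true, _ => .inr ()

theorem eq_elementaryT (b : Bool) (r : ℕ) (x : (elementary b r).Transistor) :
    x = elementaryT b r := by
  cases b
  · rcases x with ⟨⟩ | ⟨⟨⟩⟩
    rfl
  · rcases x with ⟨⟨⟩⟩ | ⟨⟩
    rfl

/-- The position of the contact depends only on the type of the transistor and not on the number of
other wires, which changes when two transistors are exchanged. -/
theorem elementary_symm_split (b : Bool) (r r' : ℕ) (s : (elementary b r).S) :
    ∃ i, ∃ hi : i < arity b, (elementary b r).wire.symm (.split s) = .frame ⟨i, by omega⟩ ∧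
      (elementary b r').wire.symm (.split (elementaryS b r r' s)) = .frame ⟨i, by omega⟩ := by
  cases b
  · exact ⟨0, one_pos, rfl, rfl⟩
  · exact Empty.elim s

theorem elementary_symm_merge (b : Bool) (r r' : ℕ) (t : (elementary b r).M) (c : Bool) :
    ∃ i, ∃ hi : i < arity b, (elementary b r).wire.symm (.merge t c) = .frame ⟨i, by omega⟩ ∧
      (elementary b r').wire.symm (.merge (elementaryM b r r' t) c) = .frame ⟨i, by omega⟩ := by
  cases b
  · exact Empty.elim t
  · cases c
    · exact ⟨0, two_pos, mergeFirst_symm_merge r false, mergeFirst_symm_merge r' false⟩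
    · exact ⟨1, one_lt_two, mergeFirst_symm_merge r true, mergeFirst_symm_merge r' true⟩

theorem ofFn_elementary {b : Bool} {r : ℕ} {P : Picture 1 (r + arity b)} (hP : P.IsFinite)
    {h : Piece} {l : List Piece} (hl : List.ofFn P.outs = ends b h ++ l) :
    List.ofFn (P.concat (elementary b r)).outs = ends (!b) h ++ l := by
  cases b
  · exact PictureClass.ofFn_split hP hl
  · exact PictureClass.ofFn_merge hP hl

theorem getElem_ofFn {n : ℕ} {a : Fin n → Piece} {l : List Piece} (h : List.ofFn a = l) (i : Fin n) :
    ∃ hi : (i : ℕ) < l.length, l[(i : ℕ)] = a i := by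
  subst h
  exact ⟨by simp, by simp⟩

/-- Labels whose images meet belong to the same wire. A half of a label that is again a label would
therefore be a half of itself, which fails at the constant sequence `!c`. So the labels created by a
transistor are new. -/
theorem disjoint_ends {n : ℕ} {a : Fin n → Piece} (ha : IsPartition a) {b : Bool} {h : Piece}
    {l : List Piece} (hl : List.ofFn a = ends b h ++ l) {f : Piece} (hf : f ∈ ends (!b) h)
    (i : Fin n) : f ≠ a i := by
  have key : ∀ c, ∀ i j, (a i).sub c ≠ a j := by
    intro c i j e
    have h1 := ha.eq_of_apply (c := cons c fun _ => !c) (d := fun _ => !c)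
      (congrFun e fun _ => !c)
    have h2 := congrFun h1.2 0
    cases c <;> simp [cons] at h2
  have hmem : ∀ g ∈ ends b h, ∃ j, a j = g := by
    intro g hg
    have : g ∈ List.ofFn a := by rw [hl]; exact List.mem_append_left _ hg
    rwa [List.mem_ofFn] at this
  rintro rfl
  cases b
  · obtain ⟨j, rfl⟩ := hmem h (by simp [ends])
    simp only [ends, Bool.not_false, List.mem_cons, List.not_mem_nil, or_false] at hf
    rcases hf with hf | hf
    · exact key _ _ _ hf.symm
    · exact key _ _ _ hf.symm
  · obtain ⟨j, hj⟩ := hmem (h.sub false) (by simp [ends])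
    simp only [ends, Bool.not_true, List.mem_cons, List.not_mem_nil, or_false] at hf
    subst hf
    exact key _ _ _ hj.symm

/-- Bottom labels are distinct, so a wire is recognised by its label: if the label is not one of the
new ones, the wire runs past the transistor. -/
theorem concat_splitFirst_symm {r : ℕ} {P : Picture 1 (r + 1)} (hP : P.IsFinite) {i j}
    (e : (P.concat (splitFirst r)).outs j = P.outs i)
    (hd : ∀ f ∈ ends true (P.outs 0), f ≠ P.outs i) :
    (P.concat (splitFirst r)).wire.symm (.frame j) =
      (P.wire.symm (.frame i)).map Sum.inl Sum.inl := by
  rw [outs_concat_split hP] at e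
  cases j using Fin.cases with
  | zero => exact absurd e (hd _ (by simp [ends]))
  | succ j =>
    cases j using Fin.cases with
    | zero => exact absurd e (hd _ (by simp [ends]))
    | succ j =>
      obtain rfl := (isPartition_outs hP).injective e
      rfl

theorem concat_mergeFirst_symm {r : ℕ} {P : Picture 1 (r + 2)} (hP : P.IsFinite) {i j}
    (e : (P.concat (mergeFirst r)).outs j = P.outs i)
    (hd : Piece.join (P.outs 0) (P.outs 1) ≠ P.outs i) :
    (P.concat (mergeFirst r)).wire.symm (.frame j) =
      (P.wire.symm (.frame i)).map Sum.inl Sum.inl := by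
  rw [outs_concat_merge hP] at e
  cases j using Fin.cases with
  | zero => exact absurd e hd
  | succ j =>
    obtain rfl := (isPartition_outs hP).injective e
    rfl

/-- A wire at the bottom of a picture that does not touch an elementary picture below it. -/
theorem concat_elementary_symm {b : Bool} {r : ℕ} {P : Picture 1 (r + arity b)} (hP : P.IsFinite)
    {h : Piece} {l : List Piece} (hl : List.ofFn P.outs = ends b h ++ l) {i j}
    (e : (P.concat (elementary b r)).outs j = P.outs i) :
    (P.concat (elementary b r)).wire.symm (.frame j) =
      (P.wire.symm (.frame i)).map Sum.inl Sum.inl := by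
  have hd := fun f hf => disjoint_ends (isPartition_outs hP) hl (f := f) hf i
  have hget := fun k => (getElem_ofFn hl k).2
  cases b
  · refine concat_splitFirst_symm hP e ?_
    have h0 : P.outs (0 : Fin (r + 1)) = h := (hget (0 : Fin (r + 1))).symm
    exact h0 ▸ hd
  · refine concat_mergeFirst_symm hP e ?_
    have h0 : P.outs (0 : Fin (r + 2)) = h.sub false := (hget (0 : Fin (r + 2))).symm
    have h1 : P.outs (1 : Fin (r + 2)) = h.sub true := (hget (1 : Fin (r + 2))).symm
    have h2 : Piece.join (P.outs (0 : Fin (r + 2))) (P.outs (1 : Fin (r + 2))) = h := by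
      rw [h0, h1]
      refine Piece.ext_sub fun b => ?_
      rw [Piece.sub_join]
      cases b <;> rfl
    exact fun e => hd h (by simp [ends]) (h2.symm.trans e)

/-- Two transistors of the types `b` and `b'` are attached to a picture in one order. -/
abbrev Picture.attachTwo {b b' : Bool} {r r' m : ℕ} (P : Picture 1 m)
    (e : Fin m ≃ Fin (r + arity b)) (e' : Fin (r + arity !b) ≃ Fin (r' + arity b')) :
    Picture 1 (r' + arity !b') :=
  (((P.concat (ofEquiv e)).concat (elementary b r)).concat (ofEquiv e')).concat (elementary b' r')

section Swap

variable {b b' : Bool} {m r r' s s' : ℕ} {P : Picture 1 m} {h h' : Piece}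
  {e₁ : Fin m ≃ Fin (r + arity b)} {e₁' : Fin (r + arity !b) ≃ Fin (r' + arity b')}
  {e₂ : Fin m ≃ Fin (s + arity b')} {e₂' : Fin (s + arity !b') ≃ Fin (s' + arity b)}
  {l₁ l₁' l₂ l₂' : List Piece}

/-- The top of the second of two independent transistors. -/
theorem attachTwo_symm (hP : P.IsFinite)
    (h₁ : List.ofFn (P.concat (ofEquiv e₁)).outs = ends b h ++ l₁)
    (h₁' : List.ofFn (((P.concat (ofEquiv e₁)).concat (elementary b r)).concat (ofEquiv e₁')).outs =
      ends b' h' ++ l₁')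
    (h₂ : List.ofFn (P.concat (ofEquiv e₂)).outs = ends b' h' ++ l₂) {i : ℕ} (hi : i < arity b') :
    (((P.concat (ofEquiv e₁)).concat (elementary b r)).concat (ofEquiv e₁')).wire.symm
        (.frame ⟨i, by omega⟩) =
      (P.wire.symm (.frame (e₂.symm ⟨i, by omega⟩))).map (Sum.inl ∘ Sum.inl ∘ Sum.inl)
        (Sum.inl ∘ Sum.inl ∘ Sum.inl) := by
  have hP1 := hP.concat (ofEquiv_isFinite e₁)
  have hP2 := hP1.concat (elementary_isFinite b r)
  obtain ⟨h3, h4⟩ := getElem_ofFn h₁' ⟨i, by omega⟩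
  obtain ⟨h5, h6⟩ := getElem_ofFn h₂ ⟨i, by omega⟩
  have hlen : i < (ends b' h').length := by rw [length_ends]; exact hi
  rw [List.getElem_append_left hlen] at h4 h6
  rw [outs_concat_ofEquiv hP] at h6
  obtain ⟨j, hj⟩ : ∃ j, e₁'.symm ⟨i, by omega⟩ = j := ⟨_, rfl⟩
  -- In both pictures the label of the wire in question is entry `i` of `ends b' h'`; hence the wire
  -- to the second transistor runs past the first one and comes from the same contact of `P`.
  have h7 : _ = ((P.concat (ofEquiv e₁)).concat (elementary b r)).outs (e₁'.symm ⟨i, by omega⟩) :=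
    h4.trans (congrFun (outs_concat_ofEquiv hP2 e₁') _)
  rw [hj] at h7
  rw [concat_ofEquiv_symm, hj]
  have h8 : (P.concat (ofEquiv e₁)).outs (e₁ (e₂.symm ⟨i, by omega⟩)) =
      P.outs (e₂.symm ⟨i, by omega⟩) := by
    rw [outs_concat_ofEquiv hP]
    exact congrArg P.outs (Equiv.symm_apply_apply _ _)
  rw [concat_elementary_symm hP1 h₁ (h7.symm.trans (h6.trans h8.symm)),
    concat_ofEquiv_symm, Equiv.symm_apply_apply]
  generalize P.wire.symm _ = p
  rcases p with _ | _ | _ <;> rfl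

/-- The identification of the transistors when two elementary pictures change places. -/
def swapEquiv {α β γ β' γ' : Type} (f : β ≃ β') (g : γ ≃ γ') :
    (((α ⊕ Empty) ⊕ β) ⊕ Empty) ⊕ γ ≃ (((α ⊕ Empty) ⊕ γ') ⊕ Empty) ⊕ β' where
  toFun
    | .inl (.inl (.inl (.inl a))) => .inl (.inl (.inl (.inl a)))
    | .inl (.inl (.inr x)) => .inr (f x)
    | .inr y => .inl (.inl (.inr (g y)))
  invFun
    | .inl (.inl (.inl (.inl a))) => .inl (.inl (.inl (.inl a)))
    | .inl (.inl (.inr x)) => .inr (g.symm x)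
    | .inr y => .inl (.inl (.inr (f.symm y)))
  left_inv := by rintro ((((a | ⟨⟨⟩⟩) | x) | ⟨⟨⟩⟩) | y) <;> simp
  right_inv := by rintro ((((a | ⟨⟨⟩⟩) | x) | ⟨⟨⟩⟩) | y) <;> simp

/-- The identification of the transistors when an elementary picture is inserted. -/
def swapInclusion {α β γ β' : Type} (f : β ≃ β') :
    (α ⊕ Empty) ⊕ β → (((α ⊕ Empty) ⊕ γ) ⊕ Empty) ⊕ β'
  | .inl (.inl a) => .inl (.inl (.inl (.inl a)))
  | .inr x => .inr (f x)

theorem swapInclusion_injective {α β γ β' : Type} (f : β ≃ β') :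
    Function.Injective (swapInclusion f : (α ⊕ Empty) ⊕ β → (((α ⊕ Empty) ⊕ γ) ⊕ Empty) ⊕ β') := by
  rintro ((x | ⟨⟨⟩⟩) | x) ((y | ⟨⟨⟩⟩) | y) hxy <;> simp_all [swapInclusion]

theorem range_swapInclusion {α β γ β' α₁ β₁ γ₁ β₁' : Type} (f : β ≃ β') (g : β₁ ≃ β₁')
    {T : γ ⊕ γ₁} (hT : ∀ x, x = T) :
    Set.range (Sum.map (swapInclusion f : (α ⊕ Empty) ⊕ β → _)
      (swapInclusion g : (α₁ ⊕ Empty) ⊕ β₁ → _)) =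
    {Sum.map (Sum.inl ∘ Sum.inl ∘ Sum.inr) (Sum.inl ∘ Sum.inl ∘ Sum.inr) T}ᶜ := by
  ext x
  simp only [Set.mem_compl_iff, Set.mem_singleton_iff, Set.mem_range]
  constructor
  · rintro ⟨((x | ⟨⟨⟩⟩) | x) | ((x | ⟨⟨⟩⟩) | x), rfl⟩ h <;> rcases T with y | y <;>
      simp [swapInclusion] at h
  · rcases x with ((((x | ⟨⟨⟩⟩) | x) | ⟨⟨⟩⟩) | x) | ((((x | ⟨⟨⟩⟩) | x) | ⟨⟨⟩⟩) | x)
    · exact fun _ => ⟨.inl (.inl (.inl x)), rfl⟩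
    · rw [← hT (.inl x)]
      exact fun hx => absurd rfl hx
    · exact fun _ => ⟨.inl (.inr (f.symm x)), by simp [swapInclusion]⟩
    · exact fun _ => ⟨.inr (.inl (.inl x)), rfl⟩
    · rw [← hT (.inr x)]
      exact fun hx => absurd rfl hx
    · exact fun _ => ⟨.inr (.inr (g.symm x)), by simp [swapInclusion]⟩

/-- Two independent transistors can be attached in any order. -/
theorem exists_iso_attachTwo (hP : P.IsFinite)
    (h₁ : List.ofFn (P.concat (ofEquiv e₁)).outs = ends b h ++ l₁)
    (h₁' : List.ofFn (((P.concat (ofEquiv e₁)).concat (elementary b r)).concat (ofEquiv e₁')).outs =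
      ends b' h' ++ l₁')
    (h₂ : List.ofFn (P.concat (ofEquiv e₂)).outs = ends b' h' ++ l₂)
    (h₂' : List.ofFn (((P.concat (ofEquiv e₂)).concat (elementary b' s)).concat (ofEquiv e₂')).outs =
      ends b h ++ l₂') :
    ∃ σ, Nonempty (Iso ((P.attachTwo e₁ e₁').concat (ofEquiv σ)) (P.attachTwo e₂ e₂')) := by
  refine exists_iso_concat_ofEquiv
    (swapEquiv (elementaryS b r s') (elementaryS b' r' s))
    (swapEquiv (elementaryM b r s') (elementaryM b' r' s)) ?_ ?_
  · rintro ((((x | ⟨⟨⟩⟩) | x) | ⟨⟨⟩⟩) | x)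
    · change (((((P.wire.symm (.split x)).map _ _).map _ _).map _ _).map _ _) =
        (((((P.wire.symm (.split x)).map _ _).map _ _).map _ _).map _ _).map _ _
      generalize P.wire.symm _ = p
      rcases p with _ | _ | _ <;> rfl
    -- One picture attaches this transistor directly to `P`, the other attaches it second.
    -- `attachTwo_symm` with the roles exchanged finds the same upper end for its wire.
    · obtain ⟨i, hi, hx, hx'⟩ := elementary_symm_split b r s' x
      change concatUp _ _ ((elementary b s').wire.symm (.split (elementaryS b r s' x))) =
        (((concatUp _ _ ((elementary b r).wire.symm (.split x))).map _ _).map _ _).map _ _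
      rw [hx, hx']
      change ((Picture.wire _).symm (.frame ⟨i, _⟩)).map _ _ =
        ((((((P.wire.symm (.frame (e₁.symm ⟨i, _⟩))).map _ _).map _ _).map _ _).map _ _).map _ _)
      rw [attachTwo_symm hP h₂ h₂' h₁ hi]
      generalize P.wire.symm _ = p
      rcases p with _ | _ | _ <;> rfl
    · obtain ⟨i, hi, hx, hx'⟩ := elementary_symm_split b' r' s x
      change (((concatUp _ _ ((elementary b' s).wire.symm
        (.split (elementaryS b' r' s x)))).map _ _).map _ _) =
        (concatUp _ _ ((elementary b' r').wire.symm (.split x))).map _ _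
      rw [hx, hx']
      change ((((P.wire.symm (.frame (e₂.symm ⟨i, _⟩))).map _ _).map _ _).map _ _).map _ _ =
        (((Picture.wire _).symm (.frame ⟨i, _⟩)).map _ _).map _ _
      rw [attachTwo_symm hP h₁ h₁' h₂ hi]
      generalize P.wire.symm _ = p
      rcases p with _ | _ | _ <;> rfl
  · rintro ((((x | ⟨⟨⟩⟩) | x) | ⟨⟨⟩⟩) | x) c
    · change (((((P.wire.symm (.merge x c)).map _ _).map _ _).map _ _).map _ _) =
        (((((P.wire.symm (.merge x c)).map _ _).map _ _).map _ _).map _ _).map _ _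
      generalize P.wire.symm _ = p
      rcases p with _ | _ | _ <;> rfl
    · obtain ⟨i, hi, hx, hx'⟩ := elementary_symm_merge b r s' x c
      change concatUp _ _ ((elementary b s').wire.symm (.merge (elementaryM b r s' x) c)) =
        (((concatUp _ _ ((elementary b r).wire.symm (.merge x c))).map _ _).map _ _).map _ _
      rw [hx, hx']
      change ((Picture.wire _).symm (.frame ⟨i, _⟩)).map _ _ =
        ((((((P.wire.symm (.frame (e₁.symm ⟨i, _⟩))).map _ _).map _ _).map _ _).map _ _).map _ _)
      rw [attachTwo_symm hP h₂ h₂' h₁ hi]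
      generalize P.wire.symm _ = p
      rcases p with _ | _ | _ <;> rfl
    · obtain ⟨i, hi, hx, hx'⟩ := elementary_symm_merge b' r' s x c
      change (((concatUp _ _ ((elementary b' s).wire.symm
        (.merge (elementaryM b' r' s x) c))).map _ _).map _ _) =
        (concatUp _ _ ((elementary b' r').wire.symm (.merge x c))).map _ _
      rw [hx, hx']
      change ((((P.wire.symm (.frame (e₂.symm ⟨i, _⟩))).map _ _).map _ _).map _ _).map _ _ =
        (((Picture.wire _).symm (.frame ⟨i, _⟩)).map _ _).map _ _
      rw [attachTwo_symm hP h₁ h₁' h₂ hi]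
      generalize P.wire.symm _ = p
      rcases p with _ | _ | _ <;> rfl

/-- The upper one of two independent transistors can be left off. -/
theorem isTruncation_attachTwo (hP : P.IsFinite)
    (h₁ : List.ofFn (P.concat (ofEquiv e₁)).outs = ends b h ++ l₁)
    (h₂ : List.ofFn (P.concat (ofEquiv e₂)).outs = ends b' h' ++ l₂)
    (h₂' : List.ofFn (((P.concat (ofEquiv e₂)).concat (elementary b' s)).concat (ofEquiv e₂')).outs =
      ends b h ++ l₂') :
    (P.attachTwo e₂ e₂').IsTruncation
      {Sum.map (Sum.inl ∘ Sum.inl ∘ Sum.inr) (Sum.inl ∘ Sum.inl ∘ Sum.inr) (elementaryT b' s)}ᶜ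
      ((P.concat (ofEquiv e₁)).concat (elementary b r)) := by
  have key : (P.attachTwo e₂ e₂').IsTruncation (Set.range (Sum.map
      (swapInclusion (γ := (elementary b' s).S) (elementaryS b r s'))
      (swapInclusion (γ := (elementary b' s).M) (elementaryM b r s'))))
      ((P.concat (ofEquiv e₁)).concat (elementary b r)) := by
    refine isTruncation_range ?_ ?_ (swapInclusion_injective _) (swapInclusion_injective _)
    · rintro ((x | ⟨⟨⟩⟩) | x)
      · change (((((P.wire.symm (.split x)).map _ _).map _ _).map _ _).map _ _) =
          (((P.wire.symm (.split x)).map _ _).map _ _).map _ _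
        generalize P.wire.symm _ = p
        rcases p with _ | _ | _ <;> rfl
      · obtain ⟨i, hi, hx, hx'⟩ := elementary_symm_split b r s' x
        change concatUp _ _ ((elementary b s').wire.symm (.split (elementaryS b r s' x))) =
          (concatUp _ _ ((elementary b r).wire.symm (.split x))).map _ _
        rw [hx, hx']
        change ((Picture.wire _).symm (.frame ⟨i, _⟩)).map _ _ =
          ((((P.wire.symm (.frame (e₁.symm ⟨i, _⟩))).map _ _).map _ _).map _ _)
        rw [attachTwo_symm hP h₂ h₂' h₁ hi]
        generalize P.wire.symm _ = p
        rcases p with _ | _ | _ <;> rfl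
    · rintro ((x | ⟨⟨⟩⟩) | x) c
      · change (((((P.wire.symm (.merge x c)).map _ _).map _ _).map _ _).map _ _) =
          (((P.wire.symm (.merge x c)).map _ _).map _ _).map _ _
        generalize P.wire.symm _ = p
        rcases p with _ | _ | _ <;> rfl
      · obtain ⟨i, hi, hx, hx'⟩ := elementary_symm_merge b r s' x c
        change concatUp _ _ ((elementary b s').wire.symm (.merge (elementaryM b r s' x) c)) =
          (concatUp _ _ ((elementary b r).wire.symm (.merge x c))).map _ _
        rw [hx, hx']
        change ((Picture.wire _).symm (.frame ⟨i, _⟩)).map _ _ =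
          ((((P.wire.symm (.frame (e₁.symm ⟨i, _⟩))).map _ _).map _ _).map _ _)
        rw [attachTwo_symm hP h₂ h₂' h₁ hi]
        generalize P.wire.symm _ = p
        rcases p with _ | _ | _ <;> rfl
  have hr := range_swapInclusion (α := P.S) (α₁ := P.M) (elementaryS b r s') (elementaryM b r s')
    (eq_elementaryT b' s)
  exact (congrArg (fun A => (P.attachTwo e₂ e₂').IsTruncation A
    ((P.concat (ofEquiv e₁)).concat (elementary b r))) hr).mp key

end Swap

end DiagramProfile

/-! ### Attaching transistors to vertices -/

namespace DiagramProfile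

open Picture

namespace PictureClass

variable {C : PictureClass}

theorem IsNice.elementary (hC : C.IsNice) (b : Bool) (r : ℕ) : C.Mem (elementary b r) := by
  cases b
  · exact hC.split r
  · exact hC.merge r

/-- The vertex `w` arises from the vertex `v` by attaching one transistor with label `h`. -/
def Attach (hC : C.IsNice) (b : Bool) (h : Piece) (v w : C.Vertex) : Prop :=
  ∃ (r : ℕ) (P : Picture 1 (r + arity b)) (hP : C.Mem P) (l : List Piece),
    List.ofFn P.outs = ends b h ++ l ∧ v = vertex P hP ∧
      w = vertex (P.concat (Picture.elementary b r)) (C.concat hP (hC.elementary b r))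

theorem attach_concat (hC : C.IsNice) {m r : ℕ} {P : Picture 1 m} (hP : C.Mem P) {b : Bool}
    {h : Piece} {l : List Piece} {e : Fin m ≃ Fin (r + arity b)} (he : C.Mem (ofEquiv e))
    (hl : List.ofFn (P.concat (ofEquiv e)).outs = ends b h ++ l) :
    Attach hC b h (vertex P hP) (vertex ((P.concat (ofEquiv e)).concat (Picture.elementary b r))
      (C.concat (C.concat hP he) (hC.elementary b r))) :=
  ⟨r, _, C.concat hP he, l, hl, (vertex_concat_ofEquiv he).symm, rfl⟩

theorem attach_false {hC : C.IsNice} {h : Piece} {v w : C.Vertex} :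
    Attach hC false h v w ↔ Split hC h v w := by
  constructor
  · rintro ⟨r, P, hP, l, hl, rfl, rfl⟩
    exact ⟨r, P, hP, ((getElem_ofFn hl (0 : Fin (r + 1))).2).symm, rfl, rfl⟩
  · rintro ⟨r, P, hP, rfl, rfl, rfl⟩
    exact ⟨r, P, hP, _, List.ofFn_succ, rfl, rfl⟩

/-- A merge and a split on the same wires form a dipole, so merging is the inverse of splitting.
Hence edges of both types can be studied through `Split` alone. -/
theorem attach_true {hC : C.IsNice} {h : Piece} {v w : C.Vertex} :
    Attach hC true h v w ↔ Split hC h w v := by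
  constructor
  · rintro ⟨r, P, hP, l, hl, rfl, rfl⟩
    refine ⟨r, P.concat (mergeFirst r), C.concat hP (hC.merge r), ?_, rfl, ?_⟩
    · exact (getElem_ofFn (ofFn_merge (C.isFinite hP) hl) (0 : Fin (r + 1))).2.symm
    · exact (vertex_eq_of_dipoleEq (DipoleEq.concat_merge_split P)).symm
  · rintro ⟨r, P, hP, rfl, rfl, rfl⟩
    refine ⟨r, P.concat (splitFirst r), C.concat hP (hC.split r), _,
      ofFn_split (C.isFinite hP) List.ofFn_succ, rfl, ?_⟩
    exact (vertex_eq_of_dipoleEq (DipoleEq.concat_split_merge P)).symm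

/-- The wires needed by a transistor are consecutive, so a rotation suffices to bring them to the
front. -/
theorem IsNice.exists_front (hC : C.IsNice) {m : ℕ} {P : Picture 1 m} (hP : C.Mem P) {b : Bool}
    {h : Piece} {l l' : List Piece} (hl : List.ofFn P.outs = l ++ (ends b h ++ l')) :
    ∃ (r : ℕ) (e : Fin m ≃ Fin (r + arity b)), C.Mem (ofEquiv e) ∧
      List.ofFn (P.concat (ofEquiv e)).outs = ends b h ++ (l' ++ l) := by
  have hm : m = (l'.length + l.length) + arity b := by
    have := congrArg List.length hl
    simp only [List.length_ofFn, List.length_append, length_ends] at this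
    omega
  refine ⟨_, DiagramProfile.rotation hm (ends b h ++ l').length, hC.rotation hm _, ?_⟩
  rw [ofFn_rotate hP hl hm, List.append_assoc]

/-- Two transistors can be attached to different wires in any order. -/
theorem IsNice.exists_attachTwo (hC : C.IsNice) {m : ℕ} {P : Picture 1 m} (hP : C.Mem P)
    {b b' : Bool} {h h' : Piece} {l l' : List Piece}
    (hl : List.ofFn P.outs = ends b h ++ (l ++ (ends b' h' ++ l'))) :
    ∃ (r r' s s' : ℕ) (e₁ : Fin m ≃ Fin (r + arity b))
      (e₁' : Fin (r + arity !b) ≃ Fin (r' + arity b')) (e₂ : Fin m ≃ Fin (s + arity b'))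
      (e₂' : Fin (s + arity !b') ≃ Fin (s' + arity b)) (l₁ l₁' l₂ l₂' : List Piece),
      C.Mem (ofEquiv e₁) ∧ C.Mem (ofEquiv e₁') ∧ C.Mem (ofEquiv e₂) ∧ C.Mem (ofEquiv e₂') ∧
      List.ofFn (P.concat (ofEquiv e₁)).outs = ends b h ++ l₁ ∧
      List.ofFn (((P.concat (ofEquiv e₁)).concat (Picture.elementary b r)).concat
        (ofEquiv e₁')).outs = ends b' h' ++ l₁' ∧
      List.ofFn (P.concat (ofEquiv e₂)).outs = ends b' h' ++ l₂ ∧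
      List.ofFn (((P.concat (ofEquiv e₂)).concat (Picture.elementary b' s)).concat
        (ofEquiv e₂')).outs = ends b h ++ l₂' ∧
      ∃ σ, C.Mem (ofEquiv σ) ∧
        Nonempty (Iso ((P.attachTwo e₁ e₁').concat (ofEquiv σ)) (P.attachTwo e₂ e₂')) := by
  obtain ⟨r, e₁, he₁, h₁⟩ := hC.exists_front hP (l := []) hl
  have hl2 : List.ofFn P.outs = (ends b h ++ l) ++ (ends b' h' ++ l') := by rw [hl]; simp
  obtain ⟨s, e₂, he₂, h₂⟩ := hC.exists_front hP hl2
  have hP₁ := C.concat hP he₁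
  have hP₂ := C.concat hP he₂
  have h₃ := ofFn_elementary (C.isFinite hP₁) h₁
  have h₄ := ofFn_elementary (C.isFinite hP₂) h₂
  have hE₁ := C.concat hP₁ (hC.elementary b r)
  have hE₂ := C.concat hP₂ (hC.elementary b' s)
  rw [show ends (!b) h ++ (l ++ (ends b' h' ++ l') ++ []) =
    (ends (!b) h ++ l) ++ (ends b' h' ++ l') by simp] at h₃
  rw [show ends (!b') h' ++ (l' ++ (ends b h ++ l)) =
    (ends (!b') h' ++ l') ++ (ends b h ++ l) by simp] at h₄
  obtain ⟨r', e₁', he₁', h₁'⟩ := hC.exists_front hE₁ h₃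
  obtain ⟨s', e₂', he₂', h₂'⟩ := hC.exists_front hE₂ h₄
  obtain ⟨σ, ⟨i⟩⟩ := exists_iso_attachTwo (C.isFinite hP) h₁ h₁' h₂ h₂'
  refine ⟨r, r', s, s', e₁, e₁', e₂, e₂', _, _, _, _, he₁, he₁', he₂, he₂', h₁, h₁', h₂, h₂',
    σ, ?_, ⟨i⟩⟩
  have hX := C.concat (C.concat hE₁ he₁') (hC.elementary b' r')
  have h₅ := ofFn_elementary (C.isFinite (C.concat hE₁ he₁')) h₁'
  have h₆ := ofFn_elementary (C.isFinite (C.concat hE₂ he₂')) h₂'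
  rw [show ends (!b') h' ++ (l' ++ (ends (!b) h ++ l)) =
    (ends (!b') h' ++ l') ++ (ends (!b) h ++ l) by simp] at h₅
  rw [show ends (!b) h ++ (l ++ (ends (!b') h' ++ l')) =
    (ends (!b) h ++ l) ++ (ends (!b') h' ++ l') by simp] at h₆
  have h₇ : (P.attachTwo e₂ e₂').outs = fun j => (P.attachTwo e₁ e₁').outs (σ.symm j) := by
    rw [← outs_concat_ofEquiv (C.isFinite hX)]
    exact ((DipoleEq.of_iso i).outs_eq ((C.isFinite hX).concat (ofEquiv_isFinite σ))).symm
  -- The exchange of the two transistors yields only some permutation `σ`. The lists of bottom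
  -- labels of the two pictures are rotations of each other and have no repetitions, so `σ` is a
  -- rotation and belongs to the class.
  refine hC.annular (IsRotation.isAnnular (isRotation_of_ofFn
    (isPartition_outs (C.isFinite hX)).injective h₅ σ ?_))
  rw [← h₇]
  exact h₆

/-- Different pieces of a vertex can be split in any order. -/
theorem exists_diamond {hC : C.IsNice} {v v₁ v₂ : C.Vertex} {g k : Piece} (hg : Split hC g v v₁)
    (hk : Split hC k v v₂) (hgk : g ≠ k) : ∃ v₃, Split hC k v₁ v₃ ∧ Split hC g v₂ v₃ := by
  obtain ⟨l, hl⟩ := exists_hasList_cons hC hg.halved.1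
  have hk' := hl.mem_iff.2 hk.halved.1
  obtain ⟨l1, l2, rfl⟩ := List.append_of_mem ((List.mem_cons.1 hk').resolve_left hgk.symm)
  obtain ⟨n, P, hP, rfl, h⟩ := hl
  obtain ⟨r, r', s, s', e₁, e₁', e₂, e₂', l₁, l₁', l₂, l₂', he₁, he₁', he₂, he₂', h₁, h₁', h₂, h₂',
    σ, hσ, ⟨i⟩⟩ := hC.exists_attachTwo hP (b := false) (b' := false) (h := g) (h' := k) (l := l1)
      (l' := l2) h
  have a₁ := attach_concat hC hP he₁ h₁
  have a₂ := attach_concat hC hP he₂ h₂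
  have a₃ := attach_concat hC (C.concat (C.concat hP he₁) (hC.elementary false r)) he₁' h₁'
  have a₄ := attach_concat hC (C.concat (C.concat hP he₂) (hC.elementary false s)) he₂' h₂'
  rw [attach_false] at a₁ a₂ a₃ a₄
  rw [a₁.unique hg] at a₃
  rw [a₂.unique hk] at a₄
  refine ⟨_, a₃, ?_⟩
  convert a₄ using 1
  rw [← vertex_concat_ofEquiv hσ]
  exact vertex_eq_of_dipoleEq (.of_iso i)

/-! ### Chains of splits -/

/-- A piece with the property `A` is split. -/
def Step (hC : C.IsNice) (A : Piece → Prop) (v w : C.Vertex) : Prop := ∃ g, A g ∧ Split hC g v w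

theorem mem_of_split {hC : C.IsNice} {g f : Piece} {v w : C.Vertex} (h : Split hC g v w) :
    f ∈ pieces w ↔ (f ∈ pieces v ∧ f ≠ g) ∨ f = g.sub false ∨ f = g.sub true := by
  rw [h.halved.2]
  rfl

/-- A piece survives or is divided in a chain of splits. -/
theorem exists_descendant {hC : C.IsNice} {A : Piece → Prop} {v w : C.Vertex}
    (h : Relation.ReflTransGen (Step hC A) v w) {f : Piece} (hf : f ∈ pieces v) :
    ∃ u, f ∘ pre u ∈ pieces w := by
  induction h using Relation.ReflTransGen.head_induction_on generalizing f with
  | refl => exact ⟨[], hf⟩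
  | @head v x h _ ih =>
    obtain ⟨g, -, hg⟩ := h
    by_cases hfg : f = g
    · subst hfg
      obtain ⟨u, hu⟩ := ih ((mem_of_split hg).2 (.inr (.inl rfl)))
      exact ⟨u ++ [false], by rwa [← sub_comp_pre]⟩
    · exact ih ((mem_of_split hg).2 (.inl ⟨hf, hfg⟩))

/-- The chain of splits follows the cutting tree of `f`. The other pieces of `v` survive because no
half of `f` is among them. -/
theorem exists_chain_of_cuts (hC : C.IsNice) {T A : Piece → Prop} {f : Piece} (h : Cuts T A f) :
    ∀ v : C.Vertex, f ∈ pieces v → ∃ w, Relation.ReflTransGen (Step hC A) v w ∧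
      pieces v \ {f} ⊆ pieces w ∧ ∀ k ∈ pieces w, k ∈ pieces v \ {f} ∨ T k := by
  induction h with
  | @leaf f h =>
    refine fun v hf => ⟨v, .refl, Set.sdiff_subset, fun k hk => ?_⟩
    by_cases hkf : k = f
    · exact .inr (hkf ▸ h)
    · exact .inl ⟨hk, hkf⟩
  | @node f hA _ _ ih0 ih1 =>
    intro v hf
    obtain ⟨v1, h1⟩ := exists_split hC hf
    have hm := fun k => mem_of_split (f := k) h1
    obtain ⟨v2, c2, s2, d2⟩ := ih0 v1 ((hm _).2 (.inr (.inl rfl)))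
    obtain ⟨v3, c3, s3, d3⟩ := ih1 v2 (s2 ⟨(hm _).2 (.inr (.inr rfl)), (sub_ne hf).symm⟩)
    refine ⟨v3, .head ⟨f, hA, h1⟩ (c2.trans c3), ?_, ?_⟩
    · rintro k ⟨hk, hkf⟩
      exact s3 ⟨s2 ⟨(hm k).2 (.inl ⟨hk, hkf⟩), fun e => sub_notMem hf _ (e ▸ hk : f.sub false ∈ _)⟩,
        fun e => sub_notMem hf _ (e ▸ hk : f.sub true ∈ _)⟩
    · intro k hk
      rcases d3 k hk with ⟨hk, hk1⟩ | h
      · rcases d2 k hk with ⟨hk, hk0⟩ | h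
        · rcases (hm k).1 hk with h | h | h
          · exact .inl h
          · exact absurd h hk0
          · exact absurd h hk1
        · exact .inr h
      · exact .inr h

theorem exists_chain (hC : C.IsNice) {T A : Piece → Prop} {K : Set Piece} {v : C.Vertex}
    (hK : K ⊆ pieces v) (h : ∀ f ∈ pieces v, f ∉ K → Cuts T A f) :
    ∃ w, Relation.ReflTransGen (Step hC A) v w ∧ K ⊆ pieces w ∧ ∀ k ∈ pieces w, k ∈ K ∨ T k := by
  -- `B` contains all pieces that may still have to be cut; it shrinks while the vertex changes, so
  -- it need not consist of pieces of the current vertex.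
  have key : ∀ B : Set Piece, B.Finite → (∀ f ∈ B, f ∉ K → Cuts T A f) → ∀ v : C.Vertex,
      K ⊆ pieces v → (∀ f ∈ pieces v, f ∈ B ∨ f ∈ K ∨ T f) →
      ∃ w, Relation.ReflTransGen (Step hC A) v w ∧ K ⊆ pieces w ∧
        ∀ k ∈ pieces w, k ∈ K ∨ T k := by
    intro B hB
    induction B, hB using Set.Finite.induction_on with
    | empty => exact fun _ v hK h => ⟨v, .refl, hK, fun k hk => (h k hk).resolve_left id⟩
    | @insert f B _ _ ih =>
      intro hB v hK h
      by_cases hf : f ∈ pieces v ∧ f ∉ K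
      · obtain ⟨w, c, s, d⟩ := exists_chain_of_cuts hC (hB f (Set.mem_insert _ _) hf.2) v hf.1
        obtain ⟨x, c', h'⟩ := ih (fun k hk => hB k (.inr hk)) w
          (fun k hk => s ⟨hK hk, fun e => hf.2 (e ▸ hk)⟩) fun k hk => by
            rcases d k hk with ⟨hk, hkf⟩ | hk
            · exact (h k hk).imp_left fun h => h.resolve_left hkf
            · exact .inr (.inr hk)
        exact ⟨x, c.trans c', h'⟩
      · refine ih (fun k hk => hB k (.inr hk)) v hK fun k hk => ?_
        rcases h k hk with (rfl | h) | h
        · exact .inr (.inl (by by_contra h; exact hf ⟨hk, h⟩))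
        · exact .inl h
        · exact .inr h
  exact key _ (pieces_finite v) h v hK fun f hf => .inl hf

/-- All pieces outside `K` can be cut into words of the same length. -/
theorem exists_chain_words (hC : C.IsNice) {K : Set Piece} {v : C.Vertex} (hK : K ⊆ pieces v) :
    ∃ N₀, ∀ N, N₀ ≤ N → ∃ w, Relation.ReflTransGen (Step hC fun g => g ∉ K) v w ∧ K ⊆ pieces w ∧
      ∀ k ∈ pieces w, k ∈ K ∨ IsWordOf N k := by
  have : ∀ f : pieces v, ∃ N₀, ∀ N, N₀ ≤ N → ∀ A : Piece → Prop,
    (∀ u, A (f.1 ∘ pre u)) → Cuts (IsWordOf N) A f.1 := fun f => (pieces_tame f.2).cuts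
  choose c hc using this
  have := (pieces_finite v).to_subtype
  obtain ⟨N₀, hN₀⟩ := (Set.finite_range c).bddAbove
  refine ⟨N₀, fun N hN => exists_chain hC hK fun f hf hfK => ?_⟩
  -- A restriction of `f` that lies in `K` is a piece of `v`, hence is `f` itself, which was assumed
  -- to lie outside `K`.
  refine hc ⟨f, hf⟩ N ((hN₀ ⟨_, rfl⟩).trans hN) _ fun u hu => hfK ?_
  have := pieces_eq_of_comp_pre (hK hu) hf (u := []) (w := u) rfl
  rwa [this.1] at hu

/-- A split can be moved to the front of a chain that leads to words of the same length. -/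
theorem chain_of_split {hC : C.IsNice} {N : ℕ} {v t : C.Vertex}
    (h : Relation.ReflTransGen (Step hC fun _ => True) v t) (ht : ∀ k ∈ pieces t, IsWordOf N k) {k : Piece}
    (hk : ¬ IsWordOf N k) {v' : C.Vertex} (hv : Split hC k v v') :
    Relation.ReflTransGen (Step hC fun _ => True) v' t := by
  induction h using Relation.ReflTransGen.head_induction_on generalizing v' with
  | refl => exact absurd (ht k hv.halved.1) hk
  | @head v x h h' ih =>
    obtain ⟨g, -, hg⟩ := h
    by_cases hgk : g = k
    · subst hgk
      rwa [hv.unique hg]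
    -- Both orders of splitting `g` and `k` end in `y`; by induction `y` still leads to `t`, and `y`
    -- arises from `v'` by splitting `g`.
    · obtain ⟨y, hy, hy'⟩ := exists_diamond hg hv hgk
      exact .head ⟨g, trivial, hy'⟩ (ih hy)

theorem IsWordOf.eq {N N' : ℕ} {f : Piece} {u : List Bool} (h : IsWordOf N f)
    (h' : IsWordOf N' (f ∘ pre u)) : N' = u.length + N := by
  obtain ⟨w, rfl, rfl⟩ := h
  obtain ⟨w', rfl, h⟩ := h'
  rw [← pre_append] at h
  rw [← pre_inj h, List.length_append]

/-- A vertex reached from the base vertex all of whose pieces are words of length `N`. -/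
theorem exists_flat (hC : C.IsNice) (N : ℕ) : ∃ t, Relation.ReflTransGen (Step hC fun _ => True) C.base t ∧
    ∀ k ∈ pieces t, IsWordOf N k := by
  obtain ⟨w, h, -, h'⟩ := exists_chain_of_cuts hC (T := IsWordOf N) (A := fun _ => True)
    (cuts_pre N [] (by simp) fun _ => trivial) C.base (by rw [pieces_base]; rfl)
  refine ⟨w, h, fun k hk => (h' k hk).resolve_left ?_⟩
  rw [pieces_base]
  simp

/-- The proof follows the construction of a representative of `v` from the identity picture. A new
split is moved to the front of the chain already known and dropped there. A new merge is undone by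
one additional split at the start of the chain. -/
theorem exists_chain_flat (hC : C.IsNice) (v : C.Vertex) : ∃ N₀, ∀ N, N₀ ≤ N → ∀ t,
    Relation.ReflTransGen (Step hC fun _ => True) C.base t → (∀ k ∈ pieces t, IsWordOf N k) →
    Relation.ReflTransGen (Step hC fun _ => True) v t := by
  obtain ⟨n, P, hP, rfl⟩ := exists_rep v
  refine hC.induction (Φ := fun n P => ∀ hP : C.Mem P, ∃ N₀, ∀ N, N₀ ≤ N → ∀ t,
    Relation.ReflTransGen (Step hC fun _ => True) C.base t → (∀ k ∈ pieces t, IsWordOf N k) →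
    Relation.ReflTransGen (Step hC fun _ => True) (C.vertex P hP) t) ?_ ?_ ?_ ?_ ?_ P hP hP
  · rintro m P Q ⟨e⟩ hP ih hQ
    rw [← vertex_eq_of_dipoleEq (hP := hP) (.of_iso e)]
    exact ih hP
  · exact fun hP => ⟨0, fun N _ t h _ => h⟩
  · intro m m' P e hP he ih h
    rw [vertex_concat_ofEquiv (hP := hP) he]
    exact ih hP
  · intro r P hP ih h
    obtain ⟨N₀, hN₀⟩ := ih hP
    have hs : Split hC (P.outs 0) (C.vertex P hP) (C.vertex _ h) := ⟨r, P, hP, rfl, rfl, rfl⟩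
    by_cases hw : ∃ M, IsWordOf M (P.outs 0)
    · obtain ⟨M, hM⟩ := hw
      -- If the split piece is a word of length `M`, it must not be one of the final words, so `N`
      -- has to exceed `M`.
      refine ⟨max N₀ (M + 1), fun N hN t h1 h2 => chain_of_split
        (hN₀ N ((le_max_left _ _).trans hN) t h1 h2) h2 (fun h3 => ?_) hs⟩
      have := IsWordOf.eq (u := []) hM h3
      have := (le_max_right _ _).trans hN
      simp at *
      omega
    · exact ⟨N₀, fun N hN t h1 h2 => chain_of_split (hN₀ N hN t h1 h2) h2
        (fun h3 => hw ⟨N, h3⟩) hs⟩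
  · intro r P hP ih h
    obtain ⟨N₀, hN₀⟩ := ih hP
    refine ⟨N₀, fun N hN t h1 h2 => .head ⟨_, trivial, r, _, h, rfl, rfl, ?_⟩ (hN₀ N hN t h1 h2)⟩
    exact (vertex_eq_of_dipoleEq (DipoleEq.concat_merge_split P)).symm

/-- A vertex is determined by its pieces. -/
theorem eq_of_pieces_eq (hC : C.IsNice) {v w : C.Vertex} (h : pieces v = pieces w) : v = w := by
  obtain ⟨N₁, h₁⟩ := exists_chain_flat hC v
  obtain ⟨N₂, h₂⟩ := exists_chain_flat hC w
  -- Both vertices can be split down to the same flat vertex `t`; the induction runs along the chain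
  -- from `v`.
  obtain ⟨t, ht, htN⟩ := exists_flat hC (max N₁ N₂)
  have c₁ := h₁ _ (le_max_left _ _) t ht htN
  have c₂ := h₂ _ (le_max_right _ _) t ht htN
  clear h₁ h₂
  induction c₁ using Relation.ReflTransGen.head_induction_on generalizing w with
  | refl =>
    rcases c₂.cases_head with rfl | ⟨x, ⟨g, -, hg⟩, hx⟩
    · rfl
    -- A further split of `w` would leave in the final vertex a proper restriction of one of its own
    -- pieces.
    · obtain ⟨u, hu⟩ := exists_descendant hx ((mem_of_split hg).2 (.inr (.inl rfl)))
      rw [sub_comp_pre, h] at hu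
      have := pieces_eq_of_comp_pre hu hg.halved.1 (u := []) rfl
      simp at this
  | @head v x hv hx ih =>
    obtain ⟨g, -, hg⟩ := hv
    obtain ⟨y, hy⟩ := exists_split hC (h ▸ hg.halved.1 : g ∈ pieces w)
    have hxy : pieces x = pieces y := by rw [hg.halved.2, hy.halved.2, h]
    -- A proper restriction of `g` survives in `t` as a word of the final length, so `g` itself does
    -- not have that length.
    have hgN : ¬ IsWordOf (max N₁ N₂) g := by
      intro hgN
      obtain ⟨u, hu⟩ := exists_descendant hx ((mem_of_split hg).2 (.inr (.inl rfl)))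
      rw [sub_comp_pre] at hu
      have := IsWordOf.eq hgN (htN _ hu)
      simp at this
    -- Splitting `g` on both sides keeps the sets of pieces equal, so the induction identifies the
    -- results, and then the split is cancelled.
    obtain rfl := ih hxy (chain_of_split c₂ htN hgN hy)
    exact hg.cancel hy

end PictureClass

end DiagramProfile

/-! ### Normal pictures: reducedness expressed by labels -/

namespace DiagramProfile

namespace Picture

variable {n m k : ℕ}

/-- The picture carries labels `a` at the top of the frame, labels `o` at its bottom, words above
its `(x, x²)`-transistors, and labels that are not words below its `(x², x)`-transistors. -/
def IsNormal (P : Picture n m) (a : Fin n → Piece) (o : Fin m → Piece) : Prop :=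
  ∃ φ, P.IsLabelling a φ ∧ (∀ j, φ (P.wire.symm (.frame j)) = o j) ∧
    (∀ s, IsWord (φ (P.wire.symm (.split s)))) ∧ ∀ t, ¬ IsWord (φ (.merge t))

/-- In a dipole of either kind the label above the (x, x²)-transistor equals the label below the
(x², x)-transistor, so it would be both a word and not a word. -/
theorem IsNormal.isReduced {P : Picture n m} {a o} (h : P.IsNormal a o) : P.IsReduced := by
  obtain ⟨φ, h1, -, h3, h4⟩ := h
  refine fun s t => ⟨fun h => h4 t ?_, fun h => h4 t ?_⟩
  · have : φ (.merge t) = φ (P.wire.symm (.split s)) := by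
      refine Piece.ext_sub fun b => ?_
      rw [h1.merge, ← h1.split, ← h b, Equiv.symm_apply_apply]
    rw [this]
    exact h3 s
  · have := h3 s
    rwa [← h, Equiv.symm_apply_apply] at this

theorem IsNormal.concat {P : Picture n k} {Q : Picture k m} {a : Fin n → Piece}
    {b : Fin k → Piece} {c : Fin m → Piece} (hP : P.IsNormal a b) (hQ : Q.IsNormal b c) :
    (P.concat Q).IsNormal a c := by
  obtain ⟨φ, hφ, hb, h3, h4⟩ := hP
  obtain ⟨ψ, hψ, hc, h5, h6⟩ := hQ
  let χ : Source n (P.S ⊕ Q.S) (P.M ⊕ Q.M) → Piece := fun p => match p with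
    | .frame i => φ (.frame i)
    | .split (.inl s) b => φ (.split s b)
    | .split (.inr s) b => ψ (.split s b)
    | .merge (.inl t) => φ (.merge t)
    | .merge (.inr t) => ψ (.merge t)
  have h1 : ∀ p : Source n P.S P.M, χ (p.map Sum.inl Sum.inl) = φ p := by
    rintro (_ | _ | _) <;> rfl
  have h2 : ∀ p : Source k Q.S Q.M, χ (concatUp P Q p) = ψ p := by
    rintro (j | _ | _)
    · exact (h1 _).trans ((hb j).trans (hψ.frame j).symm)
    · rfl
    · rfl
  refine ⟨χ, ⟨hφ.frame, ?_, ?_⟩, fun j => (h2 _).trans (hc j), ?_, ?_⟩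
  · rintro (s | s) b
    · exact (hφ.split s b).trans (congrArg (Piece.sub · b) (h1 _).symm)
    · exact (hψ.split s b).trans (congrArg (Piece.sub · b) (h2 _).symm)
  · rintro (t | t) b
    · exact (hφ.merge t b).trans (h1 _).symm
    · exact (hψ.merge t b).trans (h2 _).symm
  · rintro (s | s)
    · exact (congrArg IsWord (h1 _)).mpr (h3 s)
    · exact (congrArg IsWord (h2 _)).mpr (h5 s)
  · rintro (t | t)
    · exact h4 t
    · exact h6 t

theorem isNormal_ofEquiv (e : Fin n ≃ Fin m) (a : Fin n → Piece) :
    (ofEquiv e).IsNormal a (fun j => a (e.symm j)) := by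
  obtain ⟨φ, h1, h2⟩ := yields_ofEquiv e a
  exact ⟨φ, h1, h2, fun s => Empty.elim s, fun t => Empty.elim t⟩

theorem isNormal_ofPerm (σ : Equiv.Perm (Fin n)) (a : Fin n → Piece) :
    (ofPerm σ).IsNormal a (fun j => a (σ.symm j)) := by
  obtain ⟨φ, h1, h2⟩ := yields_ofPerm σ a
  exact ⟨φ, h1, h2, fun s => Empty.elim s, fun t => Empty.elim t⟩

theorem isNormal_elementary {b : Bool} {r : ℕ} {a : Fin (r + arity b) → Piece} {h : Piece}
    {l : List Piece} (ha : List.ofFn a = ends b h ++ l) (hb : b = false ↔ IsWord h) :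
    (elementary b r).IsNormal a ((elementary b r).out a) := by
  obtain ⟨φ, h1, h2⟩ := (elementary_isFinite b r).yields_out a
  refine ⟨φ, h1, h2, ?_, ?_⟩
  · cases b
    · intro s
      have h3 : φ ((splitFirst r).wire.symm (.split s)) = h :=
        (h1.frame (0 : Fin (r + 1))).trans (getElem_ofFn ha (0 : Fin (r + 1))).2.symm
      exact (congrArg IsWord h3).mpr (hb.1 rfl)
    · exact fun s => Empty.elim s
  · cases b
    · exact fun s => Empty.elim s
    · intro t
      have h3 : φ (.merge t) = h := by
        refine Piece.ext_sub fun c => ?_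
        have h4 := h1.merge t c
        have h5 := mergeFirst_symm_merge r c
        have h6 : φ ((elementary true r).wire.symm (.merge t c)) = h.sub c := by
          refine (congrArg φ h5).trans ((h1.frame _).trans ?_)
          cases c
          · exact (getElem_ofFn ha (0 : Fin (r + 2))).2.symm
          · exact (getElem_ofFn ha (1 : Fin (r + 2))).2.symm
        exact h4.trans h6
      rw [h3]
      exact fun h => by simpa using hb.2 h

theorem sub_injective_of_isWord {f g : Piece} (hf : IsWord f) (hg : IsWord g) {b c : Bool}
    (h : f.sub b = g.sub c) : f = g ∧ b = c := by
  obtain ⟨u, rfl⟩ := hf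
  obtain ⟨w, rfl⟩ := hg
  have := pre_inj (u := b :: u) (w := c :: w) h
  simp_all

/-- In a reduced picture the labels above the `(x, x²)`-transistors are words, and the
labels below the `(x², x)`-transistors are not. -/
theorem IsReduced.isNormal {P : Picture 1 m} (hP : P.IsFinite) (h : P.IsReduced) :
    P.IsNormal (fun _ => id) P.outs := by
  obtain ⟨φ, h1, h2⟩ := hP.yields_out fun _ => id
  -- Induction from the top. Above an (x, x²)-transistor the wire cannot come from an (x²,
  -- x)-transistor, as that would be a dipole; so its label is the identity or a half of a word.
  have key : ∀ x : P.Transistor, (∀ s, x = .inl s → IsWord (φ (P.wire.symm (.split s)))) ∧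
      (∀ t, x = .inr t → ¬ IsWord (φ (.merge t))) := by
    intro x
    induction x using (wellFounded_lt hP).induction with
    | _ x ih =>
      have habove : ∀ (q : Sink m P.S P.M) y, q.transistor = some x →
          (P.wire.symm q).transistor = some y → P.Lt y x := by
        intro q y hq hy
        exact .single ⟨_, hy, by rw [Equiv.apply_symm_apply]; exact hq⟩
      refine ⟨?_, ?_⟩
      · rintro s rfl
        rcases hs : P.wire.symm (.split s) with i | ⟨s', b⟩ | t
        · rw [h1.frame]
          exact ⟨[], rfl⟩
        · rw [h1.split]
          exact ((ih (.inl s') (habove (.split s) _ rfl (by rw [hs]; rfl))).1 _ rfl).sub b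
        · exact absurd (by rw [← hs, Equiv.apply_symm_apply]) (h s t).2
      · rintro t rfl hw
        -- If the label below `t` were a word, each wire above `t` would start at the matching
        -- contact of an (x, x²)-transistor that carries this same word.
        have top : ∀ b, ∃ s, P.wire.symm (.merge t b) = .split s b ∧
            φ (P.wire.symm (.split s)) = φ (.merge t) ∧ P.Lt (.inl s) (.inr t) := by
          intro b
          have hb := h1.merge t b
          rcases hs : P.wire.symm (.merge t b) with i | ⟨s, c⟩ | t'
          · rw [hs, h1.frame] at hb
            obtain ⟨w, hw⟩ := hw
            rw [hw] at hb
            exact absurd (pre_inj (u := b :: w) (w := []) hb) (by simp)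
          · have hlt := habove (.merge t b) (.inl s) rfl (by rw [hs]; rfl)
            rw [hs, h1.split] at hb
            obtain ⟨e, rfl⟩ := sub_injective_of_isWord hw ((ih _ hlt).1 _ rfl) hb
            exact ⟨s, rfl, e.symm, hlt⟩
          · rw [hs] at hb
            exact absurd (hb ▸ hw.sub b)
              ((ih (.inr t') (habove (.merge t b) _ rfl (by rw [hs]; rfl))).2 _ rfl)
        -- An (x, x²)-transistor above `t` is determined by its word: the letters of the word lead
        -- upwards through (x, x²)-transistors to the top of the frame.
        have inj : ∀ w : List Bool, ∀ s s', P.Lt (.inl s) (.inr t) → P.Lt (.inl s') (.inr t) →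
            φ (P.wire.symm (.split s)) = pre w → φ (P.wire.symm (.split s')) = pre w → s = s' := by
          intro w
          induction w with
          | nil =>
            have hnil : ∀ s, P.Lt (.inl s) (.inr t) → φ (P.wire.symm (.split s)) = pre [] →
                P.wire.symm (.split s) = .frame 0 := by
              intro s hs e
              rcases hq : P.wire.symm (.split s) with i | ⟨s', b⟩ | t'
              · rw [Subsingleton.elim i 0]
              · rw [hq, h1.split] at e
                obtain ⟨w, hw⟩ := (ih (.inl s') (.trans (.single ⟨.split s' b, rfl, by
                  rw [← hq, Equiv.apply_symm_apply]; rfl⟩) hs)).1 _ rfl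
                rw [hw] at e
                exact absurd (pre_inj (u := b :: w) (w := []) e) (by simp)
              · exact absurd (by rw [← hq, Equiv.apply_symm_apply]) (h s t').2
            intro s s' hs hs' e e'
            have := P.wire.symm.injective ((hnil s hs e).trans (hnil s' hs' e').symm)
            exact (Sink.split.inj this)
          | cons b w ihw =>
            have hcons : ∀ s, P.Lt (.inl s) (.inr t) → φ (P.wire.symm (.split s)) = pre (b :: w) →
                ∃ s', P.wire.symm (.split s) = .split s' b ∧ P.Lt (.inl s') (.inr t) ∧
                  φ (P.wire.symm (.split s')) = pre w := by
              intro s hs e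
              rcases hq : P.wire.symm (.split s) with i | ⟨s', c⟩ | t'
              · rw [hq, h1.frame] at e
                exact absurd (pre_inj (u := []) (w := b :: w) e) (by simp)
              · have hlt : P.Lt (.inl s') (.inr t) := .trans (.single ⟨.split s' c, rfl, by
                  rw [← hq, Equiv.apply_symm_apply]; rfl⟩) hs
                rw [hq, h1.split] at e
                obtain ⟨e1, rfl⟩ := sub_injective_of_isWord ((ih _ hlt).1 _ rfl) ⟨w, rfl⟩ e
                exact ⟨s', rfl, hlt, e1⟩
              · exact absurd (by rw [← hq, Equiv.apply_symm_apply]) (h s t').2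
            intro s s' hs hs' e e'
            obtain ⟨x, hx, hx1, hx2⟩ := hcons s hs e
            obtain ⟨x', hx', hx1', hx2'⟩ := hcons s' hs' e'
            obtain rfl := ihw x x' hx1 hx1' hx2 hx2'
            exact (Sink.split.inj (P.wire.symm.injective (hx.trans hx'.symm)))
        obtain ⟨s, hs, hs1, hs2⟩ := top false
        obtain ⟨s', hs', hs1', hs2'⟩ := top true
        obtain ⟨w, hw⟩ := hw
        obtain rfl := inj w s s' hs2 hs2' (hs1.trans hw) (hs1'.trans hw)
        -- Both wires above `t` come from the same transistor and in the right order, which gives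
        -- the forbidden dipole.
        refine (h s t).1 fun b => ?_
        cases b
        · rw [← hs, Equiv.apply_symm_apply]
        · rw [← hs', Equiv.apply_symm_apply]
  exact ⟨φ, h1, h2, fun s => (key _).1 s rfl, fun t => (key _).2 t rfl⟩

end Picture

open Picture

/-- The type of the transistor that is added along the edges with label `h`. -/
noncomputable def kind (h : Piece) : Bool := by
  classical exact decide (¬ IsWord h)

theorem kind_eq_false {h : Piece} : kind h = false ↔ IsWord h := by simp [kind]

theorem kind_of_isWord {h : Piece} (hh : IsWord h) : kind h = false := kind_eq_false.2 hh

theorem kind_of_not_isWord {h : Piece} (hh : ¬ IsWord h) : kind h = true := by simp [kind, hh]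

/-- The picture is normal with the standard labels at the top of the frame. -/
abbrev Picture.Normal {m : ℕ} (P : Picture 1 m) : Prop := P.IsNormal (fun _ => id) P.outs

theorem Picture.Normal.ofEquiv {n m : ℕ} {P : Picture 1 n} (h : P.Normal) (hP : P.IsFinite)
    (e : Fin n ≃ Fin m) : (P.concat (Picture.ofEquiv e)).Normal := by
  have := IsNormal.concat h (isNormal_ofEquiv e P.outs)
  rwa [← outs_concat_ofEquiv hP] at this

theorem Picture.Normal.elementary {b : Bool} {r : ℕ} {P : Picture 1 (r + arity b)} (h : P.Normal)
    (hP : P.IsFinite) {f : Piece} {l : List Piece} (hl : List.ofFn P.outs = ends b f ++ l)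
    (hb : b = kind f) : (P.concat (Picture.elementary b r)).Normal := by
  have := IsNormal.concat h (isNormal_elementary hl (by rw [hb, kind_eq_false]))
  rwa [← out_concat hP (elementary_isFinite b r)] at this

namespace PictureClass

variable {C : PictureClass}

/-- The vertex is represented by a normal picture. -/
def HasNormal (v : C.Vertex) : Prop :=
  ∃ (n : ℕ) (P : Picture 1 n) (hP : C.Mem P), v = vertex P hP ∧ P.Normal

/-- A permutation at the bottom does not affect normality, so it can be absorbed into the
representative. -/
theorem HasNormal.exists_dipoleEq (hC : C.IsNice) {n : ℕ} {P : Picture 1 n} {hP : C.Mem P}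
    (h : HasNormal (C.vertex P hP)) : ∃ Q : Picture 1 n, C.Mem Q ∧ DipoleEq Q P ∧ Q.Normal := by
  obtain ⟨m, Q, hQ, h, hN⟩ := h
  obtain ⟨e, he, hd⟩ := hC.vertex_eq_iff.1 h.symm
  exact ⟨_, C.concat hQ he, hd, hN.ofEquiv (C.isFinite hQ) e⟩

theorem HasNormal.attach {hC : C.IsNice} {h : Piece} {v w : C.Vertex} (hv : HasNormal v)
    (a : Attach hC (kind h) h v w) : HasNormal w := by
  obtain ⟨r, P, hP, l, hl, rfl, rfl⟩ := a
  obtain ⟨Q, hQ, hd, hN⟩ := hv.exists_dipoleEq hC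
  rw [← hd.outs_eq (C.isFinite hQ)] at hl
  exact ⟨_, _, C.concat hQ (hC.elementary _ r),
    (vertex_eq_of_dipoleEq (hd.concat (.refl _))).symm, hN.elementary (C.isFinite hQ) hl rfl⟩

/-- Words that partition the Cantor set are the leaves of a finite binary tree. Cutting continues as
long as a piece lies properly inside the current cone, and it stops because the lengths are bounded
by `N`. -/
theorem cuts_pieces {v : C.Vertex} (hv : ∀ f ∈ pieces v, IsWord f) :
    Cuts (· ∈ pieces v) IsWord id := by
  obtain ⟨N, hN⟩ : ∃ N, ∀ w, pre w ∈ pieces v → w.length < N := by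
    have hfin : {w | pre w ∈ pieces v}.Finite :=
      (pieces_finite v).preimage (fun _ _ _ _ h => pre_inj h)
    obtain ⟨N, hN⟩ := (hfin.image List.length).bddAbove
    exact ⟨N + 1, fun w hw => Nat.lt_succ_of_le (hN ⟨w, hw, rfl⟩)⟩
  have key : ∀ k w, w.length + k = N → (∃ u, pre w ∘ pre u ∈ pieces v) →
      Cuts (· ∈ pieces v) IsWord (pre w) := by
    intro k
    induction k with
    | zero =>
      rintro w hw ⟨u, hu⟩
      rw [← pre_append] at hu
      have := hN _ hu
      simp at this
      omega
    | succ k ih =>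
      rintro w hw ⟨u, hu⟩
      by_cases hwv : pre w ∈ pieces v
      · exact .leaf hwv
      · have step : ∀ b, ∃ u, pre (b :: w) ∘ pre u ∈ pieces v := by
          intro b
          obtain ⟨f, hf, d, hd⟩ := exists_piece v (pre (b :: w) fun _ => true)
          obtain ⟨w', rfl⟩ := hv f hf
          rcases comparable_of_pre_eq hd with ⟨t, ht⟩ | ⟨t, ht⟩
          · refine ⟨t, ?_⟩
            rwa [← pre_append, ← ht]
          · cases t with
            | nil =>
              refine ⟨[], ?_⟩
              simp at ht
              rwa [ht]
            -- The cone of the piece found here contains the cone of `w`, inside which there is a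
            -- piece already. The two coincide, so `pre w` would itself be a piece.
            | cons c t =>
              obtain ⟨rfl, rfl⟩ := List.cons.inj ht
              have := pieces_eq_of_comp_pre hf hu (u := u ++ t) (w := []) (by
                rw [← pre_append, ← pre_append]; simp)
              obtain ⟨rfl, rfl⟩ := List.append_eq_nil_iff.1 this.2
              exact absurd hf hwv
        exact .node ⟨w, rfl⟩ (ih _ (by simp; omega) (step false))
          (ih _ (by simp; omega) (step true))
  obtain ⟨f, hf, -⟩ := exists_piece v fun _ => true
  obtain ⟨w, rfl⟩ := hv f hf
  exact key N [] (by simp) ⟨w, hf⟩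

theorem HasNormal.chain {hC : C.IsNice} {v w : C.Vertex} (hv : HasNormal v)
    (c : Relation.ReflTransGen (Step hC IsWord) v w) : HasNormal w := by
  induction c with
  | refl => exact hv
  | tail _ h ih =>
    obtain ⟨g, hg, h⟩ := h
    exact ih.attach (hC := hC) (by rw [kind_of_isWord hg]; exact attach_false.2 h)

theorem hasNormal_base : HasNormal C.base := by
  refine ⟨1, _, C.one, rfl, ?_⟩
  rw [Picture.Normal, outs, out_ofPerm]
  exact isNormal_ofPerm 1 _

/-- Splitting pieces that are not words leads from `v` to a vertex with only words, and that vertex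
is reached from the base vertex by splitting words. Read from the base vertex to `v`, this path
attaches only transistors of the kind that keeps a picture normal. -/
theorem hasNormal (hC : C.IsNice) (v : C.Vertex) : HasNormal v := by
  obtain ⟨w, c, -, hw⟩ := exists_chain hC (Set.empty_subset (pieces v))
    fun f hf _ => (pieces_tame hf).cuts_isWord
  have hw : ∀ f ∈ pieces w, IsWord f := fun f hf => (hw f hf).resolve_left id
  have hwn : HasNormal w := by
    obtain ⟨x, c₁, -, hx⟩ := exists_chain_of_cuts hC (cuts_pieces hw) C.base
      (by rw [pieces_base]; rfl)
    have hx : pieces x ⊆ pieces w := fun k hk => (hx k hk).resolve_left (by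
      rw [pieces_base]; simp)
    obtain rfl := eq_of_pieces_eq hC (eq_of_pieces_subset hx)
    exact hasNormal_base.chain c₁
  clear hw
  induction c using Relation.ReflTransGen.head_induction_on with
  | refl => exact hwn
  | head h _ ih =>
    obtain ⟨g, hg, h⟩ := h
    exact ih.attach (hC := hC) (by rw [kind_of_not_isWord hg]; exact attach_true.2 h)

/-- Every picture of the class agrees modulo dipoles with a normal one. -/
theorem exists_normal (hC : C.IsNice) {n : ℕ} {P : Picture 1 n} (hP : C.Mem P) :
    ∃ Q : Picture 1 n, C.Mem Q ∧ DipoleEq Q P ∧ Q.Normal :=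
  (hasNormal hC (vertex P hP)).exists_dipoleEq hC

end PictureClass

end DiagramProfile

/-! ### Truncations of labelled pictures -/

namespace DiagramProfile

namespace Picture

variable {n m k : ℕ}

/-- The starting points of the wires that are cut when all transistors outside `A` are left off. -/
def cut (P : Picture n m) (A : Set P.Transistor) : Set (Source n P.S P.M) :=
  {p | (∀ x, p.transistor = some x → x ∈ A) ∧ ∀ x, (P.wire p).transistor = some x → x ∉ A}

/-- This replaces the isomorphism with a concatenation by two inclusions with disjoint images, so
that later arguments stay inside `P`. -/
theorem IsTruncation.exists_maps {P : Picture n m} {A : Set P.Transistor} {Q : Picture n k}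
    (h : P.IsTruncation A Q) : ∃ (R : Picture k m) (fS : Q.S → P.S) (fM : Q.M → P.M)
      (gS : R.S → P.S) (gM : R.M → P.M), A = Set.range (Sum.map fS fM) ∧
      (∀ x y, fS x ≠ gS y) ∧ (∀ x y, fM x ≠ gM y) ∧
      (∀ s, P.wire.symm (.split (fS s)) = (Q.wire.symm (.split s)).map fS fM) ∧
      (∀ t b, P.wire.symm (.merge (fM t) b) = (Q.wire.symm (.merge t b)).map fS fM) ∧
      (∀ j, P.wire ((Q.wire.symm (.frame j)).map fS fM) = (R.wire (.frame j)).map gS gM) ∧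
      ∀ p : Source n P.S P.M, (∃ p' : Source n Q.S Q.M, p = p'.map fS fM) ∨
        ((∃ q : Sink m R.S R.M, P.wire p = q.map gS gM) ∧
          ((∃ s b, p = .split (gS s) b) ∨ ∃ t, p = .merge (gM t))) := by
  obtain ⟨R, e, rfl⟩ := h
  refine ⟨R, e.eS ∘ Sum.inl, e.eM ∘ Sum.inl, e.eS ∘ Sum.inr, e.eM ∘ Sum.inr, rfl,
    fun x y h => Sum.inl_ne_inr (e.eS.injective h), fun x y h => Sum.inl_ne_inr (e.eM.injective h),
    fun s => ?_, fun t b => ?_, fun j => ?_, fun p => ?_⟩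
  · exact (e.symm_wire (.split (.inl s))).trans (Source.map_map _ _ _ _ _)
  · exact (e.symm_wire (.merge (.inl t) b)).trans (Source.map_map _ _ _ _ _)
  · have h1 := e.wire ((Q.wire.symm (.frame j)).map Sum.inl Sum.inl)
    have h2 : (Q.concat R).wire ((Q.wire.symm (.frame j)).map Sum.inl Sum.inl) =
        (R.wire (.frame j)).map Sum.inr Sum.inr := by
      refine (concatFun_inl Q R _).trans ?_
      rw [Equiv.apply_symm_apply]
      rfl
    rw [h2] at h1
    exact (congrArg P.wire (Source.map_map _ _ _ _ _).symm).trans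
      (h1.trans (Sink.map_map _ _ _ _ _))
  · have key : ∀ (p' : Source n (Q.S ⊕ R.S) (Q.M ⊕ R.M)) p, p'.map e.eS e.eM = p →
        (∃ p'' : Source n Q.S Q.M, p = p''.map (e.eS ∘ Sum.inl) (e.eM ∘ Sum.inl)) ∨
        ((∃ q : Sink m R.S R.M, P.wire p = q.map (e.eS ∘ Sum.inr) (e.eM ∘ Sum.inr)) ∧
          ((∃ s b, p = .split (e.eS (.inr s)) b) ∨ ∃ t, p = .merge (e.eM (.inr t)))) := by
      rintro (i | ⟨s | s, b⟩ | t | t) _ rfl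
      · exact .inl ⟨.frame i, rfl⟩
      · exact .inl ⟨.split s b, rfl⟩
      · exact .inr ⟨⟨R.wire (.split s b), (e.wire _).trans (Sink.map_map _ _ _ _ _)⟩,
          .inl ⟨s, b, rfl⟩⟩
      · exact .inl ⟨.merge t, rfl⟩
      · exact .inr ⟨⟨R.wire (.merge t), (e.wire _).trans (Sink.map_map _ _ _ _ _)⟩,
          .inr ⟨t, rfl⟩⟩
    refine key (p.map e.eS.symm e.eM.symm) p ?_
    exact (Source.map_map _ _ _ _ _).trans (Source.map_id' _ _ (by simp) (by simp) p)

/-- A labelling of `P` restricts to one of `Q`, so by uniqueness the bottom labels of `Q` are the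
labels in `P` of the wires that are cut. Only `Q` has to be finite, so this applies to truncations
of the infinite tree. -/
theorem IsTruncation.exists_cut {P : Picture n m} {A : Set P.Transistor} {Q : Picture n k}
    (h : P.IsTruncation A Q) (hQ : Q.IsFinite) {a : Fin n → Piece} {φ : Source n P.S P.M → Piece}
    (hφ : P.IsLabelling a φ) :
    (∃ p : Fin k → Source n P.S P.M, Set.range p = P.cut A ∧ ∀ j, φ (p j) = Q.out a j) ∧
      ∀ x y, Above P.wire x y → y ∈ A → x ∈ A := by
  obtain ⟨R, fS, fM, gS, gM, rfl, hfS, hfM, hS, hM, hd, hp⟩ := h.exists_maps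
  have hnot : ∀ x : R.Transistor, Sum.map gS gM x ∉ Set.range (Sum.map fS fM) := by
    rintro (x | x) ⟨y | y, h⟩
    · exact hfS _ _ (Sum.inl.inj h)
    · cases h
    · cases h
    · exact hfM _ _ (Sum.inr.inj h)
  have hnot' : ∀ (q : Sink m R.S R.M) x, (q.map gS gM).transistor = some x →
      x ∉ Set.range (Sum.map fS fM) := by
    rintro (j | s | ⟨t, b⟩) x hx
    · simp [Sink.map, Sink.transistor] at hx
    · obtain rfl := Option.some.inj hx
      exact hnot (.inl s)
    · obtain rfl := Option.some.inj hx
      exact hnot (.inr t)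
  have hin : ∀ (p : Source n Q.S Q.M) x, (p.map fS fM).transistor = some x →
      x ∈ Set.range (Sum.map fS fM) := by
    rintro (j | ⟨s, b⟩ | t) x hx
    · simp [Source.map, Source.transistor] at hx
    · obtain rfl := Option.some.inj hx
      exact ⟨.inl s, rfl⟩
    · obtain rfl := Option.some.inj hx
      exact ⟨.inr t, rfl⟩
  refine ⟨⟨fun j => (Q.wire.symm (.frame j)).map fS fM, ?_, ?_⟩, ?_⟩
  · ext p
    constructor
    · rintro ⟨j, rfl⟩
      refine ⟨hin _, fun x hx => ?_⟩
      dsimp only at hx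
      rw [hd] at hx
      exact hnot' _ x hx
    · rintro ⟨h1, h2⟩
      rcases hp p with ⟨p, rfl⟩ | ⟨-, ⟨s, b, rfl⟩ | ⟨t, rfl⟩⟩
      · rcases h : Q.wire p with j | s | ⟨t, b⟩ <;> rw [← Equiv.eq_symm_apply] at h <;> subst h
        · exact ⟨j, rfl⟩
        · rw [← hS, Equiv.apply_symm_apply] at h2
          exact absurd ⟨.inl s, rfl⟩ (h2 _ rfl)
        · rw [← hM, Equiv.apply_symm_apply] at h2
          exact absurd ⟨.inr t, rfl⟩ (h2 _ rfl)
      · exact absurd (h1 _ rfl) (hnot (.inl s))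
      · exact absurd (h1 _ rfl) (hnot (.inr t))
  · have hQφ : Q.IsLabelling a fun p => φ (p.map fS fM) := by
      refine ⟨hφ.frame, fun s b => ?_, fun t b => ?_⟩
      · rw [← hS]
        exact hφ.split _ b
      · rw [← hM]
        exact hφ.merge _ b
    intro j
    exact (congrFun (Yields.out_eq ⟨_, hQφ, fun _ => rfl⟩ hQ) j).symm
  · rintro x y ⟨p, hx, hy⟩ hyA
    rcases hp p with ⟨p, rfl⟩ | ⟨⟨q, hq⟩, -⟩
    · exact hin _ _ hx
    · rw [hq] at hy
      exact absurd hyA (hnot' _ _ hy)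

/-- The label of a transistor: above an `(x, x²)`-transistor, or below an `(x², x)`-transistor. -/
def label (P : Picture n m) (φ : Source n P.S P.M → Piece) : P.Transistor → Piece
  | .inl s => φ (P.wire.symm (.split s))
  | .inr t => φ (.merge t)

/-- Everything directly above `s` lies in `A`, and by acyclicity nothing below `s` lies in the
enlarged set. So the wire above `s` and the two wires below it are the only ones whose status
changes. -/
theorem cut_insert_split {P : Picture n m} {A : Set P.Transistor} {s : P.S}
    (hA : ∀ x y, Above P.wire x y → y ∈ A → x ∈ A)
    (hA' : ∀ x y, Above P.wire x y → y ∈ insert (.inl s) A → x ∈ insert (.inl s) A)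
    (hs : .inl s ∉ A) :
    P.wire.symm (.split s) ∈ P.cut A ∧ P.cut (insert (.inl s) A) =
      (P.cut A \ {P.wire.symm (.split s)}) ∪ {.split s false, .split s true} := by
  refine ⟨⟨fun x hx => ?_, fun x hx => ?_⟩, ?_⟩
  · have hxs : Above P.wire x (.inl s) := ⟨_, hx, by rw [Equiv.apply_symm_apply]; rfl⟩
    rcases hA' x _ hxs (Set.mem_insert _ _) with rfl | h
    · exact absurd (.single hxs) (P.acyclic _)
    · exact h
  · rw [Equiv.apply_symm_apply] at hx
    obtain rfl := Option.some.inj hx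
    exact hs
  · ext p
    constructor
    · rintro ⟨h1, h2⟩
      by_cases hp : p.transistor = some (.inl s)
      · right
        rcases p with i | ⟨s', b⟩ | t
        · simp [Source.transistor] at hp
        · obtain rfl : s' = s := by simpa [Source.transistor] using hp
          cases b
          · exact .inl rfl
          · exact .inr rfl
        · simp [Source.transistor] at hp
      · refine .inl ⟨⟨fun x hx => ?_, fun x hx h => h2 x hx (.inr h)⟩, ?_⟩
        · exact (h1 x hx).resolve_left fun e => hp (e ▸ hx)
        · rintro rfl
          exact h2 (.inl s) (by rw [Equiv.apply_symm_apply]; rfl) (Set.mem_insert _ _)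
    · have hb : ∀ b, .split s b ∈ P.cut (insert (.inl s) A) := by
        intro b
        refine ⟨fun x hx => ?_, fun x hx h => ?_⟩
        · obtain rfl := Option.some.inj hx
          exact Set.mem_insert _ _
        · have hab : Above P.wire (.inl s) x := ⟨_, rfl, hx⟩
          rcases h with rfl | h
          · exact P.acyclic _ (.single hab)
          · exact hs (hA _ _ hab h)
      rintro (⟨⟨h1, h2⟩, hp⟩ | rfl | rfl)
      · refine ⟨fun x hx => .inr (h1 x hx), fun x hx h => ?_⟩
        rcases h with rfl | h
        · refine hp ?_
          rw [Set.mem_singleton_iff, Equiv.eq_symm_apply]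
          rcases hq : P.wire p with _ | s' | _ <;> rw [hq] at hx <;>
            simp [Sink.transistor] at hx
          rw [hx]
        · exact h2 x hx h
      · exact hb false
      · exact hb true

/-- Adding an (x², x)-transistor joins two wires of the cut, so here the old cut is expressed
through the new one. -/
theorem cut_insert_merge {P : Picture n m} {A : Set P.Transistor} {t : P.M}
    (hA : ∀ x y, Above P.wire x y → y ∈ A → x ∈ A)
    (hA' : ∀ x y, Above P.wire x y → y ∈ insert (.inr t) A → x ∈ insert (.inr t) A)
    (ht : .inr t ∉ A) :
    .merge t ∈ P.cut (insert (.inr t) A) ∧ P.cut A =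
      (P.cut (insert (.inr t) A) \ {.merge t}) ∪
        {P.wire.symm (.merge t false), P.wire.symm (.merge t true)} := by
  refine ⟨⟨fun x hx => ?_, fun x hx h => ?_⟩, ?_⟩
  · obtain rfl := Option.some.inj hx
    exact Set.mem_insert _ _
  · have hab : Above P.wire (.inr t) x := ⟨_, rfl, hx⟩
    rcases h with rfl | h
    · exact P.acyclic _ (.single hab)
    · exact ht (hA _ _ hab h)
  · have hb : ∀ b, P.wire.symm (.merge t b) ∈ P.cut A := by
      intro b
      refine ⟨fun x hx => ?_, fun x hx => ?_⟩
      · have hxt : Above P.wire x (.inr t) := ⟨_, hx, by rw [Equiv.apply_symm_apply]; rfl⟩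
        rcases hA' x _ hxt (Set.mem_insert _ _) with rfl | h
        · exact absurd (.single hxt) (P.acyclic _)
        · exact h
      · rw [Equiv.apply_symm_apply] at hx
        obtain rfl := Option.some.inj hx
        exact ht
    ext p
    constructor
    · rintro ⟨h1, h2⟩
      by_cases hp : (P.wire p).transistor = some (.inr t)
      · right
        rcases hq : P.wire p with _ | _ | ⟨t', b⟩ <;> rw [hq] at hp <;>
          simp [Sink.transistor] at hp
        subst hp
        rw [← Equiv.eq_symm_apply] at hq
        cases b
        · exact .inl hq
        · exact .inr hq
      · refine .inl ⟨⟨fun x hx => .inr (h1 x hx), fun x hx h => ?_⟩, ?_⟩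
        · rcases h with rfl | h
          · exact hp hx
          · exact h2 x hx h
        · rintro rfl
          exact ht (h1 _ rfl)
    · rintro (⟨⟨h1, h2⟩, hp⟩ | rfl | rfl)
      · refine ⟨fun x hx => ?_, fun x hx h => h2 x hx (.inr h)⟩
        rcases h1 x hx with rfl | h
        · rcases p with _ | _ | t' <;> simp [Source.transistor] at hx
          exact absurd (congrArg _ hx) hp
        · exact h
      · exact hb false
      · exact hb true

theorem IsTruncation.halved {P : Picture 1 m} {A : Set P.Transistor} {x : P.Transistor} {k' : ℕ}
    {Q : Picture 1 k} {Q' : Picture 1 k'} (h : P.IsTruncation A Q)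
    (h' : P.IsTruncation (insert x A) Q') (hx : x ∉ A) (hQ : Q.IsFinite) (hQ' : Q'.IsFinite)
    {φ : Source 1 P.S P.M → Piece} (hφ : P.IsLabelling (fun _ => id) φ) :
    (∃ s, x = .inl s ∧ Halved (P.label φ x) (Set.range Q.outs) (Set.range Q'.outs)) ∨
      (∃ t, x = .inr t ∧ Halved (P.label φ x) (Set.range Q'.outs) (Set.range Q.outs)) := by
  obtain ⟨⟨p, hp, hpφ⟩, hA⟩ := h.exists_cut hQ hφ
  obtain ⟨⟨p', hp', hpφ'⟩, hA'⟩ := h'.exists_cut hQ' hφ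
  have hr : Set.range Q.outs = φ '' P.cut A := by
    rw [← hp, ← Set.range_comp]
    exact congrArg Set.range (funext fun j => (hpφ j).symm)
  have hr' : Set.range Q'.outs = φ '' P.cut (insert x A) := by
    rw [← hp', ← Set.range_comp]
    exact congrArg Set.range (funext fun j => (hpφ' j).symm)
  -- Labels are distinct on a cut, so taking images commutes with removing a wire from it.
  have hi : Set.InjOn φ (P.cut A) := by
    rw [← hp]
    rintro _ ⟨i, rfl⟩ _ ⟨j, rfl⟩ e
    rw [hpφ, hpφ] at e
    rw [(isPartition_outs hQ).injective e]
  have hi' : Set.InjOn φ (P.cut (insert x A)) := by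
    rw [← hp']
    rintro _ ⟨i, rfl⟩ _ ⟨j, rfl⟩ e
    rw [hpφ', hpφ'] at e
    rw [(isPartition_outs hQ').injective e]
  rcases x with s | t
  · obtain ⟨h1, h2⟩ := cut_insert_split hA hA' hx
    refine .inl ⟨s, rfl, hr ▸ ⟨_, h1, rfl⟩, ?_⟩
    rw [hr, hr', h2, Set.image_union, Set.image_pair, hφ.split, hφ.split]
    congr 1
    rw [hi.image_sdiff_subset (Set.singleton_subset_iff.2 h1), Set.image_singleton]
    rfl
  · obtain ⟨h1, h2⟩ := cut_insert_merge hA hA' hx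
    refine .inr ⟨t, rfl, hr' ▸ ⟨_, h1, rfl⟩, ?_⟩
    rw [hr, hr', h2, Set.image_union, Set.image_pair, ← hφ.merge, ← hφ.merge]
    congr 1
    rw [hi'.image_sdiff_subset (Set.singleton_subset_iff.2 h1), Set.image_singleton]
    rfl

theorem IsTruncation.isMaximal {P : Picture n m} {x : P.Transistor} {Q : Picture n k}
    (h : P.IsTruncation {x}ᶜ Q) (hQ : Q.IsFinite) (hP : P.IsFinite) : P.IsMaximal x := by
  obtain ⟨o, φ, hφ, -⟩ := hP.exists_yields fun _ => id
  obtain ⟨-, hA⟩ := h.exists_cut hQ hφ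
  intro y hy
  obtain ⟨z, hz, -⟩ := Relation.TransGen.head'_iff.1 hy
  by_cases hzx : z = x
  · exact P.acyclic x (.single (hzx ▸ hz))
  · exact hA x z hz hzx rfl

theorem isTruncation_univ (P : Picture n m) : P.IsTruncation Set.univ P := by
  refine ⟨ofPerm 1, Iso.concatOne P, ?_⟩
  symm
  rw [Set.eq_univ_iff_forall]
  rintro (x | x)
  · exact ⟨.inl x, rfl⟩
  · exact ⟨.inr x, rfl⟩

theorem isTruncation_concat_elementary {b : Bool} {r : ℕ} (P : Picture n (r + arity b)) :
    (P.concat (elementary b r)).IsTruncation {Sum.map Sum.inr Sum.inr (elementaryT b r)}ᶜ P := by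
  refine ⟨elementary b r, Iso.refl _, ?_⟩
  ext x
  constructor
  · intro hx
    rcases x with (x | x) | (x | x)
    · exact ⟨.inl x, rfl⟩
    · exact absurd (congrArg (Sum.map Sum.inr Sum.inr) (eq_elementaryT b r (.inl x))) hx
    · exact ⟨.inr x, rfl⟩
    · exact absurd (congrArg (Sum.map Sum.inr Sum.inr) (eq_elementaryT b r (.inr x))) hx
  · rintro ⟨x, rfl⟩ h
    rcases hT : elementaryT b r with y | y <;> rw [hT] at h <;> rcases x with x | x <;>
      cases h

end Picture

end DiagramProfile

/-! ### Labels of edges and squares -/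

namespace DiagramProfile

open Picture

namespace PictureClass

variable {C : PictureClass}

/-- Since pieces determine the vertex, a split is recognised from the two sets of pieces alone. -/
theorem split_of_halved (hC : C.IsNice) {h : Piece} {v w : C.Vertex}
    (hh : Halved h (pieces v) (pieces w)) : Split hC h v w := by
  obtain ⟨x, hx⟩ := exists_split hC hh.1
  obtain rfl := eq_of_pieces_eq hC (hx.halved.2.trans hh.2.symm)
  exact hx

theorem Attach.unique {hC : C.IsNice} {b : Bool} {h : Piece} {v w w' : C.Vertex}
    (a : Attach hC b h v w) (a' : Attach hC b h v w') : w = w' := by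
  cases b
  · exact (attach_false.1 a).unique (attach_false.1 a')
  · exact (attach_true.1 a).cancel (attach_true.1 a')

/-- The pair of vertices is an edge with the label `h`. -/
def Edge (hC : C.IsNice) (h : Piece) (e : C.Vertex × C.Vertex) : Prop :=
  Attach hC (kind h) h e.1 e.2

/-- The conditions on words make the type of the transistor agree with `kind`. They hold for reduced
finite pictures and also for the infinite tree. -/
theorem edge_of_represents (hC : C.IsNice) {m : ℕ} {P : Picture 1 m} {φ : Source 1 P.S P.M → Piece}
    (hφ : P.IsLabelling (fun _ => id) φ) (hS : ∀ s, IsWord (φ (P.wire.symm (.split s))))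
    (hM : ∀ t, ¬ IsWord (φ (.merge t))) {A : Set P.Transistor} {x : P.Transistor} (hx : x ∉ A)
    {v w : C.Vertex} (hv : C.Represents P A v) (hw : C.Represents P (insert x A) w) :
    Edge hC (P.label φ x) (v, w) := by
  obtain ⟨k, Q, hQ, hT, rfl⟩ := hv
  obtain ⟨k', Q', hQ', hT', rfl⟩ := hw
  rcases hT.halved hT' hx (C.isFinite hQ) (C.isFinite hQ') hφ with ⟨s, rfl, h⟩ | ⟨t, rfl, h⟩
  · rw [Edge, kind_of_isWord (show IsWord (P.label φ (.inl s)) from hS s), attach_false]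
    exact split_of_halved hC h
  · rw [Edge, kind_of_not_isWord (show ¬ IsWord (P.label φ (.inr t)) from hM t), attach_true]
    exact split_of_halved hC h

theorem IsEdge.exists_edge (hC : C.IsNice) {e : C.Vertex × C.Vertex} (h : C.IsEdge e) :
    ∃ h, Edge hC h e := by
  obtain ⟨n, P, x, hP, hr, -, h1, h2⟩ := h
  obtain ⟨φ, hφ, -, hS, hM⟩ := hr.isNormal (C.isFinite hP)
  exact ⟨_, edge_of_represents hC hφ hS hM (x := x) (A := {x}ᶜ) (by simp) h1
    (by rwa [Set.insert_eq, Set.union_compl_self])⟩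

/-- Both edges add the transistor `x`, whose label in the whole square does not depend on whether
`y` is present. -/
theorem IsParallel.exists_edge (hC : C.IsNice) {e f : C.Vertex × C.Vertex}
    (h : C.IsParallel e f) : ∃ h, Edge hC h e ∧ Edge hC h f := by
  obtain ⟨n, P, x, y, hP, hr, -, -, hxy, h1, h2, h3, h4⟩ := h
  obtain ⟨φ, hφ, -, hS, hM⟩ := hr.isNormal (C.isFinite hP)
  refine ⟨_, edge_of_represents hC hφ hS hM (x := x) (A := {x, y}ᶜ) (by simp) h1 ?_,
    edge_of_represents hC hφ hS hM (x := x) (A := {x}ᶜ) (by simp) h3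
      (by rwa [Set.insert_eq, Set.union_compl_self])⟩
  convert h2 using 1
  ext z
  by_cases hz : z = x <;> simp [hz, hxy]

/-- Starting from a normal representative, attaching a transistor of the type `kind h` gives a
normal picture again, hence a reduced one. -/
theorem Edge.isEdge {hC : C.IsNice} {h : Piece} {e : C.Vertex × C.Vertex} (he : Edge hC h e) :
    C.IsEdge e := by
  obtain ⟨v, w⟩ := e
  obtain ⟨r, P, hP, l, hl, rfl, rfl⟩ := he
  obtain ⟨Q, hQ, hd, hN⟩ := exists_normal hC hP
  rw [← hd.outs_eq (C.isFinite hQ)] at hl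
  have hQ' := C.concat hQ (hC.elementary (kind h) r)
  refine ⟨_, Q.concat (Picture.elementary (kind h) r), _, hQ',
    (hN.elementary (C.isFinite hQ) hl rfl).isReduced,
    (isTruncation_concat_elementary Q).isMaximal (C.isFinite hQ) (C.isFinite hQ'),
    ⟨_, Q, hQ, isTruncation_concat_elementary Q, (vertex_eq_of_dipoleEq hd).symm⟩,
    ⟨_, _, hQ', isTruncation_univ _, ?_⟩⟩
  exact (vertex_eq_of_dipoleEq (hd.concat (.refl _))).symm

theorem range_sum_inl_inl (α β γ : Type) (α' β' γ' : Type) (T : β ⊕ β') (hT : ∀ x, x = T)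
    (U : γ ⊕ γ') (hU : ∀ x, x = U) :
    Set.range (Sum.map (fun a : α => (.inl (.inl (.inl (.inl a))) : (((α ⊕ Empty) ⊕ β) ⊕ Empty) ⊕ γ))
      (fun a : α' => (.inl (.inl (.inl (.inl a))) : (((α' ⊕ Empty) ⊕ β') ⊕ Empty) ⊕ γ'))) =
    {Sum.map Sum.inr Sum.inr U,
      Sum.map (Sum.inl ∘ Sum.inl ∘ Sum.inr) (Sum.inl ∘ Sum.inl ∘ Sum.inr) T}ᶜ := by
  ext x
  simp only [Set.mem_compl_iff, Set.mem_insert_iff, Set.mem_singleton_iff, Set.mem_range]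
  constructor
  · rintro ⟨x | x, rfl⟩ h <;> rcases T with y | y <;> rcases U with z | z <;> simp at h
  · rcases x with ((((x | ⟨⟨⟩⟩) | x) | ⟨⟨⟩⟩) | x) | ((((x | ⟨⟨⟩⟩) | x) | ⟨⟨⟩⟩) | x)
    · exact fun _ => ⟨.inl x, rfl⟩
    · rw [← hT (.inl x)]
      exact fun hx => absurd (.inr rfl) hx
    · rw [← hU (.inl x)]
      exact fun hx => absurd (.inl rfl) hx
    · exact fun _ => ⟨.inr x, rfl⟩
    · rw [← hT (.inr x)]
      exact fun hx => absurd (.inr rfl) hx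
    · rw [← hU (.inr x)]
      exact fun hx => absurd (.inl rfl) hx

theorem sum_map_inr_ne {α β α' β' : Type} (T : α ⊕ α') (U : β ⊕ β') :
    (Sum.map Sum.inr Sum.inr T : (β ⊕ α) ⊕ (β' ⊕ α')) ≠ Sum.map Sum.inl Sum.inl U := by
  rcases T with x | x <;> rcases U with y | y <;> simp

theorem isTruncation_attachTwo_top {b b' : Bool} {m s s' : ℕ} {P : Picture 1 m}
    {e₂ : Fin m ≃ Fin (s + arity b')} {e₂' : Fin (s + arity !b') ≃ Fin (s' + arity b)} :
    (P.attachTwo e₂ e₂').IsTruncation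
      {Sum.map Sum.inr Sum.inr (elementaryT b s'),
        Sum.map (Sum.inl ∘ Sum.inl ∘ Sum.inr) (Sum.inl ∘ Sum.inl ∘ Sum.inr) (elementaryT b' s)}ᶜ
      P := by
  have hr := range_sum_inl_inl P.S _ _ P.M _ _ (elementaryT b' s) (eq_elementaryT b' s)
    (elementaryT b s') (eq_elementaryT b s')
  have hi : ∀ α β γ : Type, Function.Injective
      (fun a : α => (.inl (.inl (.inl (.inl a))) : (((α ⊕ Empty) ⊕ β) ⊕ Empty) ⊕ γ)) := by
    intro α β γ x y h
    simpa using h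
  have key := isTruncation_range (P := P.attachTwo e₂ e₂') (Q := P)
    (fS := fun a => .inl (.inl (.inl (.inl a)))) (fM := fun a => .inl (.inl (.inl (.inl a))))
    (fun x => by
      change (((((P.wire.symm (.split x)).map _ _).map _ _).map _ _).map _ _) = _
      generalize P.wire.symm _ = p
      rcases p with _ | _ | _ <;> rfl)
    (fun x c => by
      change (((((P.wire.symm (.merge x c)).map _ _).map _ _).map _ _).map _ _) = _
      generalize P.wire.symm _ = p
      rcases p with _ | _ | _ <;> rfl) (hi _ _ _) (hi _ _ _)
  exact (congrArg (fun A => (P.attachTwo e₂ e₂').IsTruncation A P) hr).mp key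

/-- Two transistors that are attached to different wires span a square. -/
theorem exists_square (hC : C.IsNice) {v : C.Vertex} {h h' : Piece} {l l' : List Piece}
    (hv : HasList v (ends (kind h) h ++ (l ++ (ends (kind h') h' ++ l')))) :
    ∃ v₁ v₂ v₃, Attach hC (kind h) h v v₁ ∧ Attach hC (kind h') h' v v₂ ∧
      Attach hC (kind h) h v₂ v₃ ∧ C.IsParallel (v, v₁) (v₂, v₃) := by
  obtain ⟨m, P₀, hP₀, rfl, hl⟩ := hv
  obtain ⟨P, hP, hd, hN⟩ := exists_normal hC hP₀
  rw [← hd.outs_eq (C.isFinite hP)] at hl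
  rw [← vertex_eq_of_dipoleEq (hP := hP) hd]
  obtain ⟨r, r', s, s', e₁, e₁', e₂, e₂', l₁, l₁', l₂, l₂', he₁, he₁', he₂, he₂', h₁, h₁', h₂, h₂',
    -⟩ := hC.exists_attachTwo hP hl
  have hP₁ := C.concat hP he₁
  have hP₂ := C.concat hP he₂
  have hE₁ := C.concat hP₁ (hC.elementary (kind h) r)
  have hE₂ := C.concat hP₂ (hC.elementary (kind h') s)
  have hE₂' := C.concat hE₂ he₂'
  have hX := C.concat hE₂' (hC.elementary (kind h) s')
  refine ⟨_, _, _, attach_concat hC hP he₁ h₁, attach_concat hC hP he₂ h₂,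
    attach_concat hC hE₂ he₂' h₂', _, P.attachTwo e₂ e₂',
    Sum.map Sum.inr Sum.inr (elementaryT (kind h) s'),
    Sum.map (Sum.inl ∘ Sum.inl ∘ Sum.inr) (Sum.inl ∘ Sum.inl ∘ Sum.inr) (elementaryT (kind h') s),
    hX, ?_, ?_, ?_, ?_, ⟨_, P, hP, isTruncation_attachTwo_top, rfl⟩,
    ⟨_, _, hE₁, isTruncation_attachTwo (C.isFinite hP) h₁ h₂ h₂', rfl⟩,
    ⟨_, _, hE₂', isTruncation_concat_elementary _, (vertex_concat_ofEquiv he₂').symm⟩,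
    ⟨_, _, hX, isTruncation_univ _, rfl⟩⟩
  · have hN₂ := (hN.ofEquiv (C.isFinite hP) e₂).elementary (C.isFinite hP₂) h₂ rfl
    exact ((hN₂.ofEquiv (C.isFinite hE₂) e₂').elementary (C.isFinite hE₂') h₂' rfl).isReduced
  · exact (isTruncation_concat_elementary _).isMaximal (C.isFinite hE₂') (C.isFinite hX)
  · exact (isTruncation_attachTwo (C.isFinite hP) h₁ h₂ h₂').isMaximal (C.isFinite hE₁)
      (C.isFinite hX)
  · intro e
    refine sum_map_inr_ne (elementaryT (kind h) s') (Sum.map (Sum.inl ∘ Sum.inr)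
      (Sum.inl ∘ Sum.inr) (elementaryT (kind h') s)) (e.trans ?_)
    rw [Sum.map_map]
    rfl

theorem HasList.split {hC : C.IsNice} {v w : C.Vertex} {h : Piece} {l : List Piece}
    (hv : HasList v (h :: l)) (hs : Split hC h v w) :
    HasList w (h.sub false :: h.sub true :: l) := by
  obtain ⟨P, hP, rfl, h0, hl⟩ := hv.cons
  have hs' : Split hC h (C.vertex P hP) _ := ⟨_, P, hP, h0, rfl, rfl⟩
  rw [hs.unique hs']
  exact ⟨_, _, C.concat hP (hC.split _), rfl, ofFn_split (C.isFinite hP) hl⟩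

theorem HasList.attach {hC : C.IsNice} {v w : C.Vertex} {h : Piece} {l : List Piece}
    (hv : HasList v (h :: l)) (hs : Split hC h v w) (b : Bool) :
    HasList (cond b w v) (ends b h ++ l) := by
  cases b
  · exact hv
  · exact hv.split hs

theorem Split.attach {hC : C.IsNice} {v w : C.Vertex} {h : Piece} (hs : Split hC h v w) (b : Bool) :
    Attach hC b h (cond b w v) (cond b v w) := by
  cases b
  · exact attach_false.2 hs
  · exact attach_true.2 hs

/-- The edge between a vertex and the vertex where the piece `h` is split. -/
noncomputable def edge (h : Piece) (v w : C.Vertex) : C.Vertex × C.Vertex :=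
  (cond (kind h) w v, cond (kind h) v w)

theorem Split.edge {hC : C.IsNice} {v w : C.Vertex} {h : Piece} (hs : Split hC h v w) :
    Edge hC h (PictureClass.edge h v w) := hs.attach (kind h)

theorem Edge.exists_split {hC : C.IsNice} {h : Piece} {e : C.Vertex × C.Vertex} (he : Edge hC h e) :
    ∃ v w, Split hC h v w ∧ e = PictureClass.edge h v w := by
  obtain ⟨v, w⟩ := e
  unfold Edge at he
  unfold PictureClass.edge
  cases hk : kind h
  · rw [hk] at he
    exact ⟨v, w, attach_false.1 he, rfl⟩
  · rw [hk] at he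
    exact ⟨w, v, attach_true.1 he, rfl⟩

/-- The four vertices given by splitting `h`, `g`, both or none form a square of the complex; the
kinds of `g` and `h` decide only how it is oriented. -/
theorem parallel_of_split {hC : C.IsNice} {h g : Piece} {v w v' w' : C.Vertex}
    (hs : Split hC h v w) (hg : Split hC g v v') (hgh : g ≠ h) (hs' : Split hC h v' w') :
    Relation.EqvGen C.IsParallel (edge h v w) (edge h v' w') := by
  obtain ⟨l, hl⟩ := exists_hasList_cons hC hs.halved.1
  have hg' := hl.mem_iff.2 hg.halved.1
  obtain ⟨l1, l2, rfl⟩ := List.append_of_mem ((List.mem_cons.1 hg').resolve_left hgh)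
  obtain ⟨x, hgw, hx⟩ := exists_diamond hs hg hgh.symm
  obtain rfl := hx.unique hs'
  have hrot : HasList v (g :: (l2 ++ h :: l1)) := by
    have := hl.rotate hC (l := h :: l1) (l' := g :: l2)
    simpa using this
  -- `IsParallel` describes a square from the corner where both transistors are missing. For a word
  -- this is the side before its split, for any other label the side after it.
  have hcorner : HasList (cond (kind g) (cond (kind h) x v') (cond (kind h) w v))
      (ends (kind h) h ++ (l1 ++ (ends (kind g) g ++ l2))) := by
    have h1 : HasList (cond (kind g) v' v) (h :: (l1 ++ (ends (kind g) g ++ l2))) := by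
      have h2 := hrot.attach hg (kind g)
      have h3 := (show HasList _ ((ends (kind g) g ++ l2) ++ h :: l1) by simpa using h2).rotate hC
      simpa using h3
    cases hkg : kind g
    · rw [hkg] at h1
      exact h1.attach hs (kind h)
    · rw [hkg] at h1
      exact h1.attach hs' (kind h)
  obtain ⟨v₁, v₂, v₃, a₁, a₂, a₃, hp⟩ := exists_square hC hcorner
  cases hkg : kind g
  · rw [hkg] at a₁ a₂ hp
    have b₂ : Attach hC false g (cond (kind h) w v) (cond (kind h) x v') := by
      cases kind h
      · exact attach_false.2 hg
      · exact attach_false.2 hgw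
    obtain rfl := a₂.unique b₂
    obtain rfl := a₁.unique (hs.attach (kind h))
    obtain rfl := a₃.unique (hs'.attach (kind h))
    exact .rel _ _ hp
  · rw [hkg] at a₁ a₂ hp
    have b₂ : Attach hC true g (cond (kind h) x v') (cond (kind h) w v) := by
      cases kind h
      · exact attach_true.2 hg
      · exact attach_true.2 hgw
    obtain rfl := a₂.unique b₂
    obtain rfl := a₁.unique (hs'.attach (kind h))
    obtain rfl := a₃.unique (hs.attach (kind h))
    exact .symm _ _ (.rel _ _ hp)

end PictureClass

end DiagramProfile

namespace DiagramProfile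

open Picture

namespace PictureClass

variable {C : PictureClass}

/-! ### Half-spaces -/

/-- The vertices which have a piece that restricts to `h`. -/
def above (C : PictureClass) (h : Piece) : Set C.Vertex :=
  {v | ∃ f ∈ pieces v, ∃ u, f ∘ pre u = h}

theorem mem_above_of_mem {v : C.Vertex} {h : Piece} (hh : h ∈ pieces v) : v ∈ C.above h :=
  ⟨h, hh, [], rfl⟩

theorem base_mem_above {h : Piece} : C.base ∈ C.above h ↔ IsWord h := by
  constructor
  · rintro ⟨f, hf, u, rfl⟩
    rw [pieces_base] at hf
    subst hf
    exact ⟨u, rfl⟩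
  · rintro ⟨w, rfl⟩
    exact ⟨id, by rw [pieces_base]; rfl, w, rfl⟩

/-- The only restriction of `g` that is not also a restriction of one of its halves is `g` itself.
-/
theorem Split.mem_above_iff {hC : C.IsNice} {g h : Piece} {v w : C.Vertex} (hs : Split hC g v w)
    (hgh : g ≠ h) : v ∈ C.above h ↔ w ∈ C.above h := by
  constructor
  · rintro ⟨f, hf, u, rfl⟩
    by_cases hfg : f = g
    · subst hfg
      rcases List.eq_nil_or_concat u with rfl | ⟨u, b, rfl⟩
      · exact absurd rfl hgh
      · refine ⟨f.sub b, (mem_of_split hs).2 (.inr ?_), u, by rw [sub_comp_pre]; simp⟩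
        cases b
        · exact .inl rfl
        · exact .inr rfl
    · exact ⟨f, (mem_of_split hs).2 (.inl ⟨hf, hfg⟩), u, rfl⟩
  · rintro ⟨f, hf, u, rfl⟩
    rcases (mem_of_split hs).1 hf with ⟨hf, -⟩ | rfl | rfl
    · exact ⟨f, hf, u, rfl⟩
    · exact ⟨g, hs.halved.1, _, (sub_comp_pre _ _ _).symm⟩
    · exact ⟨g, hs.halved.1, _, (sub_comp_pre _ _ _).symm⟩

theorem Split.notMem_above {hC : C.IsNice} {h : Piece} {v w : C.Vertex} (hs : Split hC h v w) :
    w ∉ C.above h := by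
  have hh := hs.halved.1
  rintro ⟨f, hf, u, e⟩
  rcases (mem_of_split hs).1 hf with ⟨hf, hfh⟩ | rfl | rfl
  · exact hfh (pieces_eq_of_comp_pre hf hh (w := []) e).1
  · rw [sub_comp_pre] at e
    have := (pieces_eq_of_comp_pre hh hh (w := []) e).2
    simp at this
  · rw [sub_comp_pre] at e
    have := (pieces_eq_of_comp_pre hh hh (w := []) e).2
    simp at this

/-- Membership in `above h` changes along an edge with label `h` and along no other, so the end
points of an edge determine its label. -/
theorem Split.label_eq {hC : C.IsNice} {g h : Piece} {v w v' w' : C.Vertex} (hs : Split hC g v w)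
    (hs' : Split hC h v' w')
    (e : PictureClass.edge g v w = PictureClass.edge h v' w') : g = h := by
  by_contra hgh
  have h1 := hs.mem_above_iff hgh
  have h2 := mem_above_of_mem hs'.halved.1
  have h3 := hs'.notMem_above
  unfold PictureClass.edge at e
  cases hg : kind g <;> cases hh : kind h <;> simp only [hg, hh, cond_true, cond_false,
    Prod.mk.injEq] at e <;> obtain ⟨rfl, rfl⟩ := e <;> tauto

theorem Edge.label_eq {hC : C.IsNice} {g h : Piece} {e : C.Vertex × C.Vertex} (he : Edge hC g e)
    (he' : Edge hC h e) : g = h := by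
  obtain ⟨v, w, hs, rfl⟩ := he.exists_split
  obtain ⟨v', w', hs', h⟩ := he'.exists_split
  exact hs.label_eq hs' h

theorem edge_iff_of_eqvGen {hC : C.IsNice} {e f : C.Vertex × C.Vertex}
    (h : Relation.EqvGen C.IsParallel e f) (g : Piece) : Edge hC g e ↔ Edge hC g f := by
  induction h with
  | rel e f h =>
    obtain ⟨k, h1, h2⟩ := h.exists_edge hC
    exact ⟨fun h => h.label_eq h1 ▸ h2, fun h => h.label_eq h2 ▸ h1⟩
  | refl => exact Iff.rfl
  | symm _ _ _ ih => exact ih.symm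
  | trans _ _ _ _ _ ih ih' => exact ih.trans ih'

/-- A vertex is determined by the set of those of its pieces that are not words of a fixed
length. -/
theorem eq_of_words (hC : C.IsNice) {K : Set Piece} {N : ℕ} {v w : C.Vertex} (hw : K ⊆ pieces w)
    (hv' : ∀ k ∈ pieces v, k ∈ K ∨ IsWordOf N k) (hw' : ∀ k ∈ pieces w, k ∈ K ∨ IsWordOf N k)
    (hv : K ⊆ pieces v) : v = w := by
  refine eq_of_pieces_eq hC (eq_of_pieces_subset fun f hf => ?_)
  rcases hv' f hf with h | ⟨u, hu, rfl⟩
  · exact hw h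
  · obtain ⟨g, hg, d, hd⟩ := exists_piece w (pre u fun _ => true)
    rcases hw' g hg with h | ⟨u', hu', rfl⟩
    · rwa [← (pieces_eq_of_apply (hv h) hf hd).1]
    · rcases comparable_of_pre_eq hd with ⟨t, rfl⟩ | ⟨t, rfl⟩
      · have : t = [] := by
          rw [List.length_append] at hu'
          exact List.eq_nil_of_length_eq_zero (by omega)
        subst this
        exact hg
      · have : t = [] := by
          rw [List.length_append] at hu
          exact List.eq_nil_of_length_eq_zero (by omega)
        subst this
        exact hg

/-- Each split of a piece other than `h` spans a square with the edge labelled `h`, and the edge is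
moved across that square. -/
theorem exists_parallel_chain {hC : C.IsNice} {h : Piece} {v w x : C.Vertex}
    (c : Relation.ReflTransGen (Step hC fun g => g ∉ ({h} : Set Piece)) v x) (hs : Split hC h v w) :
    ∃ y, Split hC h x y ∧ Relation.EqvGen C.IsParallel (edge h v w) (edge h x y) := by
  induction c using Relation.ReflTransGen.head_induction_on generalizing w with
  | refl => exact ⟨w, hs, .refl _⟩
  | head hg _ ih =>
    obtain ⟨g, hgh, hg⟩ := hg
    obtain ⟨z, hz, -⟩ := exists_diamond hg hs hgh
    obtain ⟨y, hy, hy'⟩ := ih hz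
    exact ⟨y, hy, .trans _ _ _ (parallel_of_split hs hg hgh hz) hy'⟩

/-- Edges with the same label belong to the same hyperplane. -/
theorem Edge.eqvGen {hC : C.IsNice} {h : Piece} {e f : C.Vertex × C.Vertex} (he : Edge hC h e)
    (hf : Edge hC h f) : Relation.EqvGen C.IsParallel e f := by
  obtain ⟨v, w, hs, rfl⟩ := he.exists_split
  obtain ⟨v', w', hs', rfl⟩ := hf.exists_split
  -- Both edges are moved, by splitting everything but `h`, to a vertex whose other pieces are words
  -- of one common length. By `eq_of_words` there is only one such vertex.
  obtain ⟨N₁, h₁⟩ := exists_chain_words hC (Set.singleton_subset_iff.2 hs.halved.1)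
  obtain ⟨N₂, h₂⟩ := exists_chain_words hC (Set.singleton_subset_iff.2 hs'.halved.1)
  obtain ⟨x, c, hx, hx'⟩ := h₁ _ (le_max_left N₁ N₂)
  obtain ⟨x', c', hy, hy'⟩ := h₂ _ (le_max_right N₁ N₂)
  obtain rfl := eq_of_words hC hy hx' hy' hx
  obtain ⟨y, hy, p⟩ := exists_parallel_chain c hs
  obtain ⟨y', hy', p'⟩ := exists_parallel_chain c' hs'
  obtain rfl := hy.unique hy'
  exact .trans _ _ _ p (.symm _ _ p')

theorem mem_hyperplane_iff {hC : C.IsNice} {h : Piece} {e f : C.Vertex × C.Vertex}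
    (he : Edge hC h e) : f ∈ C.hyperplane e ↔ Edge hC h f :=
  ⟨fun hf => (edge_iff_of_eqvGen hf h).1 he, fun hf => he.eqvGen hf⟩

theorem chain_of_notMem_above {hC : C.IsNice} {h : Piece} {A : Piece → Prop} {v w : C.Vertex}
    (c : Relation.ReflTransGen (Step hC A) v w) (hv : v ∉ C.above h) :
    Relation.ReflTransGen (Step hC fun g => g ≠ h) v w := by
  induction c using Relation.ReflTransGen.head_induction_on with
  | refl => exact .refl
  | head hg _ ih =>
    obtain ⟨g, -, hg⟩ := hg
    have hgh : g ≠ h := fun e => hv (e ▸ mem_above_of_mem hg.halved.1)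
    exact .head ⟨g, hgh, hg⟩ (ih fun h => hv ((hg.mem_above_iff hgh).2 h))

/-- Following the letters of `u`, only pieces that properly contain `h` are split, so the chain does
not cross the hyperplane of `h`. -/
theorem exists_chain_of_mem_above (hC : C.IsNice) {h : Piece} {v : C.Vertex}
    (hv : v ∈ C.above h) : ∃ w, Relation.ReflTransGen (Step hC fun g => g ≠ h) v w ∧
      h ∈ pieces w := by
  obtain ⟨f, hf, u, rfl⟩ := hv
  induction u using List.reverseRecOn generalizing f v with
  | nil => exact ⟨v, .refl, hf⟩
  | append_singleton u b ih =>
    obtain ⟨x, hx⟩ := exists_split hC hf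
    have hb : f.sub b ∈ pieces x := (mem_of_split hx).2 (.inr (by cases b <;> simp))
    obtain ⟨w, c, hw⟩ := ih _ hb
    rw [sub_comp_pre] at c hw
    refine ⟨w, .head ⟨f, fun e => ?_, hx⟩ c, hw⟩
    have := (pieces_eq_of_comp_pre hf hf (u := []) e).2
    simp at this

/-- The positive half-space of the hyperplane of the edges with the label `h`. -/
def half (C : PictureClass) (h : Piece) : Set C.Vertex := {v | ¬ (v ∈ C.above h ↔ IsWord h)}

/-- Membership in `above h` changes only along edges labelled `h`, so a path avoiding the hyperplane
stays on its side. Conversely, every vertex on the side of the base vertex can be joined to it, by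
splitting both down to a common vertex. -/
theorem halfSpace_hyperplane {hC : C.IsNice} {h : Piece} {e : C.Vertex × C.Vertex}
    (he : Edge hC h e) : C.halfSpace (C.hyperplane e) = C.half h := by
  have hstep : ∀ {g : Piece} {v w : C.Vertex}, Split hC g v w → g ≠ h →
      Relation.EqvGen (fun a b => C.IsEdge (a, b) ∧ (a, b) ∉ C.hyperplane e) v w := by
    intro g v w hs hgh
    have hg := hs.edge
    have h1 := hg.isEdge
    have h2 : edge g v w ∉ C.hyperplane e := fun hm =>
      hgh (hg.label_eq ((mem_hyperplane_iff he).1 hm))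
    unfold edge at h1 h2
    cases hk : kind g <;> rw [hk] at h1 h2
    · exact .rel _ _ ⟨h1, h2⟩
    · exact .symm _ _ (.rel _ _ ⟨h1, h2⟩)
  have hchain : ∀ {v w : C.Vertex}, Relation.ReflTransGen (Step hC fun g => g ≠ h) v w →
      Relation.EqvGen (fun a b => C.IsEdge (a, b) ∧ (a, b) ∉ C.hyperplane e) v w := by
    intro v w c
    induction c with
    | refl => exact .refl _
    | tail _ hs ih =>
      obtain ⟨g, hgh, hs⟩ := hs
      exact .trans _ _ _ ih (hstep hs hgh)
  ext v
  simp only [halfSpace, half, Set.mem_ofPred_eq, not_iff_not]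
  constructor
  · intro hp
    rw [← base_mem_above (C := C)]
    have key : ∀ a b, Relation.EqvGen (fun a b => C.IsEdge (a, b) ∧ (a, b) ∉ C.hyperplane e) a b →
        (b ∈ C.above h ↔ a ∈ C.above h) := by
      intro a b hab
      induction hab with
      | rel a b hab =>
        obtain ⟨g, hg⟩ := hab.1.exists_edge hC
        have hgh : g ≠ h := fun e' => hab.2 ((mem_hyperplane_iff he).2 (e' ▸ hg))
        obtain ⟨x, y, hs, hxy⟩ := hg.exists_split
        have := hs.mem_above_iff hgh
        unfold edge at hxy
        cases hk : kind g <;> simp only [hk, cond_true, cond_false, Prod.mk.injEq] at hxy <;>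
          obtain ⟨rfl, rfl⟩ := hxy
        · exact this.symm
        · exact this
      | refl => exact Iff.rfl
      | symm _ _ _ ih => exact ih.symm
      | trans _ _ _ _ _ ih ih' => exact ih'.trans ih
    exact key _ _ hp
  · intro hv
    by_cases hh : IsWord h
    -- Both vertices are split, but never at `h`, until `h` is a piece and all others are words of
    -- one length; then the vertices agree.
    · obtain ⟨x, c, hx⟩ := exists_chain_of_mem_above hC (hv.2 hh)
      obtain ⟨x', c', hx'⟩ := exists_chain_of_mem_above hC ((base_mem_above (C := C)).2 hh)
      obtain ⟨N₁, h₁⟩ := exists_chain_words hC (Set.singleton_subset_iff.2 hx)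
      obtain ⟨N₂, h₂⟩ := exists_chain_words hC (Set.singleton_subset_iff.2 hx')
      obtain ⟨y, d, hy, hyN⟩ := h₁ _ (le_max_left N₁ N₂)
      obtain ⟨y', d', hy', hyN'⟩ := h₂ _ (le_max_right N₁ N₂)
      obtain rfl := eq_of_words hC hy' hyN hyN' hy
      exact .trans _ _ _ (hchain (c'.trans d')) (.symm _ _ (hchain (c.trans d)))
    -- Outside `above h` the label `h` never occurs as a piece, so the chains down to a common flat
    -- vertex cannot split it.
    · have hv : v ∉ C.above h := fun h' => hh (hv.1 h')
      obtain ⟨N₀, hN₀⟩ := exists_chain_flat hC v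
      obtain ⟨t, c, ht⟩ := exists_flat hC N₀
      exact .trans _ _ _
        (hchain (chain_of_notMem_above c fun h' => hh (base_mem_above.1 h')))
        (.symm _ _ (hchain (chain_of_notMem_above (hN₀ _ le_rfl t c ht) hv)))

theorem isPositive_iff (hC : C.IsNice) {A : Set C.Vertex} :
    C.IsPositive A ↔ ∃ h, (∃ v : C.Vertex, h ∈ pieces v) ∧ A = C.half h := by
  constructor
  · rintro ⟨e, he, rfl⟩
    obtain ⟨h, hh⟩ := he.exists_edge hC
    obtain ⟨v, w, hs, -⟩ := hh.exists_split
    exact ⟨h, ⟨v, hs.halved.1⟩, halfSpace_hyperplane hh⟩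
  · rintro ⟨h, ⟨v, hv⟩, rfl⟩
    obtain ⟨w, hs⟩ := exists_split hC hv
    exact ⟨_, hs.edge.isEdge, (halfSpace_hyperplane hs.edge).symm⟩

theorem half_of_isWord {h : Piece} (hh : IsWord h) : C.half h = (C.above h)ᶜ := by
  ext v
  simp [half, hh]

theorem half_of_not_isWord {h : Piece} (hh : ¬ IsWord h) : C.half h = C.above h := by
  ext v
  simp [half, hh]

end PictureClass

end DiagramProfile

namespace DiagramProfile

open Picture

/-! ### The infinite tree -/

/-- The labels of the wires of the infinite tree. -/
def treeLabel : Source 1 (List Bool) Empty → Piece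
  | .frame _ => id
  | .split w b => pre (b :: w)

theorem isLabelling_treeLabel : infiniteTree.IsLabelling (fun _ => id) treeLabel := by
  refine ⟨fun _ => rfl, fun s b => ?_, fun t => Empty.elim t⟩
  cases s <;> rfl

theorem label_infiniteTree (w : List Bool) :
    infiniteTree.label treeLabel (.inl w) = pre w := by
  cases w <;> rfl

theorem infiniteTree_lt {u w : List Bool} :
    infiniteTree.Lt (.inl u) (.inl w) ↔ u <:+ w ∧ u ≠ w := by
  have habove : ∀ x y : infiniteTree.Transistor, Above infiniteTree.wire x y →
      ∃ b u, x = .inl u ∧ y = .inl (b :: u) := by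
    rintro x y ⟨p, hx, hy⟩
    rcases p with i | ⟨u, b⟩ | ⟨⟨⟩⟩
    · cases hx
    · exact ⟨b, u, (Option.some.inj hx).symm, (Option.some.inj hy).symm⟩
  constructor
  · intro h
    have key : ∀ y : infiniteTree.Transistor, infiniteTree.Lt (.inl u) y →
        ∃ w : List Bool, y = .inl w ∧ u <:+ w ∧ u.length < w.length := by
      intro y hy
      induction hy with
      | single h =>
        obtain ⟨b, u', hu, rfl⟩ := habove _ _ h
        obtain rfl := Sum.inl.inj hu
        exact ⟨_, rfl, List.suffix_cons _ _, by simp⟩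
      | tail _ h ih =>
        obtain ⟨w, rfl, h1, h2⟩ := ih
        obtain ⟨b, w', hw, rfl⟩ := habove _ _ h
        obtain rfl := Sum.inl.inj hw
        exact ⟨_, rfl, h1.trans (List.suffix_cons _ _), by simp; omega⟩
    obtain ⟨w', hw, h1, h2⟩ := key _ h
    obtain rfl := Sum.inl.inj hw
    exact ⟨h1, fun e => by simp [e] at h2⟩
  · rintro ⟨h, hne⟩
    induction w with
    | nil => exact absurd (List.eq_nil_of_suffix_nil h) hne
    | cons b w ih =>
      have hw : infiniteTree.Lt (.inl w) (.inl (b :: w)) := .single ⟨.split w b, rfl, rfl⟩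
      rcases List.suffix_cons_iff.1 h with rfl | h
      · exact absurd rfl hne
      · by_cases hu : u = w
        · subst hu
          exact hw
        · exact (ih h hu).trans hw

namespace PictureClass

variable {C : PictureClass}

/-- The finite part of the infinite tree above a transistor. -/
theorem exists_branch (hC : C.IsNice) (w : List Bool) : ∃ (r : ℕ) (P : Picture 1 (r + 1))
    (_ : C.Mem P) (fS : P.S → List Bool) (fM : P.M → Empty), Function.Injective fS ∧
      Set.range fS = {u | u <:+ w ∧ u ≠ w} ∧
      (∀ s, infiniteTree.wire.symm (.split (fS s)) = (P.wire.symm (.split s)).map fS fM) ∧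
      (P.wire.symm (.frame 0)).map fS fM = infiniteTree.wire.symm (.split w) := by
  induction w with
  | nil =>
    refine ⟨0, _, C.one, Empty.elim, Empty.elim, fun s => Empty.elim s, ?_,
      fun s => Empty.elim s, rfl⟩
    ext u
    constructor
    · rintro ⟨s, -⟩
      exact Empty.elim s
    · rintro ⟨h, hne⟩
      exact absurd (List.eq_nil_of_suffix_nil h) hne
  | cons b w ih =>
    obtain ⟨r, P, hP, fS, fM, hi, hr, hS, h0⟩ := ih
    obtain ⟨e, he, h⟩ : ∃ e : Fin (r + 2) ≃ Fin (r + 2), C.Mem (ofEquiv e) ∧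
        e.symm 0 = if b then 1 else 0 := by
      -- This rotation brings the contact on side `b` of the new transistor to the first place. For
      -- the left contact it is a full turn, which keeps the amount positive.
      refine ⟨_, hC.rotation rfl (r + 2 - if b then 1 else 0), Fin.ext ?_⟩
      rw [rotation_symm_zero (i := if b then 1 else 0) rfl]
      · cases b <;> simp
      · cases b
        · simp
        · simp; omega
      · cases b <;> simp
    refine ⟨r + 1, _, C.concat (C.concat hP (hC.split r)) he,
      fun | .inl (.inl s) => fS s | .inl (.inr _) => w,
      fun | .inl (.inl t) => fM t, ?_, ?_, ?_, ?_⟩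
    · have hw : ∀ s, fS s ≠ w := fun s e => by
        have : fS s ∈ {u | u <:+ w ∧ u ≠ w} := hr ▸ ⟨s, rfl⟩
        exact this.2 e
      rintro ((s | ⟨⟩) | ⟨⟨⟩⟩) ((s' | ⟨⟩) | ⟨⟨⟩⟩) hss
      · exact congrArg _ (congrArg _ (hi hss))
      · exact absurd hss (hw s)
      · exact absurd hss.symm (hw s')
      · rfl
    · ext u
      constructor
      · rintro ⟨(s | ⟨⟩) | ⟨⟨⟩⟩, rfl⟩
        · have : fS s ∈ {u | u <:+ w ∧ u ≠ w} := hr ▸ ⟨s, rfl⟩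
          refine ⟨this.1.trans (List.suffix_cons _ _), fun e => ?_⟩
          have h1 := this.1.length_le
          have h2 : (fS s).length = w.length + 1 := by
            simpa using congrArg List.length e
          omega
        · exact ⟨List.suffix_cons _ _, fun e => by simpa using congrArg List.length e⟩
      · rintro ⟨h, hne⟩
        rcases List.suffix_cons_iff.1 h with rfl | h
        · exact absurd rfl hne
        · by_cases hu : u = w
          · exact ⟨.inl (.inr ()), hu.symm⟩
          · obtain ⟨s, hs⟩ : u ∈ Set.range fS := hr ▸ ⟨h, hu⟩
            exact ⟨.inl (.inl s), hs⟩
    · rintro ((s | ⟨⟩) | ⟨⟨⟩⟩)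
      · refine (hS s).trans ?_
        change _ = (((P.wire.symm (.split s)).map Sum.inl Sum.inl).map Sum.inl Sum.inl).map _ _
        generalize P.wire.symm _ = p
        rcases p with _ | _ | _ <;> rfl
      · refine h0.symm.trans ?_
        change _ = (((P.wire.symm (.frame 0)).map Sum.inl Sum.inl).map Sum.inl Sum.inl).map _ _
        generalize P.wire.symm _ = p
        rcases p with _ | _ | _ <;> rfl
    · have h1 : ((P.concat (splitFirst r)).concat (ofEquiv e)).wire.symm (.frame 0) =
          ((P.concat (splitFirst r)).wire.symm (.frame (e.symm 0))).map Sum.inl Sum.inl := rfl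
      rw [h1, h]
      cases b <;> rfl

theorem represents_of_branch (hC : C.IsNice) (w : List Bool) {A : Set infiniteTree.Transistor}
    (hA : ∀ u : List Bool, .inl u ∈ A ↔ u <:+ w ∧ u ≠ w) :
    ∃ v, C.Represents infiniteTree A v := by
  obtain ⟨r, P, hP, fS, fM, hi, hr, hS, -⟩ := exists_branch hC w
  refine ⟨_, _, P, hP, ?_, rfl⟩
  convert isTruncation_range (P := infiniteTree) (Q := P) (fS := fS) (fM := fM) hS
    (fun t => Empty.elim (fM t)) hi fun t => Empty.elim (fM t)
  ext x
  rcases x with u | ⟨⟨⟩⟩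
  rw [hA u]
  constructor
  · intro h
    obtain ⟨s, rfl⟩ : u ∈ Set.range fS := hr ▸ h
    exact ⟨.inl s, rfl⟩
  · rintro ⟨s | t, h⟩
    · obtain rfl := Sum.inl.inj h
      have : fS s ∈ {u | u <:+ w ∧ u ≠ w} := hr ▸ ⟨s, rfl⟩
      exact this
    · exact Empty.elim (fM t)

theorem treeProfile_eq (hC : C.IsNice) : C.treeProfile = {A | ∃ w, A = C.half (pre w)} := by
  have key : ∀ w (e : C.Vertex × C.Vertex),
      C.Represents infiniteTree {y | infiniteTree.Lt y (.inl w)} e.1 →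
      C.Represents infiniteTree {y | infiniteTree.Lt y (.inl w) ∨ y = .inl w} e.2 →
      C.halfSpace (C.hyperplane e) = C.half (pre w) := by
    intro w e h1 h2
    have := edge_of_represents hC isLabelling_treeLabel (fun s => ?_) (fun t => Empty.elim t)
      (A := {y | infiniteTree.Lt y (.inl w)}) (x := .inl w) (infiniteTree.acyclic (.inl w)) h1
      (w := e.2) (by
        convert h2 using 1
        ext y
        exact or_comm)
    · exact halfSpace_hyperplane (label_infiniteTree w ▸ this : Edge hC (pre w) e)
    · have := label_infiniteTree s
      exact ⟨s, this⟩
  ext A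
  constructor
  · rintro ⟨w | ⟨⟨⟩⟩, e, h1, h2, rfl⟩
    exact ⟨w, key w e h1 h2⟩
  · rintro ⟨w, rfl⟩
    obtain ⟨v, hv⟩ := represents_of_branch hC w (A := {y | infiniteTree.Lt y (.inl w)})
      fun u => infiniteTree_lt
    -- The transistors above or equal to `w` are those strictly above a child of `w`; the left child
    -- serves.
    obtain ⟨v', hv'⟩ := represents_of_branch hC (false :: w)
      (A := {y | infiniteTree.Lt y (.inl w) ∨ y = .inl w}) fun u => by
        have : (Sum.inl u : infiniteTree.Transistor) = .inl w ↔ u = w := Sum.inl_injective.eq_iff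
        rw [Set.mem_ofPred_eq, infiniteTree_lt, this, List.suffix_cons_iff]
        constructor
        · rintro (⟨h, -⟩ | rfl)
          · refine ⟨.inr h, fun e => ?_⟩
            have := h.length_le
            simp [e] at this
          · exact ⟨.inr List.suffix_rfl, fun e => by simpa using congrArg List.length e⟩
        · rintro ⟨rfl | h, hne⟩
          · exact absurd rfl hne
          · by_cases hu : u = w
            · exact .inr hu
            · exact .inl ⟨h, hu⟩
    exact ⟨.inl w, (v, v'), hv, hv', (key w (v, v') hv hv').symm⟩

/-! ### Half-spaces of words -/

theorem exists_mem_pieces_pre (hC : C.IsNice) (w : List Bool) : ∃ v : C.Vertex, pre w ∈ pieces v := by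
  obtain ⟨v, -, hv⟩ := exists_chain_of_mem_above hC (base_mem_above.2 ⟨w, rfl⟩ : C.base ∈ C.above _)
  exact ⟨v, hv⟩

theorem isPositive_half_pre (hC : C.IsNice) (w : List Bool) : C.IsPositive (C.half (pre w)) :=
  (isPositive_iff hC).2 ⟨_, exists_mem_pieces_pre hC w, rfl⟩

theorem half_pre_append (t w : List Bool) : C.half (pre (t ++ w)) ⊆ C.half (pre w) := by
  rw [half_of_isWord ⟨_, rfl⟩, half_of_isWord ⟨_, rfl⟩, Set.compl_subset_compl]
  rintro v ⟨f, hf, u, e⟩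
  exact ⟨f, hf, t ++ u, by rw [pre_append, ← Function.comp_assoc, e, ← pre_append]⟩

theorem half_pre_cons_ssubset (hC : C.IsNice) (b : Bool) (w : List Bool) :
    C.half (pre (b :: w)) ⊂ C.half (pre w) := by
  refine ⟨half_pre_append [b] w, fun h => ?_⟩
  obtain ⟨v, hv⟩ := exists_mem_pieces_pre (C := C) hC w
  obtain ⟨x, hx⟩ := exists_split hC hv
  rw [half_of_isWord ⟨_, rfl⟩, half_of_isWord ⟨_, rfl⟩] at h
  refine h hx.notMem_above (mem_above_of_mem ((mem_of_split hx).2 (.inr ?_)))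
  cases b
  · exact .inl rfl
  · exact .inr rfl

/-- Restricting a word of length `N` never shortens it. A deep flat vertex therefore lies in any
finite number of half-spaces of words. -/
theorem flat_mem_half {t : C.Vertex} {N : ℕ} (ht : ∀ k ∈ pieces t, IsWordOf N k) {w : List Bool}
    (hw : w.length < N) : t ∈ C.half (pre w) := by
  rw [half_of_isWord ⟨_, rfl⟩]
  rintro ⟨f, hf, u, e⟩
  have := IsWordOf.eq (ht f hf) (e ▸ ⟨w, rfl, rfl⟩ : IsWordOf w.length (f ∘ pre u))
  omega

/-- A flat vertex deeper than `w` lies in `half (pre w)`, but its pieces restrict to words only, so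
it avoids `half h` unless `h` is a word. -/
theorem isWord_of_half_subset (hC : C.IsNice) {w : List Bool} {h : Piece}
    (hs : C.half (pre w) ⊆ C.half h) : IsWord h := by
  by_contra hh
  obtain ⟨t, -, ht⟩ := exists_flat hC (w.length + 1)
  have := hs (flat_mem_half ht (Nat.lt_succ_self _))
  rw [half_of_not_isWord hh] at this
  obtain ⟨f, hf, u, rfl⟩ := this
  obtain ⟨w', -, rfl⟩ := ht f hf
  exact hh ⟨_, (pre_append _ _).symm⟩

/-- The test vertex has the piece `pre w`, while all other pieces are words longer than `w'`. It
lies outside `half (pre w)`, hence outside `half (pre w')`, so `w'` must be a restriction of `pre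
w`. -/
theorem exists_append_of_half_subset (hC : C.IsNice) {w w' : List Bool}
    (hs : C.half (pre w') ⊆ C.half (pre w)) : ∃ t, w' = t ++ w := by
  obtain ⟨v, hv⟩ := exists_mem_pieces_pre (C := C) hC w
  obtain ⟨N₀, hN₀⟩ := exists_chain_words hC (Set.singleton_subset_iff.2 hv)
  obtain ⟨x, -, hx, hxN⟩ := hN₀ _ (le_max_left N₀ (w'.length + 1))
  rw [half_of_isWord ⟨_, rfl⟩, half_of_isWord ⟨_, rfl⟩, Set.compl_subset_compl] at hs
  obtain ⟨f, hf, u, e⟩ := hs (mem_above_of_mem (hx rfl))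
  rcases hxN f hf with rfl | hfN
  · exact ⟨u, pre_inj (by rw [← e, pre_append])⟩
  · have := IsWordOf.eq hfN (e ▸ ⟨w', rfl, rfl⟩ : IsWordOf w'.length (f ∘ pre u))
    have := le_max_right N₀ (w'.length + 1)
    omega

theorem isProfile_words (hC : C.IsNice) : C.IsProfile {A | ∃ w, A = C.half (pre w)} where
  isPositive := by
    rintro A ⟨w, rfl⟩
    exact isPositive_half_pre hC w
  nonempty := ⟨_, [], rfl⟩
  inter_nonempty F hF hfin := by
    have : ∀ A : F, ∃ w, A.1 = C.half (pre w) := fun A => hF A.2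
    choose w hw using this
    have := hfin.to_subtype
    obtain ⟨N, hN⟩ := (Set.finite_range fun A => (w A).length).bddAbove
    obtain ⟨t, -, ht⟩ := exists_flat hC (N + 1)
    refine ⟨t, fun A hA => ?_⟩
    rw [show A = _ from hw ⟨A, hA⟩]
    exact flat_mem_half ht (Nat.lt_succ_of_le (hN ⟨⟨A, hA⟩, rfl⟩))
  exists_gt := by
    rintro A ⟨w, rfl⟩
    exact ⟨_, ⟨false :: w, rfl⟩, half_pre_cons_ssubset hC false w⟩
  mem_of_le := by
    rintro A ⟨w, rfl⟩ B hB hs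
    obtain ⟨h, -, rfl⟩ := (isPositive_iff hC).1 hB
    obtain ⟨u, rfl⟩ := isWord_of_half_subset hC hs
    exact ⟨u, rfl⟩

end PictureClass

end DiagramProfile

namespace DiagramProfile

open Picture

namespace PictureClass

variable {C : PictureClass}

/-! ### The action on half-spaces -/

/-- The element `g` of the diagram group acts on the labels of wires by composition with `γ`. -/
structure Induces (g : DiagramGroup C) (γ : Piece) : Prop where
  pieces_smul (v : C.Vertex) : pieces (g • v) = (γ ∘ ·) '' pieces v
  bijective : Function.Bijective γ
  tame : Tame γ

theorem outs_concat {n : ℕ} {G : Picture 1 1} {P : Picture 1 n} (hG : G.IsFinite)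
    (hP : P.IsFinite) : (G.concat P).outs = fun j => G.outs 0 ∘ P.outs j := by
  have : G.outs = fun _ => G.outs 0 ∘ id := funext fun i => by rw [Subsingleton.elim i 0]; rfl
  rw [outs, out_concat hG hP]
  change P.out G.outs = _
  rw [this, out_comp hP]
  rfl

theorem induces_mk {G : Picture 1 1} (hG : C.Mem G) :
    Induces (DiagramGroup.mk G hG) (G.outs 0) where
  pieces_smul v := by
    obtain ⟨n, P, hP, rfl⟩ := exists_rep v
    change Set.range (G.concat P).outs = _
    rw [outs_concat (C.isFinite hG) (C.isFinite hP), pieces_vertex]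
    exact Set.range_comp (fun f : Piece => G.outs 0 ∘ f) P.outs
  bijective := by
    have h := isPartition_outs (C.isFinite hG)
    refine ⟨h.piece_injective 0, fun c => ?_⟩
    obtain ⟨i, d, hd⟩ := h.exists_apply c
    rw [Subsingleton.elim i 0] at hd
    exact ⟨d, hd⟩
  tame := pieces_tame (v := C.vertex G hG) ⟨0, rfl⟩

theorem exists_induces (g : DiagramGroup C) : ∃ γ, Induces g γ := by
  obtain ⟨G, hG⟩ := g
  exact ⟨_, induces_mk hG⟩

namespace Induces

variable {g : DiagramGroup C} {γ : Piece}

theorem comp_injective (hg : Induces g γ) : Function.Injective fun f : Piece => γ ∘ f :=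
  hg.bijective.1.comp_left

theorem smul_mem_above_iff (hg : Induces g γ) {v : C.Vertex} {h : Piece} :
    g • v ∈ C.above (γ ∘ h) ↔ v ∈ C.above h := by
  constructor
  · rintro ⟨f, hf, u, e⟩
    rw [hg.pieces_smul] at hf
    obtain ⟨f, hf, rfl⟩ := hf
    exact ⟨f, hf, u, hg.comp_injective e⟩
  · rintro ⟨f, hf, u, rfl⟩
    exact ⟨γ ∘ f, by rw [hg.pieces_smul]; exact ⟨f, hf, rfl⟩, u, rfl⟩

theorem image_half (hg : Induces g γ) (h : Piece) :
    (g • ·) '' C.half h = {v | ¬ (v ∈ C.above (γ ∘ h) ↔ IsWord h)} := by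
  ext v
  constructor
  · rintro ⟨v, hv, rfl⟩
    exact fun e => hv (hg.smul_mem_above_iff.symm.trans e)
  · intro hv
    refine ⟨g⁻¹ • v, fun e => hv ?_, smul_inv_smul g v⟩
    rw [← e, ← hg.smul_mem_above_iff (v := g⁻¹ • v), smul_inv_smul]

theorem image_half_eq (hg : Induces g γ) {h : Piece} (hh : IsWord (γ ∘ h) ↔ IsWord h) :
    (g • ·) '' C.half h = C.half (γ ∘ h) := by
  rw [hg.image_half, ← hh]
  rfl

/-- If just one of `h` and `γ ∘ h` is a word, the translate contains the base vertex, which no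
positive half-space does. -/
theorem image_half_of_isPositive (hC : C.IsNice) (hg : Induces g γ) {h : Piece}
    (hp : C.IsPositive ((g • ·) '' C.half h)) : (IsWord (γ ∘ h) ↔ IsWord h) := by
  obtain ⟨k, -, hk⟩ := (isPositive_iff hC).1 hp
  by_contra hh
  have hb : C.base ∈ C.half k := by
    rw [← hk, hg.image_half]
    exact fun e => hh (base_mem_above.symm.trans e)
  exact hb base_mem_above

/-- The profile of the words is invariant. -/
theorem translate_words (hC : C.IsNice) (hg : Induces g γ) :
    C.translate g {A | ∃ w, A = C.half (pre w)} = {A | ∃ w, A = C.half (pre w)} := by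
  ext B
  constructor
  · rintro ⟨hB, A, ⟨w, rfl⟩, hp, hAB⟩
    have hw := hg.image_half_of_isPositive hC hp
    rw [hg.image_half_eq hw] at hAB
    obtain ⟨u, hu⟩ := hw.2 ⟨w, rfl⟩
    obtain ⟨k, -, rfl⟩ := (isPositive_iff hC).1 hB
    rw [hu] at hAB
    obtain ⟨t, rfl⟩ := isWord_of_half_subset hC hAB
    exact ⟨t, rfl⟩
  · rintro ⟨u, rfl⟩
    refine ⟨isPositive_half_pre hC u, ?_⟩
    have key : ∀ w w', γ ∘ pre w = pre w' → C.half (pre w') ⊆ C.half (pre u) →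
        ∃ A ∈ {A | ∃ w, A = C.half (pre w)}, C.IsPositive ((g • ·) '' A) ∧
          (g • ·) '' A ⊆ C.half (pre u) := by
      intro w w' h hs
      refine ⟨_, ⟨w, rfl⟩, ?_⟩
      rw [hg.image_half_eq (iff_of_true ⟨_, h⟩ ⟨_, rfl⟩), h]
      exact ⟨isPositive_half_pre hC w', hs⟩
    -- Choose a point that `γ` maps into the cone of `u`. A prefix `w` of length `n` is mapped to a
    -- word comparable with `u`; if that word is shorter than `u`, prolonging `w` reaches `u`
    -- exactly.
    obtain ⟨n, hn⟩ := hg.tame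
    obtain ⟨c, hc⟩ := hg.bijective.2 (pre u fun _ => true)
    obtain ⟨w, c', hw, rfl⟩ := exists_pre_eq n c
    obtain ⟨w', hw'⟩ := hn w hw.ge
    rw [show γ (pre w c') = (γ ∘ pre w) c' from rfl, hw'] at hc
    rcases comparable_of_pre_eq hc with ⟨t, rfl⟩ | ⟨t, rfl⟩
    · exact key w _ hw' (half_pre_append t u)
    · refine key (t ++ w) _ ?_ subset_rfl
      rw [pre_append, ← Function.comp_assoc, hw', ← pre_append]

end Induces

/-- The diagram group acts transitively on the wires of vertices of the same size. -/
theorem HasList.exists_induces {v v' : C.Vertex} {h k : Piece} {l l' : List Piece}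
    (hv : HasList v (h :: l)) (hv' : HasList v' (k :: l')) (hl : l.length = l'.length) :
    ∃ (g : DiagramGroup C) (γ : Piece), Induces g γ ∧ γ ∘ h = k := by
  obtain ⟨P, hP, -, rfl, -⟩ := hv.cons
  obtain ⟨P', hP', -, rfl, -⟩ := hv'.cons
  obtain ⟨n, hn⟩ : ∃ n, n = l.length + 1 := ⟨_, rfl⟩
  revert P P'
  rw [← hl]
  intro P hP _ P' hP' _
  -- The group element is `P'` followed by the mirror image of `P`; acting on `P`, it cancels to
  -- `P'` and so carries the bottom labels of `P` to those of `P'`.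
  have hM := C.concat hP' (C.mirror hP)
  refine ⟨_, _, induces_mk hM, ?_⟩
  have e : DipoleEq ((P'.concat P.mirror).concat P) P' :=
    (DipoleEq.of_iso (Iso.assoc _ _ _)).trans
      (((DipoleEq.refl _).concat (P.mirror_concat (C.isFinite hP))).trans
        (.of_iso (Iso.concatOne _)))
  rw [← e.outs_eq (C.isFinite (C.concat hM hP)), outs_concat (C.isFinite hM) (C.isFinite hP)]

theorem IsProfile.half_mem_of_translate_eq {𝓗 : Set (Set C.Vertex)} {g : DiagramGroup C}
    {γ : Piece} (hg : Induces g γ) (h𝓗 : C.translate g 𝓗 = 𝓗) {h : Piece}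
    (hh : C.half h ∈ 𝓗) (hw : IsWord (γ ∘ h) ↔ IsWord h)
    (hp : C.IsPositive (C.half (γ ∘ h))) : C.half (γ ∘ h) ∈ 𝓗 := by
  rw [← h𝓗]
  refine ⟨hp, _, hh, ?_⟩
  rw [hg.image_half_eq hw]
  exact ⟨hp, subset_rfl⟩

/-! ### Invariant profiles -/

theorem HasList.merge (hC : C.IsNice) {v : C.Vertex} {f : Piece} {l : List Piece}
    (h : HasList v (f.sub false :: f.sub true :: l)) : ∃ w : C.Vertex, HasList w (f :: l) := by
  obtain ⟨P, hP, rfl, -, h⟩ := h.cons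
  exact ⟨_, _, _, C.concat hP (hC.merge _), rfl, ofFn_merge (C.isFinite hP) h⟩

/-- The self-map of the Cantor set that maps the cones of `0`, `10`, `11` to those of `00`, `01`,
`1`. -/
def shift : Piece :=
  Piece.join ((Piece.sub id false).sub false)
    (Piece.join ((Piece.sub id false).sub true) (Piece.sub id true))

theorem shift_cons_false (c : Cantor) : shift (cons false c) = cons false (cons false c) := rfl

theorem shift_surjective : Function.Surjective shift := by
  intro c
  obtain ⟨b, c, rfl⟩ := exists_cons c
  cases b
  · obtain ⟨b, c, rfl⟩ := exists_cons c
    cases b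
    · exact ⟨cons false c, rfl⟩
    · exact ⟨cons true (cons false c), rfl⟩
  · exact ⟨cons true (cons true c), rfl⟩

theorem shift_ne_id : shift ≠ id := by
  intro h
  have := congrFun (congrFun h (cons false fun _ => true)) 1
  rw [shift_cons_false] at this
  simp at this

theorem shift_comp_shift_ne_id : shift ∘ shift ≠ id := by
  intro h
  have := congrFun (congrFun h (cons false fun _ => true)) 1
  rw [Function.comp_apply, shift_cons_false, shift_cons_false] at this
  simp at this

/-- The piece `h` is cut along the cones of `00`, `01`, `1`, and the parts are glued again in the
pattern `0`, `10`, `11`. The number of wires is restored, and only rotations are needed in between.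
-/
theorem HasList.shift (hC : C.IsNice) {v : C.Vertex} {h : Piece} {l : List Piece}
    (hv : HasList v (h :: l)) :
    ∃ w : C.Vertex, HasList w ((h ∘ PictureClass.shift) :: l) := by
  obtain ⟨v₁, h₁⟩ := exists_split hC (hv.mem_iff.1 List.mem_cons_self)
  have hv₁ := hv.split h₁
  obtain ⟨v₂, h₂⟩ := exists_split hC (hv₁.mem_iff.1 List.mem_cons_self)
  have hv₂ := hv₁.split h₂
  obtain ⟨v₃, hv₃⟩ := HasList.merge (f := Piece.sub (h ∘ PictureClass.shift) true)
    (l := l ++ [(h.sub false).sub false]) hC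
    (hv₂.rotate hC (l := [(h.sub false).sub false]))
  exact HasList.merge (f := h ∘ PictureClass.shift) hC
    (hv₃.rotate hC (l := _ :: l) (l' := [(h.sub false).sub false]))

/-- The half-spaces of a piece and of its composition with a self-map are disjoint. -/
theorem half_inter_half_comp {h σ : Piece} (hi : Function.Injective h)
    (hσ : Function.Surjective σ) (hne : σ ≠ id) (hh : ¬ IsWord h) (hk : ¬ IsWord (h ∘ σ)) :
    C.half h ∩ C.half (h ∘ σ) = ∅ := by
  rw [half_of_not_isWord hh, half_of_not_isWord hk]
  refine Set.eq_empty_of_forall_notMem ?_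
  rintro v ⟨⟨f, hf, u, e⟩, f', hf', u', e'⟩
  obtain ⟨rfl, -⟩ := pieces_eq_of_apply hf hf' (c := pre u (σ fun _ => true))
    (d := pre u' fun _ => true)
    ((congrFun e _).trans (congrFun e' fun _ => true).symm)
  -- As `σ` is onto, `h` and `h ∘ σ` have the same image. Hence they restrict one piece to one and
  -- the same cone and would be equal, contrary to `σ ≠ id`.
  have hr : Set.range (f ∘ pre u) = Set.range (f ∘ pre u') := by
    rw [e, e']
    exact (hσ.range_comp h).symm
  rw [Set.range_comp, Set.range_comp] at hr
  obtain rfl := eq_of_range_pre_eq ((Set.image_injective.2 (piece_injective hf)) hr)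
  exact hne (funext fun c => hi (congrFun (e'.symm.trans e) c))

theorem not_isWord_pre_comp {σ : Piece} (hσ : Function.Surjective σ) (hne : σ ≠ id)
    (w : List Bool) : ¬ IsWord (pre w ∘ σ) := by
  rintro ⟨u, hu⟩
  have : Set.range (pre u) = Set.range (pre w) := by rw [← hu, hσ.range_comp]
  obtain rfl := eq_of_range_pre_eq this
  exact hne (funext fun c => pre_injective _ (congrFun hu c))

/-- Invariance would put the half-space of some `h ∘ σ` with `σ ≠ id` into the profile, although it
is disjoint from that of `h`. -/
theorem IsProfile.isWord_of_half_mem (hC : C.IsNice) {𝓗 : Set (Set C.Vertex)}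
    (h𝓗 : C.IsProfile 𝓗) (hinv : ∀ g : DiagramGroup C, C.translate g 𝓗 = 𝓗) {h : Piece}
    {v : C.Vertex} (hv : h ∈ pieces v) (hh : C.half h ∈ 𝓗) : IsWord h := by
  by_contra hw
  obtain ⟨l, hl⟩ := exists_hasList_cons hC hv
  have key : ∀ {σ : Piece} {w : C.Vertex}, Function.Surjective σ → σ ≠ id →
      HasList w ((h ∘ σ) :: l) → ¬ IsWord (h ∘ σ) → False := by
    intro σ w hσ hne hlw hk
    obtain ⟨g, γ, hg, e⟩ := hl.exists_induces hlw rfl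
    have hmem := IsProfile.half_mem_of_translate_eq hg (hinv g) hh
      (by rw [e]; exact iff_of_false hk hw)
      ((isPositive_iff hC).2 ⟨_, ⟨w, by rw [e]; exact hlw.mem_iff.1 List.mem_cons_self⟩, rfl⟩)
    rw [e] at hmem
    have := h𝓗.inter_nonempty {C.half h, C.half (h ∘ σ)}
      (Set.insert_subset hh (Set.singleton_subset_iff.2 hmem)) (Set.toFinite _)
    rw [Set.sInter_pair, half_inter_half_comp (piece_injective hv) hσ hne hw hk] at this
    exact Set.not_nonempty_empty this
  obtain ⟨w, hlw⟩ := hl.shift hC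
  -- Translates stay positive only between labels of the same kind. If `h ∘ shift` happens to be a
  -- word, one more shift produces a non-word again.
  by_cases hs : IsWord (h ∘ PictureClass.shift)
  · obtain ⟨w', hlw'⟩ := hlw.shift hC
    refine key (shift_surjective.comp shift_surjective) shift_comp_shift_ne_id hlw' ?_
    obtain ⟨u, hu⟩ := hs
    rw [← Function.comp_assoc, hu]
    exact not_isWord_pre_comp shift_surjective shift_ne_id u
  · exact key shift_surjective shift_ne_id hlw hs

/-- A strictly larger member of the profile belongs to a proper extension of `w`; downward closure
then supplies the extension by exactly one letter. -/
theorem IsProfile.exists_length (hC : C.IsNice) {𝓗 : Set (Set C.Vertex)}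
    (h𝓗 : C.IsProfile 𝓗) (hw : ∀ A ∈ 𝓗, ∃ w, A = C.half (pre w)) (n : ℕ) :
    ∃ w : List Bool, w.length = n ∧ C.half (pre w) ∈ 𝓗 := by
  induction n with
  | zero =>
    obtain ⟨A, hA⟩ := h𝓗.nonempty
    obtain ⟨w, rfl⟩ := hw A hA
    exact ⟨[], rfl, h𝓗.mem_of_le _ hA _ (isPositive_half_pre hC [])
      (by simpa using half_pre_append (C := C) w [])⟩
  | succ n ih =>
    obtain ⟨w, hn, hA⟩ := ih
    obtain ⟨B, hB, hlt⟩ := h𝓗.exists_gt _ hA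
    obtain ⟨w', rfl⟩ := hw B hB
    obtain ⟨t, rfl⟩ := exists_append_of_half_subset hC hlt.subset
    rcases List.eq_nil_or_concat t with rfl | ⟨t, b, rfl⟩
    · exact absurd rfl hlt.ne
    · refine ⟨b :: w, by simp [hn], h𝓗.mem_of_le _ hB _ (isPositive_half_pre hC _) ?_⟩
      simpa using half_pre_append (C := C) t (b :: w)

theorem IsWordOf.mem_pieces {t : C.Vertex} {N : ℕ} (ht : ∀ k ∈ pieces t, IsWordOf N k)
    {w : List Bool} (hw : w.length = N) : pre w ∈ pieces t := by
  obtain ⟨f, hf, d, hd⟩ := exists_piece t (pre w fun _ => true)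
  obtain ⟨u, hu, rfl⟩ := ht f hf
  have : u = w := by
    rcases comparable_of_pre_eq hd with ⟨s, rfl⟩ | ⟨s, rfl⟩ <;>
    · rw [List.length_append] at *
      obtain rfl : s = [] := List.eq_nil_of_length_eq_zero (by omega)
      rfl
  exact this ▸ hf

theorem IsProfile.eq_words (hC : C.IsNice) {𝓗 : Set (Set C.Vertex)} (h𝓗 : C.IsProfile 𝓗)
    (hinv : ∀ g : DiagramGroup C, C.translate g 𝓗 = 𝓗) :
    𝓗 = {A | ∃ w, A = C.half (pre w)} := by
  have hw : ∀ A ∈ 𝓗, ∃ w, A = C.half (pre w) := by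
    intro A hA
    obtain ⟨h, ⟨v, hv⟩, rfl⟩ := (isPositive_iff hC).1 (h𝓗.isPositive A hA)
    obtain ⟨w, rfl⟩ := h𝓗.isWord_of_half_mem hC hinv hv hA
    exact ⟨w, rfl⟩
  refine Set.Subset.antisymm hw ?_
  rintro A ⟨u, rfl⟩
  obtain ⟨w, hwu, hmem⟩ := h𝓗.exists_length hC hw u.length
  -- Both `pre w` and `pre u` are pieces of the flat vertex at this level, so some group element
  -- carries one to the other.
  obtain ⟨t, -, ht⟩ := exists_flat hC u.length
  obtain ⟨l, hl⟩ := exists_hasList_cons hC (IsWordOf.mem_pieces ht hwu)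
  obtain ⟨l', hl'⟩ := exists_hasList_cons hC (IsWordOf.mem_pieces ht rfl)
  have hperm : (pre w :: l).Perm (pre u :: l') :=
    (List.perm_ext_iff_of_nodup hl.nodup hl'.nodup).2 fun f => hl.mem_iff.trans hl'.mem_iff.symm
  obtain ⟨g, γ, hg, e⟩ := hl.exists_induces hl' (by simpa using hperm.length_eq)
  have := IsProfile.half_mem_of_translate_eq hg (hinv g) hmem
    (by rw [e]; exact iff_of_true ⟨_, rfl⟩ ⟨_, rfl⟩) (by rw [e]; exact isPositive_half_pre hC u)
  rwa [e] at this

/-- The profile of the infinite tree is the only invariant profile. -/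
theorem invariant_profiles_eq (hC : C.IsNice) :
    {𝓗 : Set (Set C.Vertex) | C.IsProfile 𝓗 ∧ ∀ g : DiagramGroup C, C.translate g 𝓗 = 𝓗} =
      {C.treeProfile} := by
  rw [treeProfile_eq hC]
  refine Set.Subset.antisymm (fun 𝓗 h => h.1.eq_words hC h.2) ?_
  rintro _ rfl
  refine ⟨isProfile_words hC, fun g => ?_⟩
  obtain ⟨γ, hg⟩ := exists_induces g
  exact hg.translate_words hC

end PictureClass

end DiagramProfile

theorem theorem5p2 :
    {𝓗 : Set (Set DiagramProfile.annular.Vertex) | DiagramProfile.annular.IsProfile 𝓗 ∧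
        ∀ g : DiagramProfile.ThompsonT, DiagramProfile.annular.translate g 𝓗 = 𝓗} =
      {DiagramProfile.annular.treeProfile} ∧
    {𝓗 : Set (Set DiagramProfile.braided.Vertex) | DiagramProfile.braided.IsProfile 𝓗 ∧
        ∀ g : DiagramProfile.ThompsonV, DiagramProfile.braided.translate g 𝓗 = 𝓗} =
      {DiagramProfile.braided.treeProfile} := by
  exact ⟨DiagramProfile.PictureClass.invariant_profiles_eq DiagramProfile.annular_isNice,
    DiagramProfile.PictureClass.invariant_profiles_eq DiagramProfile.braided_isNice⟩
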